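/- Let $M$ be a smooth (Hausdorff) manifold of dimension $2m+1$ with a strictly pseudoconvex CR structure $(H,J)$, where $H\subset TM$ has rank $2m$ and $J:H\to H$, $J^2=-1$, is integrable, that is, $H^{1,0}=\{X-iJX : X\in H\}$ is closed under brackets of sections. Let $\theta$ be a $1$-form with $H=\ker\theta$ and positive definite Levi form $L_\theta(X,Y)=d\theta(X,JY)$ on $H$, where $d\theta(X,Y)=\tfrac12\big(X\theta(Y)-Y\theta(X)-\theta([X,Y])\big)$. Let $\xi$ be the Reeb field ($\theta(\xi)=1$, $d\theta(\xi,\cdot)=0$), extend $J$ by $J\xi=0$, let $\pi_H:TM=\mathbb R\xi\oplus H\to H$ be the projection, and let $\langle X,Y\rangle=\theta(X)\theta(Y)+d\theta(\pi_HX,J\pi_HY)$ be the Webster metric. Let $\nabla$ be the Tanaka–Webster connection, i.e. the linear connection that preserves $H$, satisfies $\nabla\langle\cdot,\cdot\rangle=0$ and $\nabla J=0$, and whose torsion $T$ satisfies $T(X,Y)=2\,d\theta(X,Y)\,\xi$ and $T(\xi,JX)+J\,T(\xi,X)=0$ for $X,Y\in H$. Assume that $M$ is Sasakian, i.e. $T(\xi,\cdot)=0$.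 Put $R(X,Y)Z=\nabla_X\nabla_YZ-\nabla_Y\nabla_XZ-\nabla_{[X,Y]}Z$ and $\mathrm{Ric}(Y,Z)=\mathrm{trace}\{X\mapsto R(X,Z)Y\}$, and assume that for some constant $k_0>0$ $$\mathrm{Ric}(X,X)\ \ge\ (2m-1)\,k_0\,\langle X,X\rangle\qquad\text{for all } X\in H.$$ Let $\gamma:[a,b]\to M$ be a $\nabla$-geodesic ($\nabla_{\gamma'}\gamma'=0$) parametrized by arc length, so that $\langle\gamma',\xi\rangle$ is constant along $\gamma$, and assume that $\gamma$ is not vertical, i.e. $\langle\gamma',\xi\rangle^2<1$. If $$b-a\ \ge\ \frac{\pi}{\sqrt{k_0\,(1-\langle\gamma',\xi\rangle^2)}},$$ then $\gamma(a)$ has a conjugate point along $\gamma|_{(a,b]}$: there is $t\in(a,b]$ such that the differential of the exponential map $\exp^\nabla_{\gamma(a)}$ of $\nabla$ at $(t-a)\gamma'(a)$ is singular. Here $\exp^\nabla_p(v)=\gamma_v(1)$, where $\gamma_v$ is the $\nabla$-geodesic with $\gamma_v(0)=p$ and $\gamma_v'(0)=v$, defined for those $v\in T_pM$ for which $\gamma_v$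 exists on $[0,1]$. -/

import Mathlib

open Set Bundle FiberBundle
open scoped Manifold ContDiff

noncomputable section

namespace CRGeometry

variable {E : Type*} [NormedAddCommGroup E] [NormedSpace ℝ E] [FiniteDimensional ℝ E]
  {M : Type*} [TopologicalSpace M] [ChartedSpace E M] [IsManifold 𝓘(ℝ, E) ∞ M]

/-- The exterior derivative of a `1`-form, with the normalisation
`dη(X, Y) = ½ (X(η(Y)) - Y(η(X)) - η([X, Y]))`. The right-hand side is tensorial in `X` and `Y` for
a differentiable `η`, so at `x` it is computed on arbitrary local extensions of the two vectors. -/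
def extDerivOneForm (η : Π x : M, TangentSpace 𝓘(ℝ, E) x →L[ℝ] ℝ) (x : M)
    (u v : TangentSpace 𝓘(ℝ, E) x) : ℝ :=
  (1 / 2 : ℝ) *
    (mvfderiv 𝓘(ℝ, E) (fun y ↦ η y (extend E v y)) x u
      - mvfderiv 𝓘(ℝ, E) (fun y ↦ η y (extend E u y)) x v
      - η x (VectorField.mlieBracket 𝓘(ℝ, E) (extend E u) (extend E v) x))

variable (E M) in
/-- A strictly pseudoconvex CR structure `(H, J)` on `M` together with a pseudo-Hermitian structure
`θ` whose Levi form is positive definite. The horizontal distribution is `H = ker θ`; the Reeb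
field `ξ` is the vector field determined by `θ(ξ) = 1`, `dθ(ξ, ·) = 0`, and the complex structure
of `H` is extended to `TM` by `J ξ = 0`. -/
structure PseudoHermitian where
  /-- The contact form. -/
  θ : Π x : M, TangentSpace 𝓘(ℝ, E) x →L[ℝ] ℝ
  /-- The complex structure of `H = ker θ`, extended to `TM`. -/
  J : Π x : M, TangentSpace 𝓘(ℝ, E) x →L[ℝ] TangentSpace 𝓘(ℝ, E) x
  /-- The Reeb vector field. -/
  ξ : Π x : M, TangentSpace 𝓘(ℝ, E) x
  contMDiff_θ : ContMDiff 𝓘(ℝ, E) (𝓘(ℝ, E).prod 𝓘(ℝ, E →L[ℝ] ℝ)) ∞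
    (fun x ↦ (⟨x, θ x⟩ : TotalSpace (E →L[ℝ] ℝ)
      (fun x ↦ TangentSpace 𝓘(ℝ, E) x →L[ℝ] Bundle.Trivial M ℝ x)))
  contMDiff_J : ContMDiff 𝓘(ℝ, E) (𝓘(ℝ, E).prod 𝓘(ℝ, E →L[ℝ] E)) ∞
    (fun x ↦ (⟨x, J x⟩ : TotalSpace (E →L[ℝ] E)
      (fun x : M ↦ TangentSpace 𝓘(ℝ, E) x →L[ℝ] TangentSpace 𝓘(ℝ, E) x)))
  contMDiff_ξ : ContMDiff 𝓘(ℝ, E) (𝓘(ℝ, E).prod 𝓘(ℝ, E)) ∞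
    (fun x ↦ (⟨x, ξ x⟩ : TangentBundle 𝓘(ℝ, E) M))
  θ_ξ : ∀ x, θ x (ξ x) = 1
  extDeriv_ξ : ∀ x v, extDerivOneForm θ x (ξ x) v = 0
  J_ξ : ∀ x, J x (ξ x) = 0
  θ_J : ∀ x v, θ x v = 0 → θ x (J x v) = 0
  J_J : ∀ x v, θ x v = 0 → J x (J x v) = -v
  /-- Integrability, `[Γ(H^{1,0}), Γ(H^{1,0})] ⊆ Γ(H^{1,0})` with
  `H^{1,0} = {X - i J X | X ∈ H}`, written in terms of real and imaginary parts. -/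
  integrable : ∀ (X Y : Π x : M, TangentSpace 𝓘(ℝ, E) x) (x : M),
    (∀ y, θ y (X y) = 0) → (∀ y, θ y (Y y) = 0) →
    MDifferentiableAt 𝓘(ℝ, E) (𝓘(ℝ, E).prod 𝓘(ℝ, E))
      (fun y ↦ (⟨y, X y⟩ : TangentBundle 𝓘(ℝ, E) M)) x →
    MDifferentiableAt 𝓘(ℝ, E) (𝓘(ℝ, E).prod 𝓘(ℝ, E))
      (fun y ↦ (⟨y, Y y⟩ : TangentBundle 𝓘(ℝ, E) M)) x →
    θ x (VectorField.mlieBracket 𝓘(ℝ, E) X Y x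
      - VectorField.mlieBracket 𝓘(ℝ, E) (fun y ↦ J y (X y)) (fun y ↦ J y (Y y)) x) = 0 ∧
    VectorField.mlieBracket 𝓘(ℝ, E) (fun y ↦ J y (X y)) Y x
      + VectorField.mlieBracket 𝓘(ℝ, E) X (fun y ↦ J y (Y y)) x
      = J x (VectorField.mlieBracket 𝓘(ℝ, E) X Y x
        - VectorField.mlieBracket 𝓘(ℝ, E) (fun y ↦ J y (X y)) (fun y ↦ J y (Y y)) x)
  /-- The Levi form `L_θ(X, Y) = dθ(X, J Y)` is positive definite on `H`. -/
  levi_pos : ∀ x v, θ x v = 0 → v ≠ 0 → 0 < extDerivOneForm θ x v (J x v)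

namespace PseudoHermitian

variable (S : PseudoHermitian E M)

/-- The projection of `TM = ℝ ξ ⊕ H` onto `H`. -/
def proj (x : M) (v : TangentSpace 𝓘(ℝ, E) x) : TangentSpace 𝓘(ℝ, E) x :=
  v - S.θ x v • S.ξ x

/-- The Webster metric `g_θ(X, Y) = θ(X) θ(Y) + dθ(π_H X, J π_H Y)`. -/
def metric (x : M) (u v : TangentSpace 𝓘(ℝ, E) x) : ℝ :=
  S.θ x u * S.θ x v + extDerivOneForm S.θ x (S.proj x u) (S.J x (S.proj x v))

/-- `D` is the Tanaka-Webster connection: the smooth linear connection that preserves `H`, `g_θ` and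
`J` and has pure torsion. (`D Y x v` is `∇_v Y` at `x`. The factor `2` matches the factor `½` in
the exterior derivative: both sides of `torsion_horizontal` have `ξ`-component `-θ([X, Y])`.) -/
structure IsTanakaWebster
    (D : CovariantDerivative 𝓘(ℝ, E) E (TangentSpace 𝓘(ℝ, E) : M → Type _)) : Prop where
  smooth : CovariantDerivative.ContMDiffCovariantDerivative D ∞
  horizontal : ∀ (Y : Π x : M, TangentSpace 𝓘(ℝ, E) x) (x : M),
    (∀ y, S.θ y (Y y) = 0) →
    MDifferentiableAt 𝓘(ℝ, E) (𝓘(ℝ, E).prod 𝓘(ℝ, E))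
      (fun y ↦ (⟨y, Y y⟩ : TangentBundle 𝓘(ℝ, E) M)) x →
    ∀ v : TangentSpace 𝓘(ℝ, E) x, S.θ x (D Y x v) = 0
  metric_parallel : ∀ (Y Z : Π x : M, TangentSpace 𝓘(ℝ, E) x) (x : M),
    MDifferentiableAt 𝓘(ℝ, E) (𝓘(ℝ, E).prod 𝓘(ℝ, E))
      (fun y ↦ (⟨y, Y y⟩ : TangentBundle 𝓘(ℝ, E) M)) x →
    MDifferentiableAt 𝓘(ℝ, E) (𝓘(ℝ, E).prod 𝓘(ℝ, E))
      (fun y ↦ (⟨y, Z y⟩ : TangentBundle 𝓘(ℝ, E) M)) x →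
    ∀ v : TangentSpace 𝓘(ℝ, E) x,
      mvfderiv 𝓘(ℝ, E) (fun y ↦ S.metric y (Y y) (Z y)) x v
        = S.metric x (D Y x v) (Z x) + S.metric x (Y x) (D Z x v)
  J_parallel : ∀ (Y : Π x : M, TangentSpace 𝓘(ℝ, E) x) (x : M),
    MDifferentiableAt 𝓘(ℝ, E) (𝓘(ℝ, E).prod 𝓘(ℝ, E))
      (fun y ↦ (⟨y, Y y⟩ : TangentBundle 𝓘(ℝ, E) M)) x →
    ∀ v : TangentSpace 𝓘(ℝ, E) x, D (fun y ↦ S.J y (Y y)) x v = S.J x (D Y x v)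
  torsion_horizontal : ∀ (x : M) (u v : TangentSpace 𝓘(ℝ, E) x),
    S.θ x u = 0 → S.θ x v = 0 →
    D.torsion x u v = (2 * extDerivOneForm S.θ x u v) • S.ξ x
  torsion_reeb : ∀ (x : M) (u : TangentSpace 𝓘(ℝ, E) x), S.θ x u = 0 →
    D.torsion x (S.ξ x) (S.J x u) + S.J x (D.torsion x (S.ξ x) u) = 0

/-- A pseudo-Hermitian manifold with Tanaka-Webster connection `D` is Sasakian if its
pseudo-Hermitian torsion `τ(X) = T(ξ, X)` vanishes. -/
def IsSasakian
    (D : CovariantDerivative 𝓘(ℝ, E) E (TangentSpace 𝓘(ℝ, E) : M → Type _)) : Prop :=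
  ∀ (x : M) (v : TangentSpace 𝓘(ℝ, E) x), D.torsion x (S.ξ x) v = 0

end PseudoHermitian

section Connection

variable (D : CovariantDerivative 𝓘(ℝ, E) E (TangentSpace 𝓘(ℝ, E) : M → Type _))

/-- The curvature `R(X, Y) Z = ∇_X ∇_Y Z - ∇_Y ∇_X Z - ∇_{[X, Y]} Z` at `x`, computed on local
extensions of the three vectors, smooth near `x` (it is tensorial for a smooth connection). -/
def curvature (x : M) (u v w : TangentSpace 𝓘(ℝ, E) x) : TangentSpace 𝓘(ℝ, E) x :=
  D (fun y ↦ D (extend E w) y (extend E v y)) x u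
    - D (fun y ↦ D (extend E w) y (extend E u y)) x v
    - D (extend E w) x (VectorField.mlieBracket 𝓘(ℝ, E) (extend E u) (extend E v) x)

/-- The Ricci tensor `Ric(Y, Z) = trace (X ↦ R(X, Z) Y)`, the trace being taken in a basis
of `T_xM`, which is the model space `E`. -/
def ricci (x : M) (v w : TangentSpace 𝓘(ℝ, E) x) : ℝ :=
  ∑ i, (Module.finBasis ℝ E).repr (curvature D x (Module.finBasis ℝ E i) w v) i

variable (E) in
/-- The velocity at time `t` of a curve defined on the set `s` of times (one-sided at the end
points of an interval). -/
def velocity (γ : ℝ → M) (s : Set ℝ) (t : ℝ) : TangentSpace 𝓘(ℝ, E) (γ t) :=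
  mfderivWithin 𝓘(ℝ, ℝ) 𝓘(ℝ, E) γ s t (1 : ℝ)

/-- The vector field `V` along `γ` has covariant derivative `W` at time `t`. If `e_i` is the
coordinate frame of the chart at `γ t` and `V = ∑ Vⁱ e_i`, this is the formula
`∇_{γ'} V = ∑ (Vⁱ)' e_i + ∇_{γ'} (∑ Vⁱ(t) e_i)`. -/
def HasCovDerivAlong (γ : ℝ → M) (s : Set ℝ) (V : Π t : ℝ, TangentSpace 𝓘(ℝ, E) (γ t))
    (t : ℝ) (W : TangentSpace 𝓘(ℝ, E) (γ t)) : Prop :=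
  ∃ V' : E,
    HasDerivWithinAt
      (fun r ↦ (trivializationAt E (TangentSpace 𝓘(ℝ, E) : M → Type _) (γ t)
        (⟨γ r, V r⟩ : TangentBundle 𝓘(ℝ, E) M)).2) V' s t ∧
    W = (trivializationAt E (TangentSpace 𝓘(ℝ, E) : M → Type _) (γ t)).symm (γ t) V'
      + D (extend E (V t)) (γ t) (velocity E γ s t)

/-- `γ` is a geodesic of the connection `D` on the set `s` of times. -/
def IsGeodesicOn (γ : ℝ → M) (s : Set ℝ) : Prop :=
  ContMDiffOn 𝓘(ℝ, ℝ) 𝓘(ℝ, E) 1 γ s ∧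
    ∀ t ∈ s, HasCovDerivAlong D γ s (velocity E γ s) t 0

open Classical in
/-- The exponential map at `p`: `exp_p v = γ_v(1)`, where `γ_v : [0, 1] → M` is the geodesic with
`γ_v(0) = p` and `γ_v'(0) = v`. Its argument is a vector of `T_pM`, which is the model space `E`.
The value `p` is used where there is no such geodesic. -/
def expMap (p : M) (v : E) : M :=
  if h : ∃ c : ℝ → M, IsGeodesicOn D c (Icc 0 1) ∧
      (⟨c 0, velocity E c (Icc 0 1) 0⟩ : TangentBundle 𝓘(ℝ, E) M) = ⟨p, v⟩
  then h.choose 1 else p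

/-- For a geodesic `γ` on `[a, b]`, the point `γ t` is conjugate to `γ a` along `γ`: the
exponential map at `γ a` is differentiable at `(t - a) γ'(a)`, with singular differential there. -/
def IsConjugateAlong (γ : ℝ → M) (a b t : ℝ) : Prop :=
  MDifferentiableAt 𝓘(ℝ, E) 𝓘(ℝ, E) (expMap D (γ a)) ((t - a) • velocity E γ (Icc a b) a) ∧
    ¬ Function.Injective
      (mfderiv 𝓘(ℝ, E) 𝓘(ℝ, E) (expMap D (γ a)) ((t - a) • velocity E γ (Icc a b) a))

end Connection

end CRGeometry

end

/-! On a Sasakian manifold the torsion is T(X, Y) = -2⟨X, JY⟩ξ for all X and Y. The metric, J and ξ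
are parallel, so T is parallel, and T(T(X, Y), Z) = 0. The curvature therefore has the algebraic
symmetries of a Riemannian one: R(X, Y) is skew, the torsion terms drop out of the first Bianchi
identity, pair symmetry follows, and R(X, Y)ξ = 0 forces R(ξ, X) = 0. The Jacobi operator v ↦ R(v,
γ')γ' is symmetric, kills ξ and γ', and depends only on the horizontal part of γ'. With κ = ⟨γ', ξ⟩
its trace is Ric evaluated on γ' - κξ, hence at least (2m - 1)k₀(1 - κ²).

Because T is parallel, the linearised geodesic equation reads V' = W, W' = -R(V, γ')γ' + T(γ', W)
(`hasDerivWithinAt_linearised_spray`). Take a parallel orthonormal frame consisting of ξ, the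
normalised horizontal part of γ', and e₁, …, eₙ with n = 2m - 1. A field Σ αᵢeᵢ + fξ solves the
equation exactly when α'' + Sα = 0, where S is the matrix of the Jacobi operator on the eᵢ, and f''
= -2⟨γ', J Σ αᵢ'eᵢ⟩. The first system does not involve f, and tr S ≥ nk with k = k₀(1 - κ²). The
Bonnet-Myers argument applies to it: if A'' + SA = 0, A(a) = 0, A'(a) = 1, then U = A'A⁻¹ is
symmetric and u = tr U / n satisfies u' ≤ -k - u², so A becomes singular no later than a + π/√k
(`exists_det_eq_zero`). A kernel vector yields α vanishing at a and at some t₁.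

The vertical equation costs no length: its right-hand side is the derivative of φ = -2⟨γ', J Σ
αᵢeᵢ⟩, so f' = φ + const, and the constant can be chosen so that f also vanishes at a and at t₁
(`exists_jacobiField`).

Finally, a Jacobi field vanishing at a and t₁ with W(a) ≠ 0 puts (t₁ - a)W(a) in the kernel of the
differential of exp. Here the differentiability of exp has to be proved as well: the flow of a C¹
vector field is differentiable with derivative given by the linearised equation
(`exists_flow_hasFDerivAt`), and local flows of the geodesic spray are chained from chart to chart
along γ (`IsSprayCurve.exists_family`). -/

noncomputable section

set_option linter.unusedSectionVars false

namespace CRGeometry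

open Filter Topology

open Filter Metric Topology
open scoped NNReal

/-! ### Ordinary differential equations: linear systems, and differentiability of local flows. -/

section ODE

/-- Induction along a compact interval: a property that propagates forward locally near every point
of `[a, b]` propagates from `a` to all of `[a, b]`. -/
theorem Icc_step_induction {a b : ℝ} (P : ℝ → Prop) (h0 : P a)
    (hstep : ∀ t₀ ∈ Icc a b, ∃ ε > 0, ∀ s ∈ Icc a b, ∀ t ∈ Icc a b, |s - t₀| < ε → |t - t₀| < ε →
      s ≤ t → P s → P t) : ∀ t ∈ Icc a b, P t := by
  intro t ht
  have hab : a ≤ b := ht.1.trans ht.2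
  set S : Set ℝ := {t | t ∈ Icc a b ∧ ∀ r ∈ Icc a t, P r} with hS
  have haS : a ∈ S := ⟨left_mem_Icc.2 hab, fun r hr ↦ by
    rwa [le_antisymm hr.2 hr.1]⟩
  have hbdd : BddAbove S := ⟨b, fun x hx ↦ hx.1.2⟩
  set c := sSup S with hc
  have hac : a ≤ c := le_csSup hbdd haS
  have hcb : c ≤ b := csSup_le ⟨a, haS⟩ fun x hx ↦ hx.1.2
  -- The local step at the supremum c itself carries P from a point of S just below c past c, so c
  -- cannot lie below b.
  obtain ⟨ε, hε, h⟩ := hstep c ⟨hac, hcb⟩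
  obtain ⟨s, hsS, hs⟩ := exists_lt_of_lt_csSup ⟨a, haS⟩ (show c - ε < c by linarith)
  have hsc : s ≤ c := le_csSup hbdd hsS
  have key : ∀ r ∈ Icc a b, r < c + ε → P r := by
    intro r hr hrc
    rcases le_total r s with hrs | hrs
    · exact hsS.2 r ⟨hr.1, hrs⟩
    · exact h s hsS.1 r hr (by rw [abs_lt]; constructor <;> linarith)
        (by rw [abs_lt]; constructor <;> linarith) hrs (hsS.2 s ⟨hsS.1.1, le_rfl⟩)
  have hcb' : c = b := by
    by_contra hne
    have hlt : c < b := lt_of_le_of_ne hcb hne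
    set d := min b (c + ε / 2) with hd
    have hcd : c < d := lt_min hlt (by linarith)
    have hdS : d ∈ S := by
      refine ⟨⟨hac.trans hcd.le, min_le_left _ _⟩, fun r hr ↦ key r ⟨hr.1, hr.2.trans (min_le_left _ _)⟩ ?_⟩
      have : r ≤ c + ε / 2 := hr.2.trans (min_le_right _ _)
      linarith
    exact absurd (le_csSup hbdd hdS) (not_le.2 hcd)
  exact key t ht (by rw [hcb']; linarith [ht.2])

variable {G : Type*} [NormedAddCommGroup G] [NormedSpace ℝ G]

/-- Gluing two differentiable curves at a common end point. -/
theorem hasDerivWithinAt_glue {a s t : ℝ} {f g f' g' : ℝ → G}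
    (hf : ∀ r ∈ Icc a s, HasDerivWithinAt f (f' r) (Icc a s) r)
    (hg : ∀ r ∈ Icc s t, HasDerivWithinAt g (g' r) (Icc s t) r)
    (hfg : f s = g s) (hfg' : f' s = g' s) (has : a ≤ s) (hst : s ≤ t) :
    ∀ r ∈ Icc a t, HasDerivWithinAt (fun r ↦ if r ≤ s then f r else g r)
      (if r ≤ s then f' r else g' r) (Icc a t) r := by
  intro r hr
  set h : ℝ → G := fun r ↦ if r ≤ s then f r else g r
  have hhf : ∀ r ∈ Icc a s, h r = f r := fun r hr ↦ if_pos hr.2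
  have hhg : ∀ r ∈ Icc s t, h r = g r := fun r hr ↦ by
    rcases hr.1.eq_or_lt with rfl | hlt
    · simp [h, hfg]
    · exact if_neg (not_le.2 hlt)
  have hA : ∀ r ∈ Icc a s, HasDerivWithinAt h (f' r) (Icc a s) r := fun r hr ↦
    (hf r hr).congr hhf (hhf r hr)
  have hB : ∀ r ∈ Icc s t, HasDerivWithinAt h (g' r) (Icc s t) r := fun r hr ↦
    (hg r hr).congr hhg (hhg r hr)
  rw [← Icc_union_Icc_eq_Icc has hst]
  rcases lt_trichotomy r s with hrs | rfl | hrs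
  · rw [if_pos hrs.le]
    have h1 := hA r ⟨hr.1, hrs.le⟩
    refine h1.union ?_
    -- At a point off the closure of a set, differentiability within that set is vacuous, so only
    -- the interval containing r matters.
    have : ¬ r ∈ closure (Icc s t) := by
      rw [isClosed_Icc.closure_eq]; exact fun hh ↦ absurd hh.1 (not_le.2 hrs)
    exact HasFDerivWithinAt.of_notMem_closure this
  · rw [if_pos le_rfl]
    exact (hA r ⟨has, le_rfl⟩).union (hfg' ▸ hB r ⟨le_rfl, hst⟩)
  · rw [if_neg (not_le.2 hrs)]
    refine HasDerivWithinAt.union ?_ (hB r ⟨hrs.le, hr.2⟩)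
    have : ¬ r ∈ closure (Icc a s) := by
      rw [isClosed_Icc.closure_eq]; exact fun hh ↦ absurd hh.2 (not_le.2 hrs)
    exact HasFDerivWithinAt.of_notMem_closure this

/-- Global existence for linear differential equations on a compact interval. -/
theorem exists_linearODE_solution [CompleteSpace G] {a b : ℝ} (hab : a ≤ b) {B : ℝ → G →L[ℝ] G}
    (hB : ContinuousOn B (Icc a b)) (y₀ : G) :
    ∃ y : ℝ → G, y a = y₀ ∧ ∀ r ∈ Icc a b, HasDerivWithinAt y (B r (y r)) (Icc a b) r := by
  obtain ⟨C, hC⟩ := isCompact_Icc.exists_bound_of_continuousOn hB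
  have hC0 : 0 ≤ C := (norm_nonneg _).trans (hC a (left_mem_Icc.2 hab))
  refine Icc_step_induction (a := a) (b := b)
    (fun t ↦ ∃ y : ℝ → G, y a = y₀ ∧ ∀ r ∈ Icc a t, HasDerivWithinAt y (B r (y r)) (Icc a t) r)
    ⟨fun _ ↦ y₀, rfl, fun r hr ↦ ?_⟩ ?_ b (right_mem_Icc.2 hab)
  · have : Icc a a = {r} := by rw [Icc_self, le_antisymm hr.2 hr.1]
    rw [this]
    exact HasFDerivWithinAt.of_subsingleton (subsingleton_singleton)
  intro t₀ _
  -- Two times this close to t₀ satisfy C(t - s) ≤ 1/2. On the ball of radius ‖y s‖ + 1 about y s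
  -- the field is bounded by C(2‖y s‖ + 1), so a solution moves by at most ‖y s‖ + 1/2 and stays in
  -- the ball.
  refine ⟨1 / (4 * (C + 1)), by positivity, ?_⟩
  rintro s hs t ht hst0 htt0 hst ⟨y, hya, hy⟩
  have hts : C * (t - s) ≤ 1 / 2 := by
    have h1 : t - s ≤ 1 / (2 * (C + 1)) := by
      have e : 1 / (2 * (C + 1)) = 1 / (4 * (C + 1)) + 1 / (4 * (C + 1)) := by field_simp; norm_num
      rw [abs_lt] at hst0 htt0
      rw [e]; linarith [hst0.1, htt0.2]
    calc C * (t - s) ≤ (C + 1) * (1 / (2 * (C + 1))) := by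
          apply mul_le_mul _ h1 (by linarith) (by positivity); linarith
      _ = 1 / 2 := by field_simp
  have hsub : Icc s t ⊆ Icc a b := Icc_subset_Icc hs.1 ht.2
  set N : ℝ≥0 := ‖y s‖₊ with hN
  obtain ⟨Cn, hCn⟩ : ∃ Cn : ℝ≥0, (Cn : ℝ) = C := ⟨⟨C, hC0⟩, rfl⟩
  have hcoe : ((Cn * (2 * N + 1) : ℝ≥0) : ℝ) = C * (2 * ‖y s‖ + 1) := by
    push_cast; rw [hCn, hN, coe_nnnorm]
  have hPL : IsPicardLindelof (fun r y ↦ B r y) (tmin := s) (tmax := t) ⟨s, le_rfl, hst⟩ (y s)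
      (N + 1) 0 (Cn * (2 * N + 1)) Cn := by
    refine ⟨fun r hr ↦ ?_, fun x _ ↦ ?_, fun r hr x hx ↦ ?_, ?_⟩
    · refine LipschitzWith.lipschitzOnWith (LipschitzWith.weaken (B r).lipschitz ?_)
      rw [← NNReal.coe_le_coe, hCn]
      exact hC r (hsub hr)
    · exact (hB.mono hsub).clm_apply continuousOn_const
    · have hx' : ‖x‖ ≤ 2 * ‖y s‖ + 1 := by
        have : ‖x - y s‖ ≤ ‖y s‖ + 1 := by simpa [hN, dist_eq_norm] using hx
        calc ‖x‖ = ‖(x - y s) + y s‖ := by simp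
          _ ≤ ‖x - y s‖ + ‖y s‖ := norm_add_le _ _
          _ ≤ _ := by linarith
      calc ‖B r x‖ ≤ ‖B r‖ * ‖x‖ := (B r).le_opNorm x
        _ ≤ C * (2 * ‖y s‖ + 1) := mul_le_mul (hC r (hsub hr)) hx' (norm_nonneg _) hC0
        _ = _ := hcoe.symm
    · have hmax : max (t - s) (s - s) = t - s := by simp [hst]
      simp only [hmax, NNReal.coe_add, NNReal.coe_one, hN, coe_nnnorm, NNReal.coe_zero, sub_zero]
      rw [hcoe]
      nlinarith [norm_nonneg (y s), hts]
  obtain ⟨z, hzs, hz⟩ := hPL.exists_eq_forall_mem_Icc_hasDerivWithinAt₀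
  refine ⟨fun r ↦ if r ≤ s then y r else z r, by simp [hs.1, hya], fun r hr ↦ ?_⟩
  have := hasDerivWithinAt_glue (f' := fun r ↦ B r (y r)) (g' := fun r ↦ B r (z r)) hy hz
    hzs.symm (by simp [hzs]) hs.1 hst r hr
  convert this using 1
  beta_reduce
  split_ifs <;> rfl

theorem linearODE_unique {a b : ℝ} {B : ℝ → G →L[ℝ] G}
    (hB : ContinuousOn B (Icc a b)) {y z : ℝ → G} (h0 : y a = z a)
    (hy : ∀ r ∈ Icc a b, HasDerivWithinAt y (B r (y r)) (Icc a b) r)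
    (hz : ∀ r ∈ Icc a b, HasDerivWithinAt z (B r (z r)) (Icc a b) r) :
    ∀ r ∈ Icc a b, y r = z r := by
  obtain ⟨C, hC⟩ := isCompact_Icc.exists_bound_of_continuousOn hB
  have := eq_zero_of_abs_deriv_le_mul_abs_self_of_eq_zero_right (f := fun r ↦ y r - z r)
    (f' := fun r ↦ B r (y r) - B r (z r)) (K := C) (a := a) (b := b)
    (fun r hr ↦ ((hy r hr).sub (hz r hr)).continuousWithinAt)
    (fun r hr ↦ ((hy r (Ico_subset_Icc_self hr)).sub (hz r (Ico_subset_Icc_self hr))).mono_of_mem_nhdsWithin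
      (Icc_mem_nhdsGE_of_mem hr))
    (by simp [h0]) (fun r hr ↦ by
      rw [← map_sub]
      exact (B r).le_of_opNorm_le (hC r (Ico_subset_Icc_self hr)) _)
  exact fun r hr ↦ sub_eq_zero.1 (this r hr)

open ODE in
/-- The local flow of an autonomous Picard-Lindelöf equation, with values in the ball. -/
theorem exists_flow_mem_closedBall [CompleteSpace G] {f : ℝ → G → G} {tmin tmax : ℝ}
    {t₀ : Icc tmin tmax} {x₀ : G} {a r L K : ℝ≥0}
    (hf : IsPicardLindelof f t₀ x₀ a r L K) :
    ∃ α : G → ℝ → G, (∀ x ∈ closedBall x₀ r, α x t₀ = x ∧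
      ∀ t ∈ Icc tmin tmax, α x t ∈ closedBall x₀ a ∧
        HasDerivWithinAt (α x) (f t (α x t)) (Icc tmin tmax) t) ∧
      ∃ L' : ℝ≥0, ∀ t ∈ Icc tmin tmax, LipschitzOnWith L' (α · t) (closedBall x₀ r) := by
  classical
  have (x) (hx : x ∈ closedBall x₀ r) := FunSpace.exists_isFixedPt_next hf hx
  choose α hα using this
  set α' := fun (x : G) ↦ if hx : x ∈ closedBall x₀ r then
    α x hx |>.compProj else 0 with hα'
  refine ⟨α', fun x hx ↦ ⟨?_, fun t ht ↦ ⟨?_, ?_⟩⟩, ?_⟩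
  · rw [hα']
    beta_reduce
    rw [dif_pos hx, FunSpace.compProj_val, ← hα, FunSpace.next_apply₀]
  · rw [hα']
    beta_reduce
    rw [dif_pos hx]
    exact (α x hx).compProj_mem_closedBall hf.mul_max_le
  · rw [hα']
    beta_reduce
    rw [dif_pos hx, FunSpace.compProj_apply]
    apply hasDerivWithinAt_picard_Icc t₀.2 hf.continuousOn_uncurry
      (α x hx |>.continuous_compProj.continuousOn)
      (fun _ ht' ↦ α x hx |>.compProj_mem_closedBall hf.mul_max_le)
      x ht |>.congr_of_mem _ ht
    intro t' ht'
    nth_rw 1 [← hα]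
    rw [FunSpace.compProj_of_mem ht', FunSpace.next_apply]
  · obtain ⟨L', h⟩ := FunSpace.exists_forall_closedBall_funSpace_dist_le_mul hf
    refine ⟨L', fun t ht ↦ LipschitzOnWith.of_dist_le_mul fun x hx y hy ↦ ?_⟩
    simp_rw [hα']
    rw [dif_pos hx, dif_pos hy, FunSpace.compProj_apply, FunSpace.compProj_apply,
      ← FunSpace.toContinuousMap_apply_eq_apply, ← FunSpace.toContinuousMap_apply_eq_apply]
    have : Nonempty (Icc tmin tmax) := ⟨t₀⟩
    apply ContinuousMap.dist_le_iff_of_nonempty.mp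
    exact h x y hx hy (α x hx) (α y hy) (hα x hx) (hα y hy)

/-- Differentiability of the flow of a `C¹` vector field with respect to the initial point, the
derivative being given by the linearised equation. -/
theorem exists_flow_hasFDerivAt [FiniteDimensional ℝ G] {F : G → G} {Ω : Set G} (hΩ : IsOpen Ω)
    (hF : ContDiffOn ℝ 1 F Ω) {x₀ : G} (hx₀ : x₀ ∈ Ω) :
    ∃ ε > 0, ∃ r > 0, ∃ a > 0, ∃ Φ : G → ℝ → G, closedBall x₀ a ⊆ Ω ∧
      (∀ x ∈ ball x₀ r, Φ x 0 = x ∧ ∀ t ∈ Icc 0 ε, Φ x t ∈ closedBall x₀ a ∧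
        HasDerivWithinAt (Φ x) (F (Φ x t)) (Icc 0 ε) t) ∧
      (∀ (s t : ℝ) (z : ℝ → G), t - s ≤ ε → z s ∈ ball x₀ r →
        (∀ τ ∈ Icc s t, z τ ∈ closedBall x₀ a ∧ HasDerivWithinAt z (F (z τ)) (Icc s t) τ) →
        ∀ τ ∈ Icc s t, z τ = Φ (z s) (τ - s)) ∧
      (∀ x ∈ ball x₀ r, ∀ τ ∈ Icc 0 ε, ∃ A : G →L[ℝ] G, HasFDerivAt (Φ · τ) A x ∧
        ∀ η : ℝ → G, (∀ t ∈ Icc 0 τ,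
          HasDerivWithinAt η (fderiv ℝ F (Φ x t) (η t)) (Icc 0 τ) t) → A (η 0) = η τ) := by
  have hF0 : ContDiffAt ℝ 1 F x₀ := hF.contDiffAt (hΩ.mem_nhds hx₀)
  have : CompleteSpace G := FiniteDimensional.complete ℝ G
  have : ProperSpace G := FiniteDimensional.proper ℝ G
  obtain ⟨K, S, hS, hl⟩ := hF0.exists_lipschitzOnWith
  obtain ⟨a₀, ha₀, haS⟩ := Metric.mem_nhds_iff.mp (Filter.inter_mem hS (hΩ.mem_nhds hx₀))
  obtain ⟨a, ha, ha'⟩ : ∃ a : ℝ≥0, 0 < a ∧ (a : ℝ) < a₀ :=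
    ⟨⟨a₀ / 2, by positivity⟩, NNReal.coe_pos.1 (half_pos ha₀), half_lt_self ha₀⟩
  have hcl : closedBall x₀ (a : ℝ) ⊆ ball x₀ a₀ := closedBall_subset_ball ha'
  have hlip : LipschitzOnWith K F (closedBall x₀ a) := hl.mono fun x hx ↦ (haS (hcl hx)).1
  have hcΩ : closedBall x₀ (a : ℝ) ⊆ Ω := fun x hx ↦ (haS (hcl hx)).2
  have hcont : ContinuousOn F (closedBall x₀ a) := hlip.continuousOn
  obtain ⟨L, hL⟩ := (isCompact_closedBall x₀ (a : ℝ)).exists_bound_of_continuousOn hcont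
  have hL0 : 0 ≤ L := (norm_nonneg _).trans (hL x₀ (mem_closedBall_self a.2))
  obtain ⟨Ln, hLn⟩ : ∃ Ln : ℝ≥0, (Ln : ℝ) = L := ⟨⟨L, hL0⟩, rfl⟩
  have ha0 : (0 : ℝ) < a := NNReal.coe_pos.2 ha
  -- At speed at most L, a solution starting in the ball of radius a/2 stays in the ball of radius a
  -- during time ε, since Lε ≤ a/2.
  set ε : ℝ := a / (2 * (L + 1)) with hε
  have hε0 : 0 < ε := by positivity
  have hPL : IsPicardLindelof (fun _ ↦ F) (tmin := 0) (tmax := ε) ⟨0, le_rfl, hε0.le⟩ x₀ a (a / 2)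
      Ln K := by
    refine IsPicardLindelof.of_time_independent (fun x hx ↦ (hL x hx).trans_eq hLn.symm) hlip ?_
    have hm : max (ε - 0) (0 - 0) = ε := by simp [hε0.le]
    simp only [hm, NNReal.coe_div, NNReal.coe_ofNat, hLn]
    have : L * ε ≤ (L + 1) * ε := by nlinarith
    have e : (L + 1) * ε = a / 2 := by rw [hε]; field_simp
    linarith
  obtain ⟨Φ, hΦ, L', hL'⟩ := exists_flow_mem_closedBall hPL
  have hball : ball x₀ ((a : ℝ) / 2) ⊆ closedBall x₀ ((a / 2 : ℝ≥0) : ℝ) := by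
    rw [NNReal.coe_div]; exact ball_subset_closedBall
  refine ⟨ε, hε0, a / 2, by positivity, a, ha0, Φ, hcΩ, fun x hx ↦ hΦ x (hball hx), ?_, ?_⟩
  · intro s t z hts hzs hz τ hτ
    have h2 := hΦ (z s) (hball hzs)
    have hmaps : ∀ r ∈ Icc s t, r - s ∈ Icc 0 ε := fun r hr ↦
      ⟨by linarith [hr.1], by linarith [hr.2]⟩
    have hder : ∀ r ∈ Icc s t, HasDerivWithinAt (fun r ↦ Φ (z s) (r - s))
        (F (Φ (z s) (r - s))) (Icc s t) r := fun r hr ↦ by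
      have := HasDerivWithinAt.scomp r (h2.2 _ (hmaps r hr)).2
        ((hasDerivAt_id r).sub_const s).hasDerivWithinAt hmaps
      simpa using! this
    refine ODE_solution_unique_of_mem_Icc_right (v := fun _ ↦ F) (s := fun _ ↦ closedBall x₀ a)
      (K := K) (fun _ _ ↦ hlip) (fun r hr ↦ (hz r hr).2.continuousWithinAt)
      (fun r hr ↦ (hz r (Ico_subset_Icc_self hr)).2.mono_of_mem_nhdsWithin
        (Icc_mem_nhdsGE_of_mem hr))
      (fun r hr ↦ (hz r (Ico_subset_Icc_self hr)).1)
      (fun r hr ↦ (hder r hr).continuousWithinAt)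
      (fun r hr ↦ (hder r (Ico_subset_Icc_self hr)).mono_of_mem_nhdsWithin
        (Icc_mem_nhdsGE_of_mem hr))
      (fun r hr ↦ (h2.2 _ (hmaps r (Ico_subset_Icc_self hr))).1) ?_ hτ
    simpa using h2.1.symm
  · intro x hx τ hτ
    have hx2 := hΦ x (hball hx)
    have hdF : ContinuousOn (fderiv ℝ F) (closedBall x₀ a) :=
      (hF.continuousOn_fderiv_of_isOpen hΩ le_rfl).mono hcΩ
    have hFd : ∀ y ∈ closedBall x₀ (a : ℝ), HasFDerivAt F (fderiv ℝ F y) y := fun y hy ↦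
      ((hF.differentiableOn one_ne_zero).differentiableAt (hΩ.mem_nhds (hcΩ hy))).hasFDerivAt
    have huc : UniformContinuousOn (fderiv ℝ F) (closedBall x₀ a) :=
      (isCompact_closedBall x₀ (a : ℝ)).uniformContinuousOn_of_continuous hdF
    have hsub : Icc 0 τ ⊆ Icc 0 ε := Icc_subset_Icc_right hτ.2
    have hΦc : ∀ y ∈ ball x₀ ((a : ℝ) / 2), ContinuousOn (Φ y) (Icc 0 τ) := fun y hy t ht ↦
      (((hΦ y (hball hy)).2 t (hsub ht)).2.mono hsub).continuousWithinAt
    have hBc : ContinuousOn (fun t ↦ fderiv ℝ F (Φ x t)) (Icc 0 τ) :=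
      hdF.comp (hΦc x hx) fun t ht ↦ (hx2.2 t (hsub ht)).1
    -- The candidate derivative is the fundamental solution, started at the identity, of the
    -- linearised equation along Φ x.
    obtain ⟨Y, hY0, hY⟩ := exists_linearODE_solution hτ.1
      (B := fun t ↦ ContinuousLinearMap.compL ℝ G G G (fderiv ℝ F (Φ x t)))
      ((ContinuousLinearMap.compL ℝ G G G).continuous.comp_continuousOn hBc)
      (ContinuousLinearMap.id ℝ G)
    have hYv : ∀ v : G, ∀ t ∈ Icc 0 τ, HasDerivWithinAt (fun t ↦ Y t v)
        (fderiv ℝ F (Φ x t) (Y t v)) (Icc 0 τ) t := fun v t ht ↦ by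
      have := (hY t ht).clm_apply (hasDerivWithinAt_const t (Icc 0 τ) v)
      simpa using! this
    refine ⟨Y τ, ?_, fun η hη ↦ ?_⟩
    · rw [hasFDerivAt_iff_isLittleO, Asymptotics.isLittleO_iff]
      intro c hc
      -- Gronwall's inequality is applied to the error Φ y - Φ x - Y(y - x), which starts at 0 and
      -- is forced by the Taylor remainder of F. A remainder of size ηL'‖y - x‖ produces an error of
      -- at most ηE₁‖y - x‖, hence the choice η = c/(E₁ + 1).
      set E₁ := L' * gronwallBound 0 K 1 τ with hE₁
      have hgpos : 0 ≤ gronwallBound 0 K 1 τ := by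
        have := gronwallBound_mono (δ := 0) (ε := 1) (K := K) le_rfl zero_le_one K.2 hτ.1
        simpa [gronwallBound_x0] using this
      have hE0 : 0 ≤ E₁ := mul_nonneg L'.2 hgpos
      obtain ⟨δ, hδ, hδ'⟩ := Metric.uniformContinuousOn_iff.1 huc (c / (E₁ + 1)) (by positivity)
      have hnear : ∀ᶠ y in 𝓝 x, y ∈ ball x₀ ((a : ℝ) / 2) ∧ ‖y - x‖ < δ / (L' + 1) := by
        refine Filter.Eventually.and (isOpen_ball.mem_nhds hx) ?_
        have := Metric.ball_mem_nhds x (show 0 < δ / (L' + 1) by positivity)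
        filter_upwards [this] with y hy
        simpa [dist_eq_norm] using hy
      filter_upwards [hnear] with y ⟨hy, hyx⟩
      have hy2 := hΦ y (hball hy)
      have hdist : ∀ t ∈ Icc 0 τ, ‖Φ y t - Φ x t‖ ≤ L' * ‖y - x‖ := fun t ht ↦ by
        simpa [dist_eq_norm] using (hL' t (hsub ht)).dist_le_mul y (hball hy) x (hball hx)
      have hL'δ : L' * ‖y - x‖ < δ := by
        rw [lt_div_iff₀ (by positivity)] at hyx
        nlinarith [norm_nonneg (y - x), L'.2]
      set ε' := c / (E₁ + 1) * (L' * ‖y - x‖) with hε'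
      have hε'0 : 0 ≤ ε' := by positivity
      have hbound := norm_le_gronwallBound_of_norm_deriv_right_le
        (f := fun t ↦ Φ y t - Φ x t - Y t (y - x))
        (f' := fun t ↦ F (Φ y t) - F (Φ x t) - fderiv ℝ F (Φ x t) (Y t (y - x)))
        (δ := 0) (K := K) (ε := ε') (a := 0) (b := τ)
        (fun t ht ↦ ((hΦc y hy t ht).sub (hΦc x hx t ht)).sub
          (hYv (y - x) t ht).continuousWithinAt)
        (fun t ht ↦ by
          have ht' := Ico_subset_Icc_self ht
          exact ((((hy2.2 t (hsub ht')).2.mono hsub).sub ((hx2.2 t (hsub ht')).2.mono hsub)).sub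
            (hYv (y - x) t ht')).mono_of_mem_nhdsWithin (Icc_mem_nhdsGE_of_mem ht))
        (by simp [hx2.1, hy2.1, hY0]) (fun t ht ↦ by
          have ht' := Ico_subset_Icc_self ht
          have hxa := (hx2.2 t (hsub ht')).1
          have hya := (hy2.2 t (hsub ht')).1
          have hseg : segment ℝ (Φ x t) (Φ y t) ⊆ closedBall x₀ a :=
            (convex_closedBall x₀ (a : ℝ)).segment_subset hxa hya
          have h1 : ‖F (Φ y t) - F (Φ x t) - fderiv ℝ F (Φ x t) (Φ y t - Φ x t)‖ ≤ ε' := by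
            have := Convex.norm_image_sub_le_of_norm_hasFDerivWithin_le'
              (f := F) (f' := fderiv ℝ F) (φ := fderiv ℝ F (Φ x t)) (C := c / (E₁ + 1))
              (s := segment ℝ (Φ x t) (Φ y t)) (fun z hz ↦ (hFd z (hseg hz)).hasFDerivWithinAt)
              (fun z hz ↦ by
                rw [← dist_eq_norm]
                refine (hδ' z (hseg hz) _ hxa ?_).le
                calc dist z (Φ x t) ≤ dist (Φ y t) (Φ x t) := by
                      rw [dist_eq_norm, dist_eq_norm]
                      obtain ⟨p, q, hp, hq, hpq, rfl⟩ := hz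
                      have : p • Φ x t + q • Φ y t - Φ x t = q • (Φ y t - Φ x t) := by
                        rw [← eq_sub_iff_add_eq] at hpq
                        rw [hpq]; module
                      rw [this, norm_smul, Real.norm_of_nonneg hq]
                      nlinarith [norm_nonneg (Φ y t - Φ x t)]
                  _ ≤ L' * ‖y - x‖ := by rw [dist_eq_norm]; exact hdist t ht'
                  _ < δ := hL'δ)
              (convex_segment _ _) (left_mem_segment ℝ _ _) (right_mem_segment ℝ _ _)
            exact this.trans (mul_le_mul_of_nonneg_left (hdist t ht') (by positivity))
          have h2 : ‖fderiv ℝ F (Φ x t)‖ ≤ K :=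
            norm_fderiv_le_of_lipschitzOn ℝ (Filter.mem_of_superset (isOpen_ball.mem_nhds (hcl hxa))
              fun z hz ↦ (haS hz).1) hl
          calc ‖F (Φ y t) - F (Φ x t) - fderiv ℝ F (Φ x t) (Y t (y - x))‖
              = ‖(F (Φ y t) - F (Φ x t) - fderiv ℝ F (Φ x t) (Φ y t - Φ x t))
                + fderiv ℝ F (Φ x t) (Φ y t - Φ x t - Y t (y - x))‖ := by
                congr 1; simp only [map_sub]; abel
            _ ≤ ε' + K * ‖Φ y t - Φ x t - Y t (y - x)‖ :=
                (norm_add_le _ _).trans (add_le_add h1 ((fderiv ℝ F (Φ x t)).le_of_opNorm_le h2 _))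
            _ = _ := add_comm _ _) τ (right_mem_Icc.2 hτ.1)
      have hscale : gronwallBound 0 K ε' τ = ε' * gronwallBound 0 K 1 τ := by
        unfold gronwallBound
        split_ifs <;> ring
      rw [sub_zero, hscale] at hbound
      refine hbound.trans ?_
      have e1 : ε' * gronwallBound 0 K 1 τ = c * (E₁ / (E₁ + 1)) * ‖y - x‖ := by
        rw [hε', hE₁]; ring
      rw [e1]
      have e2 : E₁ / (E₁ + 1) ≤ 1 := by rw [div_le_one (by positivity)]; linarith
      have : c * (E₁ / (E₁ + 1)) ≤ c := by nlinarith
      exact mul_le_mul_of_nonneg_right this (norm_nonneg _)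
    · have := linearODE_unique hBc (y := fun t ↦ Y t (η 0)) (z := η) (by simp [hY0])
        (hYv (η 0)) hη τ (right_mem_Icc.2 hτ.1)
      simpa using this

end ODE

/-! ### Riccati comparison for A'' + SA = 0 with symmetric S. -/

section MatrixRiccati

open Matrix Filter Topology
open scoped Matrix.Norms.Operator

/-- Cauchy-Schwarz on the diagonal; by symmetry tr U² is the sum of the squares of all entries,
which dominates the diagonal ones. It turns the matrix Riccati equation into a scalar inequality for
the normalised trace. -/
theorem sq_trace_le_mul_trace_sq {n : ℕ} {U : Matrix (Fin n) (Fin n) ℝ} (hU : U.IsSymm) :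
    U.trace ^ 2 ≤ n * (U * U).trace := by
  have h1 : U.trace ^ 2 ≤ n * ∑ i, U i i ^ 2 := by
    simpa [Matrix.trace] using
      sq_sum_le_card_mul_sum_sq (s := (Finset.univ : Finset (Fin n))) (f := fun i ↦ U i i)
  refine h1.trans (mul_le_mul_of_nonneg_left ?_ (Nat.cast_nonneg n))
  simp only [Matrix.trace, Matrix.diag, Matrix.mul_apply]
  refine Finset.sum_le_sum fun i _ ↦ ?_
  have h2 : ∀ j, U i j * U j i = U i j ^ 2 := fun j ↦ by rw [hU.apply i j, sq]
  simp only [h2]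
  exact Finset.single_le_sum (f := fun j ↦ U i j ^ 2) (fun j _ ↦ sq_nonneg _) (Finset.mem_univ i)

theorem hasDerivAt_matrix_inv {n : ℕ} {A : ℝ → Matrix (Fin n) (Fin n) ℝ}
    {A' : Matrix (Fin n) (Fin n) ℝ} {t : ℝ} (hA : HasDerivAt A A' t) (hdet : (A t).det ≠ 0) :
    HasDerivAt (fun r ↦ (A r)⁻¹) (-((A t)⁻¹ * A' * (A t)⁻¹)) t := by
  obtain ⟨u, hu⟩ : IsUnit (A t) := (Matrix.isUnit_iff_isUnit_det _).2 (isUnit_iff_ne_zero.2 hdet)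
  have h := hasFDerivAt_ringInverse (𝕜 := ℝ) u
  rw [hu] at h
  have h2 := h.comp_hasDerivAt t hA
  have e : (A t)⁻¹ = ((u⁻¹ : (Matrix (Fin n) (Fin n) ℝ)ˣ) : Matrix (Fin n) (Fin n) ℝ) := by
    rw [← hu, Matrix.coe_units_inv]
  have e2 : (fun r ↦ (A r)⁻¹) = Ring.inverse ∘ A := by
    funext r; exact Matrix.nonsing_inv_eq_ringInverse _
  rw [e2, e]
  simpa using! h2

variable {n : ℕ} {a b : ℝ} {S A B : ℝ → Matrix (Fin n) (Fin n) ℝ}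

theorem hasDerivAt_matrix_trace {U : ℝ → Matrix (Fin n) (Fin n) ℝ}
    {U' : Matrix (Fin n) (Fin n) ℝ} {t : ℝ} (hU : HasDerivAt U U' t) :
    HasDerivAt (fun r ↦ (U r).trace) U'.trace t :=
  (LinearMap.toContinuousLinearMap (Matrix.traceLinearMap (Fin n) ℝ ℝ)).hasFDerivAt.comp_hasDerivAt
    t hU

theorem hasDerivAt_matrix_transpose {U : ℝ → Matrix (Fin n) (Fin n) ℝ}
    {U' : Matrix (Fin n) (Fin n) ℝ} {s : Set ℝ} {t : ℝ} (hU : HasDerivWithinAt U U' s t) :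
    HasDerivWithinAt (fun r ↦ (U r)ᵀ) U'ᵀ s t :=
  (LinearMap.toContinuousLinearMap
    (Matrix.transposeLinearEquiv (Fin n) (Fin n) ℝ ℝ).toLinearMap).hasFDerivAt.comp_hasDerivWithinAt
    t hU

/-- In the derivative of AᵀB - BᵀA the terms BᵀB and AᵀSA cancel because S is symmetric, and the
initial value is zero because A a = 0. This identity is what makes BA⁻¹ symmetric. -/
theorem wronskian_eq_zero
    (hsym : ∀ t ∈ Icc a b, (S t).IsSymm) (hA0 : A a = 0)
    (hA : ∀ t ∈ Icc a b, HasDerivWithinAt A (B t) (Icc a b) t)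
    (hB : ∀ t ∈ Icc a b, HasDerivWithinAt B (-(S t * A t)) (Icc a b) t) {t : ℝ}
    (ht : t ∈ Icc a b) : (A t)ᵀ * B t = (B t)ᵀ * A t := by
  have hW : ∀ t ∈ Icc a b, HasDerivWithinAt (fun r ↦ (A r)ᵀ * B r - (B r)ᵀ * A r) 0 (Icc a b) t := by
    intro t ht
    have h1 := ((hasDerivAt_matrix_transpose (hA t ht)).mul (hB t ht)).sub
      ((hasDerivAt_matrix_transpose (hB t ht)).mul (hA t ht))
    convert! h1 using 1
    rw [Matrix.transpose_neg, Matrix.transpose_mul, (hsym t ht).eq]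
    noncomm_ring
  have hconst := constant_of_has_deriv_right_zero (a := a) (b := b)
    (f := fun r ↦ (A r)ᵀ * B r - (B r)ᵀ * A r)
    (fun t ht ↦ (hW t ht).continuousWithinAt)
    (fun t ht ↦ (hW t (Ico_subset_Icc_self ht)).mono_of_mem_nhdsWithin (Icc_mem_nhdsGE_of_mem ht))
    t ht
  rw [hA0] at hconst
  simpa [sub_eq_zero] using hconst

theorem isSymm_riccati (hW : (A b)ᵀ * B b = (B b)ᵀ * A b) (hdet : (A b).det ≠ 0) :
    (B b * (A b)⁻¹).IsSymm := by
  have hu : IsUnit (A b).det := isUnit_iff_ne_zero.2 hdet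
  have hu' : IsUnit (A b)ᵀ.det := by rwa [Matrix.det_transpose]
  unfold Matrix.IsSymm
  rw [Matrix.transpose_mul, Matrix.transpose_nonsing_inv]
  calc ((A b)ᵀ)⁻¹ * (B b)ᵀ = ((A b)ᵀ)⁻¹ * ((B b)ᵀ * A b) * (A b)⁻¹ := by
        rw [Matrix.mul_assoc, Matrix.mul_assoc, Matrix.mul_nonsing_inv _ hu, Matrix.mul_one]
    _ = B b * (A b)⁻¹ := by
        rw [← hW, ← Matrix.mul_assoc, Matrix.nonsing_inv_mul _ hu', Matrix.one_mul]

/-- Behaviour of the Riccati solution at the initial singularity. -/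
theorem tendsto_sq_mul_trace_riccati (hab : a < b) {g : ℝ → ℝ} {g' : ℝ} (hg : HasDerivAt g g' a)
    (hg0 : g a = 0) (hA0 : A a = 0) (hB0 : B a = 1)
    (hA : HasDerivWithinAt A (B a) (Icc a b) a) (hB : ContinuousWithinAt B (Icc a b) a) :
    Tendsto (fun r ↦ g r ^ 2 * (B r * (A r)⁻¹).trace) (𝓝[>] a) (𝓝 0) := by
  have hle : 𝓝[>] a ≤ 𝓝[Icc a b] a := by
    rw [← nhdsWithin_Ioc_eq_nhdsGT hab]
    exact nhdsWithin_mono _ Ioc_subset_Icc_self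
  have hgs : Tendsto (fun r ↦ (r - a)⁻¹ * g r) (𝓝[>] a) (𝓝 g') := by
    have := (hasDerivAt_iff_tendsto_slope.1 hg).mono_left (nhdsWithin_mono a (fun r hr ↦ ne_of_gt hr :
      Ioi a ⊆ {a}ᶜ))
    refine this.congr fun r ↦ ?_
    simp [slope, hg0]
  have hgc : Tendsto g (𝓝[>] a) (𝓝 0) := by
    have := hg.continuousAt.continuousWithinAt (s := Ioi a)
    rwa [ContinuousWithinAt, hg0] at this
  have hAs : Tendsto (fun r ↦ (r - a)⁻¹ • A r) (𝓝[>] a) (𝓝 1) := by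
    have h1 := hasDerivWithinAt_iff_tendsto_slope.1 hA
    rw [hB0] at h1
    have h2 := h1.mono_left (show 𝓝[>] a ≤ 𝓝[Icc a b \ {a}] a by
      rw [← nhdsWithin_Ioc_eq_nhdsGT hab]
      exact nhdsWithin_mono _ fun r hr ↦ ⟨Ioc_subset_Icc_self hr, ne_of_gt hr.1⟩)
    refine h2.congr fun r ↦ ?_
    simp [slope, hA0]
  have hinv : Tendsto (fun r ↦ ((r - a)⁻¹ • A r)⁻¹) (𝓝[>] a) (𝓝 1) := by
    have h1 : ContinuousAt Ring.inverse (1 : Matrix (Fin n) (Fin n) ℝ) :=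
      NormedRing.inverse_continuousAt (1 : (Matrix (Fin n) (Fin n) ℝ)ˣ)
    have h2 := h1.tendsto.comp hAs
    rw [Ring.inverse_one] at h2
    refine h2.congr fun r ↦ ?_
    exact (Matrix.nonsing_inv_eq_ringInverse _).symm
  have hBt : Tendsto B (𝓝[>] a) (𝓝 1) := by
    have := hB.tendsto.mono_left hle
    rwa [hB0] at this
  have htr : Tendsto (fun r ↦ (B r * ((r - a)⁻¹ • A r)⁻¹).trace) (𝓝[>] a)
      (𝓝 ((1 : Matrix (Fin n) (Fin n) ℝ) * 1).trace) :=
    ((LinearMap.toContinuousLinearMap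
      (Matrix.traceLinearMap (Fin n) ℝ ℝ)).continuous.tendsto _).comp (hBt.mul hinv)
  -- The expression is the product of g → 0, g/(r - a) → g' and tr(B((r - a)⁻¹A)⁻¹) → tr 1: the pole
  -- of BA⁻¹ at a is simple, and g² vanishes there to second order.
  have hall := (hgc.mul hgs).mul htr
  rw [zero_mul, zero_mul] at hall
  refine hall.congr' ?_
  filter_upwards [self_mem_nhdsWithin] with r hr
  have hra : r - a ≠ 0 := sub_ne_zero.2 (ne_of_gt hr)
  have e : ((r - a)⁻¹ • A r)⁻¹ = (r - a) • (A r)⁻¹ := by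
    -- If A r is singular, both inverses are 0 by convention.
    by_cases hd : (A r).det = 0
    · rw [Matrix.nonsing_inv_apply_not_isUnit, Matrix.nonsing_inv_apply_not_isUnit, smul_zero]
      · simp [hd]
      · rw [Matrix.det_smul, hd]; simp
    · have := Matrix.inv_smul' (A := A r) (Units.mk0 (r - a) hra)⁻¹ (isUnit_iff_ne_zero.2 hd)
      simpa [Units.smul_def] using this
  rw [e, Matrix.mul_smul, Matrix.trace_smul, smul_eq_mul]
  field_simp

/-- The comparison argument of Bonnet and Myers for the matrix equation `A'' + S A = 0`. -/
theorem exists_det_eq_zero (hn : 0 < n) {k : ℝ} (hk : 0 < k) (hab : Real.pi / √k ≤ b - a)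
    (hsym : ∀ t ∈ Icc a b, (S t).IsSymm) (htr : ∀ t ∈ Icc a b, n * k ≤ (S t).trace)
    (hA0 : A a = 0) (hB0 : B a = 1)
    (hA : ∀ t ∈ Icc a b, HasDerivWithinAt A (B t) (Icc a b) t)
    (hB : ∀ t ∈ Icc a b, HasDerivWithinAt B (-(S t * A t)) (Icc a b) t) :
    ∃ t ∈ Ioc a b, (A t).det = 0 := by
  by_contra! hdet
  set w := √k with hw
  have hw0 : 0 < w := Real.sqrt_pos.2 hk
  have hwk : w ^ 2 = k := Real.sq_sqrt hk.le
  -- The first zero after a of sin(w(r - a)), the solution of the scalar model equation.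
  set d := a + Real.pi / w with hd
  have had : a < d := by rw [hd]; linarith [div_pos Real.pi_pos hw0]
  have hdb : d ≤ b := by rw [hd]; linarith
  have hIoc : Ioc a d ⊆ Ioc a b := Ioc_subset_Ioc_right hdb
  have hn0 : (0 : ℝ) < n := Nat.cast_pos.2 hn
  set s : ℝ → ℝ := fun r ↦ Real.sin (w * (r - a)) with hs
  set c : ℝ → ℝ := fun r ↦ Real.cos (w * (r - a)) with hc
  have hlin : ∀ r, HasDerivAt (fun r ↦ w * (r - a)) w r := fun r ↦ by
    simpa using ((hasDerivAt_id r).sub_const a).const_mul w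
  have hs' : ∀ r, HasDerivAt s (w * c r) r := fun r ↦ by
    have := (hlin r).sin; rwa [mul_comm] at this
  have hc' : ∀ r, HasDerivAt c (-(w * s r)) r := fun r ↦ by
    have := (hlin r).cos; convert! this using 1; simp only [hs]; ring
  have hwd : w * (d - a) = Real.pi := by rw [hd]; field_simp; ring
  have hsd : s d = 0 := by simp only [hs, hwd, Real.sin_pi]
  have hcd : c d = -1 := by simp only [hc, hwd, Real.cos_pi]
  have hspos : ∀ r ∈ Ioo a d, 0 < s r := fun r hr ↦ by
    apply Real.sin_pos_of_pos_of_lt_pi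
    · exact mul_pos hw0 (sub_pos.2 hr.1)
    · rw [← hwd]; exact mul_lt_mul_of_pos_left (by linarith [hr.2]) hw0
  set U : ℝ → Matrix (Fin n) (Fin n) ℝ := fun r ↦ B r * (A r)⁻¹ with hU
  set u : ℝ → ℝ := fun r ↦ (U r).trace / n with hu
  -- This is s²(u - w cot(w(r - a))), the difference from the model Riccati solution, with s²
  -- removing the poles. The inequality u' ≤ -w² - u² gives h' ≤ -(su - wc)² ≤ 0.
  set h : ℝ → ℝ := fun r ↦ s r ^ 2 * u r - w * s r * c r with hh
  have hUsym : ∀ r ∈ Ioc a b, (U r).IsSymm := fun r hr ↦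
    isSymm_riccati (wronskian_eq_zero hsym hA0 hA hB (Ioc_subset_Icc_self hr)) (hdet r hr)
  have hu' : ∀ r ∈ Ioo a d, HasDerivAt u ((-(S r).trace - (U r * U r).trace) / n) r := by
    intro r hr
    have hrb : r ∈ Icc a b := ⟨hr.1.le, hr.2.le.trans hdb⟩
    have hnhds : Icc a b ∈ 𝓝 r := Icc_mem_nhds hr.1 (hr.2.trans_le hdb)
    have hdr := hdet r ⟨hr.1, hr.2.le.trans hdb⟩
    have h1 := ((hB r hrb).hasDerivAt hnhds).mul
      (hasDerivAt_matrix_inv ((hA r hrb).hasDerivAt hnhds) hdr)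
    have h2 := (hasDerivAt_matrix_trace h1).div_const (n : ℝ)
    convert! h2 using 1
    congr 1
    rw [← Matrix.trace_neg, ← Matrix.trace_sub]
    congr 1
    have : A r * (A r)⁻¹ = 1 := Matrix.mul_nonsing_inv _ (isUnit_iff_ne_zero.2 hdr)
    rw [Matrix.neg_mul, Matrix.mul_assoc (S r), this, Matrix.mul_one]
    simp only [hU]
    noncomm_ring
  have hAcont : ContinuousOn A (Icc a b) := fun r hr ↦ (hA r hr).continuousWithinAt
  have hBcont : ContinuousOn B (Icc a b) := fun r hr ↦ (hB r hr).continuousWithinAt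
  have hucont : ContinuousOn u (Ioc a d) := by
    have hinv : ContinuousOn (fun r ↦ (A r)⁻¹) (Ioc a d) := by
      intro r hr
      obtain ⟨v, hv⟩ : IsUnit (A r) :=
        (Matrix.isUnit_iff_isUnit_det _).2 (isUnit_iff_ne_zero.2 (hdet r (hIoc hr)))
      have h1 := NormedRing.inverse_continuousAt v
      rw [hv] at h1
      have h2 : ContinuousWithinAt (Ring.inverse ∘ A) (Ioc a d) r :=
        h1.comp_continuousWithinAt ((hAcont r (Ioc_subset_Icc_self (hIoc hr))).mono
          (hIoc.trans Ioc_subset_Icc_self))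
      refine h2.congr (fun y _ ↦ ?_) ?_ <;> exact Matrix.nonsing_inv_eq_ringInverse _
    refine ContinuousOn.div_const ?_ _
    exact (LinearMap.toContinuousLinearMap
      (Matrix.traceLinearMap (Fin n) ℝ ℝ)).continuous.comp_continuousOn
      ((hBcont.mono (hIoc.trans Ioc_subset_Icc_self)).mul hinv)
  have hscont : Continuous s := continuous_iff_continuousAt.2 fun r ↦ (hs' r).continuousAt
  have hccont : Continuous c := continuous_iff_continuousAt.2 fun r ↦ (hc' r).continuousAt
  have hhcont : ContinuousOn h (Ioc a d) :=
    ((hscont.pow 2).continuousOn.mul hucont).sub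
      ((continuous_const.mul hscont).mul hccont).continuousOn
  have hh' : ∀ r ∈ Ioo a d, ∃ h' ≤ 0, HasDerivAt h h' r := by
    intro r hr
    have hrb : r ∈ Ioc a b := ⟨hr.1, hr.2.le.trans hdb⟩
    refine ⟨_, ?_, (((hs' r).pow 2).mul (hu' r hr)).sub (((hs' r).const_mul w).mul (hc' r))⟩
    have hq : (U r * U r).trace / n ≥ u r ^ 2 := by
      have := sq_trace_le_mul_trace_sq (hUsym r hrb)
      rw [ge_iff_le, hu, div_pow, div_le_div_iff₀ (by positivity) hn0]
      nlinarith
    have hp : (S r).trace / n ≥ w ^ 2 := by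
      rw [ge_iff_le, le_div_iff₀ hn0, hwk]; linarith [htr r (Ioc_subset_Icc_self hrb)]
    have hsc : s r ^ 2 + c r ^ 2 = 1 := Real.sin_sq_add_cos_sq _
    have e : (-(S r).trace - (U r * U r).trace) / n
        = -((S r).trace / n) - (U r * U r).trace / n := by ring
    simp only [e, Pi.pow_apply]
    have key : s r ^ 2 * (-((S r).trace / n) - (U r * U r).trace / n)
        ≤ s r ^ 2 * (- w ^ 2 - u r ^ 2) :=
      mul_le_mul_of_nonneg_left (by linarith) (sq_nonneg _)
    have : (↑2 * s r ^ (2 - 1) * (w * c r)) * u r + s r ^ 2 * (- w ^ 2 - u r ^ 2)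
        - (w * (w * c r) * c r + w * s r * -(w * s r)) = -(s r * u r - w * c r) ^ 2 := by ring
    push_cast at *
    nlinarith [sq_nonneg (s r * u r - w * c r)]
  have hanti : AntitoneOn h (Ioc a d) := by
    refine antitoneOn_of_deriv_nonpos (convex_Ioc a d) hhcont ?_ ?_
    · rw [interior_Ioc]
      intro r hr
      obtain ⟨_, _, hd'⟩ := hh' r hr
      exact hd'.differentiableAt.differentiableWithinAt
    · rw [interior_Ioc]
      intro r hr
      obtain ⟨_, hle, hd'⟩ := hh' r hr
      rwa [hd'.deriv]
  have hlim : Tendsto h (𝓝[>] a) (𝓝 0) := by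
    have hsa : s a = 0 := by simp [hs]
    have h1 := (tendsto_sq_mul_trace_riccati (had.trans_le hdb) (hs' a) hsa hA0 hB0
      (hA a (left_mem_Icc.2 (had.trans_le hdb).le)) (hBcont a (left_mem_Icc.2 (had.trans_le hdb).le))).div_const (n : ℝ)
    have h2 : Tendsto (fun r ↦ w * s r * c r) (𝓝[>] a) (𝓝 (w * s a * c a)) :=
      (((continuous_const.mul hscont).mul hccont).tendsto a).mono_left nhdsWithin_le_nhds
    have h3 := h1.sub h2
    rw [hsa] at h3
    simp only [zero_div, mul_zero, zero_mul, sub_zero] at h3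
    refine h3.congr fun r ↦ ?_
    simp only [hh, hu, hU]
    ring
  have hdmem : d ∈ Ioc a d := ⟨had, le_rfl⟩
  have hhd : h d = 0 := by simp [hh, hsd]
  -- A nonincreasing function with limit 0 at a and value 0 at d vanishes identically; hence su = wc
  -- on the open interval.
  have hzero : ∀ r ∈ Ioc a d, h r = 0 := by
    intro r hr
    refine le_antisymm ?_ (hhd ▸ hanti hr hdmem hr.2)
    refine ge_of_tendsto hlim ?_
    filter_upwards [Ioc_mem_nhdsGT hr.1] with r' hr'
    exact hanti ⟨hr'.1, hr'.2.trans hr.2⟩ hr hr'.2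
  have hzero' : ∀ r ∈ Ioo a d, s r * u r - w * c r = 0 := by
    intro r hr
    have h1 := hzero r (Ioo_subset_Ioc_self hr)
    have h2 : s r * (s r * u r - w * c r) = 0 := by rw [← h1]; simp only [hh]; ring
    exact (mul_eq_zero.1 h2).resolve_left (hspos r hr).ne'
  -- As A is assumed invertible at d too, u is continuous there and su - wc tends to -w cos π = w ≠
  -- 0 at d, although it is 0 before d. Using the value at d covers the borderline length b - a =
  -- π/√k.
  have hcontd : ContinuousWithinAt (fun r ↦ s r * u r - w * c r) (Ioc a d) d :=
    (hscont.continuousOn.mul hucont).sub (continuous_const.mul hccont).continuousOn d hdmem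
  have hlim1 : Tendsto (fun r ↦ s r * u r - w * c r) (𝓝[<] d) (𝓝 w) := by
    have h1 := hcontd.tendsto.mono_left (show 𝓝[<] d ≤ 𝓝[Ioc a d] d by
      rw [← nhdsWithin_Ioo_eq_nhdsLT had]; exact nhdsWithin_mono _ Ioo_subset_Ioc_self)
    simpa [hsd, hcd] using h1
  have hlim2 : Tendsto (fun r ↦ s r * u r - w * c r) (𝓝[<] d) (𝓝 0) := by
    refine tendsto_const_nhds.congr' ?_
    filter_upwards [Ioo_mem_nhdsLT had] with r hr
    exact (hzero' r hr).symm
  exact hw0.ne' (tendsto_nhds_unique hlim1 hlim2)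

/-- Under a positive lower bound on the normalised trace of the curvature, some nontrivial solution
of the Jacobi system vanishing at `a` has another zero. -/
theorem exists_jacobi_system_zero (hn : 0 < n) {k : ℝ} (hk : 0 < k)
    (hab : Real.pi / √k ≤ b - a) (hS : ∀ i j, ContinuousOn (fun t ↦ S t i j) (Icc a b))
    (hsym : ∀ t ∈ Icc a b, (S t).IsSymm) (htr : ∀ t ∈ Icc a b, n * k ≤ (S t).trace) :
    ∃ α β : ℝ → Fin n → ℝ, α a = 0 ∧ β a ≠ 0 ∧
      (∀ t ∈ Icc a b, ∀ i, HasDerivWithinAt (fun r ↦ α r i) (β t i) (Icc a b) t) ∧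
      (∀ t ∈ Icc a b, ∀ i,
        HasDerivWithinAt (fun r ↦ β r i) (-∑ j, S t i j * α t j) (Icc a b) t) ∧
      ∃ t ∈ Ioc a b, α t = 0 := by
  have hab' : a ≤ b := by
    have : 0 < Real.pi / √k := div_pos Real.pi_pos (Real.sqrt_pos.2 hk)
    linarith
  have hScont : ContinuousOn S (Icc a b) := by
    refine continuousOn_pi.2 fun i ↦ continuousOn_pi.2 fun j ↦ hS i j
  let X := Matrix (Fin n) (Fin n) ℝ
  obtain ⟨Z, hZ0, hZ⟩ := exists_linearODE_solution (G := X × X) hab'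
    (B := fun t ↦ (ContinuousLinearMap.inl ℝ X X).comp (ContinuousLinearMap.snd ℝ X X) -
      (ContinuousLinearMap.inr ℝ X X).comp
        ((ContinuousLinearMap.mul ℝ X (S t)).comp (ContinuousLinearMap.fst ℝ X X))) (by
      refine continuousOn_const.sub (continuousOn_const.clm_comp ?_)
      exact ((ContinuousLinearMap.mul ℝ X).continuous.comp_continuousOn hScont).clm_comp
        continuousOn_const) ((0 : X), (1 : X))
  have hA : ∀ t ∈ Icc a b, HasDerivWithinAt (fun r ↦ (Z r).1) (Z t).2 (Icc a b) t := fun t ht ↦ by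
    have := (hasFDerivAt_fst (𝕜 := ℝ) (E := X) (F := X)).comp_hasDerivWithinAt t (hZ t ht)
    convert! this using 1
    exact (sub_zero _).symm
  have hB : ∀ t ∈ Icc a b, HasDerivWithinAt (fun r ↦ (Z r).2) (-(S t * (Z t).1)) (Icc a b) t :=
    fun t ht ↦ by
      have := (hasFDerivAt_snd (𝕜 := ℝ) (E := X) (F := X)).comp_hasDerivWithinAt t (hZ t ht)
      convert! this using 1
      exact (zero_sub _).symm
  obtain ⟨t, ht, hdet⟩ := exists_det_eq_zero hn hk hab hsym htr (by simp [hZ0]) (by simp [hZ0]) hA hB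
  -- For v in the kernel of A t, the solution Av vanishes at a and at t, and its derivative at a is
  -- v ≠ 0.
  obtain ⟨v, hv, hv0⟩ := Matrix.exists_mulVec_eq_zero_iff.2 hdet
  let ev : Fin n → (Matrix (Fin n) (Fin n) ℝ →L[ℝ] ℝ) := fun i ↦ LinearMap.toContinuousLinearMap
    { toFun := fun Y ↦ (Y *ᵥ v) i
      map_add' := fun Y Y' ↦ by rw [Matrix.add_mulVec]; rfl
      map_smul' := fun c Y ↦ by rw [Matrix.smul_mulVec]; rfl }
  refine ⟨fun r ↦ (Z r).1 *ᵥ v, fun r ↦ (Z r).2 *ᵥ v, by simp only [hZ0, Matrix.zero_mulVec],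
    by simpa only [hZ0, Matrix.one_mulVec] using hv,
    fun t ht i ↦ (ev i).hasFDerivAt.comp_hasDerivWithinAt t (hA t ht), fun t ht i ↦ ?_, t, ht, hv0⟩
  have := (ev i).hasFDerivAt.comp_hasDerivWithinAt t (hB t ht)
  convert! this using 1
  change _ = (-(S t * (Z t).1) *ᵥ v) i
  rw [Matrix.neg_mulVec, ← Matrix.mulVec_mulVec]
  rfl

end MatrixRiccati

/-! ### Tensor calculus in one chart: parallel torsion and the symmetries of the curvature. -/

section LocalModel

set_option synthInstance.maxHeartbeats 400000

variable {E : Type*} [NormedAddCommGroup E] [NormedSpace ℝ E]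

/-- The torsion of the connection on an open set of a vector space with Christoffel symbols `Γ`. -/
def localTorsion (Γ : E → E →L[ℝ] E →L[ℝ] E) (z u v : E) : E := Γ z u v - Γ z v u

/-- The curvature of the connection on an open set of a vector space with Christoffel
symbols `Γ`. -/
def localCurvature (Γ : E → E →L[ℝ] E →L[ℝ] E) (z u v w : E) : E :=
  fderiv ℝ Γ z u v w - fderiv ℝ Γ z v u w + Γ z u (Γ z v w) - Γ z v (Γ z u w)

/-- The geodesic spray of the connection with Christoffel symbols `Γ`. -/
def localSpray (Γ : E → E →L[ℝ] E →L[ℝ] E) (p : E × E) : E × E := (p.2, -Γ p.1 p.2 p.2)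

/-- The expression in coordinates of a connection with parallel metric `g`, endomorphism `J` and
vector field `ξ`, whose torsion is `-2 g(u, J v) ξ`. -/
structure IsLocalSasakian (Ω : Set E) (Γ : E → E →L[ℝ] E →L[ℝ] E) (g : E → E →L[ℝ] E →L[ℝ] ℝ)
    (J : E → E →L[ℝ] E) (ξ : E → E) : Prop where
  isOpen : IsOpen Ω
  contDiffOn_christoffel : ContDiffOn ℝ 1 Γ Ω
  contDiffOn_metric : ContDiffOn ℝ 1 g Ω
  contDiffOn_J : ContDiffOn ℝ 1 J Ω
  contDiffOn_ξ : ContDiffOn ℝ 1 ξ Ω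
  fderiv_metric : ∀ z ∈ Ω, ∀ u a b, fderiv ℝ g z u a b = g z (Γ z u a) b + g z a (Γ z u b)
  fderiv_J : ∀ z ∈ Ω, ∀ u a, fderiv ℝ J z u a = J z (Γ z u a) - Γ z u (J z a)
  fderiv_ξ : ∀ z ∈ Ω, ∀ u, fderiv ℝ ξ z u = -Γ z u (ξ z)
  torsion : ∀ z ∈ Ω, ∀ u v, Γ z u v - Γ z v u = (-2 * g z u (J z v)) • ξ z
  metric_ξ_J : ∀ z ∈ Ω, ∀ v, g z (ξ z) (J z v) = 0
  symm : ∀ z ∈ Ω, ∀ u v, g z u v = g z v u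

theorem localCurvature_antisymm (Γ : E → E →L[ℝ] E →L[ℝ] E) (z u v w : E) :
    localCurvature Γ z u v w = -localCurvature Γ z v u w := by
  unfold localCurvature; abel

/-- For a connection with parallel torsion, the covariant Jacobi equation is the linearisation of
the geodesic equation. -/
theorem hasDerivWithinAt_linearised_spray {Γ : E → E →L[ℝ] E →L[ℝ] E} {x c y w : ℝ → E} {s : Set ℝ}
    {t : ℝ} (hΓ : DifferentiableAt ℝ Γ (x t))
    (hT : ∀ a u v, fderiv ℝ Γ (x t) a u v - fderiv ℝ Γ (x t) a v u
      + Γ (x t) a (localTorsion Γ (x t) u v) - localTorsion Γ (x t) (Γ (x t) a u) v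
      - localTorsion Γ (x t) u (Γ (x t) a v) = 0)
    (hx : HasDerivWithinAt x (c t) s t)
    (hc : HasDerivWithinAt c (-Γ (x t) (c t) (c t)) s t)
    (hy : HasDerivWithinAt y (w t - Γ (x t) (c t) (y t)) s t)
    (hw : HasDerivWithinAt w (-localCurvature Γ (x t) (y t) (c t) (c t)
      + localTorsion Γ (x t) (c t) (w t) - Γ (x t) (c t) (w t)) s t) :
    HasDerivWithinAt (fun r ↦ (y r, w r - Γ (x r) (c r) (y r)))
      (fderiv ℝ (localSpray Γ) (x t, c t) (y t, w t - Γ (x t) (c t) (y t))) s t := by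
  have hΓ1 : HasFDerivAt (fun p : E × E ↦ Γ p.1)
      ((fderiv ℝ Γ (x t)).comp (ContinuousLinearMap.fst ℝ E E)) (x t, c t) := by
    have h1 := HasFDerivAt.comp (𝕜 := ℝ) (g := Γ) (g' := fderiv ℝ Γ (x t)) (f := fun p : E × E ↦ p.1)
      (x t, c t) (f' := ContinuousLinearMap.fst ℝ E E)
    exact h1 hΓ.hasFDerivAt hasFDerivAt_fst
  have hF : HasFDerivAt (localSpray Γ) _ (x t, c t) :=
    HasFDerivAt.prodMk (hasFDerivAt_snd (𝕜 := ℝ) (E := E) (F := E) (p := (x t, c t)))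
      (((hΓ1.clm_apply hasFDerivAt_snd).clm_apply hasFDerivAt_snd).neg)
  have hΓx : HasDerivWithinAt (fun r ↦ Γ (x r)) (fderiv ℝ Γ (x t) (c t)) s t := by
    have h1 := HasFDerivAt.comp_hasDerivWithinAt (l := Γ) (l' := fderiv ℝ Γ (x t)) (f := x)
      (f' := c t) (s := s) t
    exact h1 hΓ.hasFDerivAt hx
  have h2 := hw.sub ((hΓx.clm_apply hc).clm_apply hy)
  rw [hF.fderiv]
  convert! hy.prodMk h2 using 1
  refine Prod.ext rfl ?_
  -- Written out in Christoffel symbols, the two second components differ, up to sign, by the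
  -- covariant derivative of the torsion in direction c evaluated on (y, c).
  have h3 := hT (c t) (y t) (c t)
  simp only [localTorsion, map_sub, sub_eq_zero] at h3
  simp only [ContinuousLinearMap.prod_apply, _root_.neg_apply,
    _root_.add_apply, ContinuousLinearMap.comp_apply, ContinuousLinearMap.flip_apply,
    ContinuousLinearMap.coe_fst', ContinuousLinearMap.coe_snd', map_sub, map_neg,
    _root_.sub_apply, localTorsion, localCurvature]
  rw [← sub_eq_zero]
  rw [← sub_eq_zero] at h3
  refine Eq.trans ?_ (neg_eq_zero.2 h3)
  abel

namespace IsLocalSasakian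

variable {Ω : Set E} {Γ : E → E →L[ℝ] E →L[ℝ] E} {g : E → E →L[ℝ] E →L[ℝ] ℝ}
  {J : E → E →L[ℝ] E} {ξ : E → E} (h : IsLocalSasakian Ω Γ g J ξ)
include h

theorem hasFDerivAt_christoffel {z : E} (hz : z ∈ Ω) : HasFDerivAt Γ (fderiv ℝ Γ z) z :=
  ((h.contDiffOn_christoffel.differentiableOn one_ne_zero).differentiableAt
    (h.isOpen.mem_nhds hz)).hasFDerivAt

theorem hasFDerivAt_metric {z : E} (hz : z ∈ Ω) : HasFDerivAt g (fderiv ℝ g z) z :=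
  ((h.contDiffOn_metric.differentiableOn one_ne_zero).differentiableAt
    (h.isOpen.mem_nhds hz)).hasFDerivAt

theorem hasFDerivAt_J {z : E} (hz : z ∈ Ω) : HasFDerivAt J (fderiv ℝ J z) z :=
  ((h.contDiffOn_J.differentiableOn one_ne_zero).differentiableAt
    (h.isOpen.mem_nhds hz)).hasFDerivAt

theorem hasFDerivAt_ξ {z : E} (hz : z ∈ Ω) : HasFDerivAt ξ (fderiv ℝ ξ z) z :=
  ((h.contDiffOn_ξ.differentiableOn one_ne_zero).differentiableAt
    (h.isOpen.mem_nhds hz)).hasFDerivAt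

theorem localTorsion_eq {z : E} (hz : z ∈ Ω) (u v : E) :
    localTorsion Γ z u v = (-2 * g z u (J z v)) • ξ z := h.torsion z hz u v

theorem localTorsion_ξ {z : E} (hz : z ∈ Ω) (a : ℝ) (w u : E) (hu : u = a • ξ z) :
    localTorsion Γ z u w = 0 := by
  rw [h.localTorsion_eq hz, hu, map_smul, _root_.smul_apply, h.metric_ξ_J z hz]
  simp

/-- The torsion is parallel. -/
theorem torsion_parallel {z : E} (hz : z ∈ Ω) (a u v : E) :
    fderiv ℝ Γ z a u v - fderiv ℝ Γ z a v u
      + Γ z a (localTorsion Γ z u v) - localTorsion Γ z (Γ z a u) v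
      - localTorsion Γ z u (Γ z a v) = 0 := by
  have hL : HasFDerivAt (fun z ↦ Γ z u v - Γ z v u) _ z :=
    (((h.hasFDerivAt_christoffel hz).clm_apply (hasFDerivAt_const u z)).clm_apply
      (hasFDerivAt_const v z)).sub
    (((h.hasFDerivAt_christoffel hz).clm_apply (hasFDerivAt_const v z)).clm_apply
      (hasFDerivAt_const u z))
  have hR : HasFDerivAt (fun z ↦ (-2 * g z u (J z v)) • ξ z) _ z :=
    ((((h.hasFDerivAt_metric hz).clm_apply (hasFDerivAt_const u z)).clm_apply
      ((h.hasFDerivAt_J hz).clm_apply (hasFDerivAt_const v z))).const_mul (-2)).smul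
      (h.hasFDerivAt_ξ hz)
  -- Differentiating the torsion formula: the right-hand side is built from parallel tensors, so its
  -- derivative consists of Christoffel terms only.
  have heq : (fun z ↦ Γ z u v - Γ z v u) =ᶠ[nhds z] fun z ↦ (-2 * g z u (J z v)) • ξ z := by
    filter_upwards [h.isOpen.mem_nhds hz] with y hy using h.torsion y hy u v
  have := congrArg (fun L : E →L[ℝ] E ↦ L a) (hL.unique (hR.congr_of_eventuallyEq heq))
  simp only [_root_.sub_apply, _root_.add_apply,
    ContinuousLinearMap.comp_apply, ContinuousLinearMap.flip_apply, _root_.zero_apply,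
    map_zero, zero_add, _root_.smul_apply, ContinuousLinearMap.smulRight_apply] at this
  rw [h.fderiv_metric z hz, h.fderiv_J z hz, h.fderiv_ξ z hz, map_sub] at this
  rw [this, h.localTorsion_eq hz, h.localTorsion_eq hz, h.localTorsion_eq hz, map_smul]
  simp only [smul_eq_mul]
  module

/-- As ξ is parallel, its derivative is -Γ(·, ξ), which is again differentiable. Symmetry of the
second derivative of ξ is then exactly the vanishing of R(u, v)ξ. -/
theorem localCurvature_ξ {z : E} (hz : z ∈ Ω) (u v : E) : localCurvature Γ z u v (ξ z) = 0 := by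
  have hf : ∀ᶠ y in nhds z, HasFDerivAt ξ (-(Γ y).flip (ξ y)) y := by
    filter_upwards [h.isOpen.mem_nhds hz] with y hy
    convert h.hasFDerivAt_ξ hy using 1
    ext a
    simp [h.fderiv_ξ y hy]
  have hflip : HasFDerivAt (fun y ↦ (Γ y).flip) _ z :=
    (ContinuousLinearMap.flipₗᵢ ℝ E E E).toContinuousLinearEquiv.toContinuousLinearMap.hasFDerivAt.comp
      z (h.hasFDerivAt_christoffel hz)
  have hf' : HasFDerivAt (fun y ↦ -(Γ y).flip (ξ y)) _ z := (hflip.clm_apply (h.hasFDerivAt_ξ hz)).neg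
  have := second_derivative_symmetric_of_eventually hf hf' u v
  simp only [_root_.neg_apply, _root_.add_apply,
    ContinuousLinearMap.comp_apply, ContinuousLinearMap.flip_apply, h.fderiv_ξ z hz] at this
  unfold localCurvature
  have e : ∀ a, ((ContinuousLinearMap.flipₗᵢ ℝ E E E).toContinuousLinearEquiv.toContinuousLinearMap
    ((fderiv ℝ Γ z) a)) (ξ z) = (fderiv ℝ Γ z a).flip (ξ z) := fun a ↦ rfl
  simp only [e, ContinuousLinearMap.flip_apply, map_neg] at this
  rw [← sub_eq_zero] at this
  rw [← neg_eq_zero, ← this]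
  abel

/-- The same argument for the function g(a, b), with a and b constant. In its second derivative the
products of two first-order Christoffel terms, one in each slot of g, are symmetric in the two
directions and drop out; what remains of the commutator is the curvature in either slot. -/
theorem metric_localCurvature_skew {z : E} (hz : z ∈ Ω) (u v a b : E) :
    g z (localCurvature Γ z u v a) b = -g z a (localCurvature Γ z u v b) := by
  have hgab : ∀ y ∈ Ω, HasFDerivAt (fun y ↦ g y a b) (((g y).flip b).comp ((Γ y).flip a)
      + (g y a).comp ((Γ y).flip b)) y := fun y hy ↦ by
    have := ((h.hasFDerivAt_metric hy).clm_apply (hasFDerivAt_const a y)).clm_apply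
      (hasFDerivAt_const b y)
    refine this.congr_fderiv ?_
    ext w
    simp [h.fderiv_metric y hy]
  have hgd := h.hasFDerivAt_metric hz
  have hΓd := h.hasFDerivAt_christoffel hz
  have hfΓ : DifferentiableAt ℝ (fun y ↦ (Γ y).flip) z :=
    (ContinuousLinearMap.flipₗᵢ ℝ E E E).toContinuousLinearEquiv.differentiableAt.comp z
      hΓd.differentiableAt
  have hfg : DifferentiableAt ℝ (fun y ↦ (g y).flip) z :=
    have h1 : DifferentiableAt ℝ (fun L : E →L[ℝ] E →L[ℝ] ℝ ↦ L.flip) (g z) :=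
      (ContinuousLinearMap.flipₗᵢ ℝ E E ℝ).toContinuousLinearEquiv.toContinuousLinearMap.differentiableAt
    have h2 := DifferentiableAt.comp (𝕜 := ℝ) (g := fun L : E →L[ℝ] E →L[ℝ] ℝ ↦ L.flip) (f := g) z h1
    h2 hgd.differentiableAt
  have hd' : DifferentiableAt ℝ (fun y ↦ ((g y).flip b).comp ((Γ y).flip a)
      + (g y a).comp ((Γ y).flip b)) z :=
    ((hfg.clm_apply (differentiableAt_const b)).clm_comp
      (hfΓ.clm_apply (differentiableAt_const a))).add
    ((hgd.differentiableAt.clm_apply (differentiableAt_const a)).clm_comp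
      (hfΓ.clm_apply (differentiableAt_const b)))
  have hsymm := second_derivative_symmetric_of_eventually
    (Filter.eventually_of_mem (h.isOpen.mem_nhds hz) hgab) hd'.hasFDerivAt u v
  have key : ∀ p q : E, fderiv ℝ (fun y ↦ ((g y).flip b).comp ((Γ y).flip a)
      + (g y a).comp ((Γ y).flip b)) z p q
      = (g z (Γ z p (Γ z q a)) b + g z (Γ z q a) (Γ z p b) + g z (fderiv ℝ Γ z p q a) b)
        + (g z (Γ z p a) (Γ z q b) + g z a (Γ z p (Γ z q b)) + g z a (fderiv ℝ Γ z p q b)) := by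
    intro p q
    have h1 := hd'.hasFDerivAt.clm_apply (hasFDerivAt_const q z)
    have h2 : HasFDerivAt (fun y ↦ g y (Γ y q a) b + g y a (Γ y q b)) _ z :=
      ((hgd.clm_apply ((hΓd.clm_apply (hasFDerivAt_const q z)).clm_apply
        (hasFDerivAt_const a z))).clm_apply (hasFDerivAt_const b z)).add
      ((hgd.clm_apply (hasFDerivAt_const a z)).clm_apply
        ((hΓd.clm_apply (hasFDerivAt_const q z)).clm_apply (hasFDerivAt_const b z)))
    have h3 := congrArg (fun L : E →L[ℝ] ℝ ↦ L p) (h1.unique h2)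
    simp only [_root_.add_apply,
      ContinuousLinearMap.comp_apply, ContinuousLinearMap.flip_apply, _root_.zero_apply,
      map_zero, zero_add, h.fderiv_metric z hz] at h3
    rw [h3]; ring
  rw [key, key] at hsymm
  unfold localCurvature
  simp only [map_add, map_sub, _root_.add_apply, _root_.sub_apply]
  linarith

/-- With torsion, the cyclic sum of R equals a cyclic sum of terms ∇T and T(T(·,·),·). The first
vanish because T is parallel, the second because T takes values in the line of ξ, which T
annihilates. -/
theorem localCurvature_bianchi {z : E} (hz : z ∈ Ω) (u v w : E) :
    localCurvature Γ z u v w + localCurvature Γ z v w u + localCurvature Γ z w u v = 0 := by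
  have hT : ∀ a b c, localTorsion Γ z (localTorsion Γ z a b) c = 0 := fun a b c ↦
    h.localTorsion_ξ hz _ _ _ (h.localTorsion_eq hz a b)
  have e1 := h.torsion_parallel hz u v w
  have e2 := h.torsion_parallel hz v w u
  have e3 := h.torsion_parallel hz w u v
  have t1 := hT u v w
  have t2 := hT v w u
  have t3 := hT w u v
  simp only [localTorsion, map_sub, _root_.sub_apply] at *
  unfold localCurvature
  have : fderiv ℝ Γ z u v w - fderiv ℝ Γ z v u w + Γ z u (Γ z v w) - Γ z v (Γ z u w)
      + (fderiv ℝ Γ z v w u - fderiv ℝ Γ z w v u + Γ z v (Γ z w u) - Γ z w (Γ z v u))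
      + (fderiv ℝ Γ z w u v - fderiv ℝ Γ z u w v + Γ z w (Γ z u v) - Γ z u (Γ z w v))
    = 0 + 0 + 0 + 0 + 0 + 0 := by
    nth_rewrite 1 [← e1]
    nth_rewrite 1 [← e2]
    nth_rewrite 1 [← e3]
    nth_rewrite 1 [← t1]
    nth_rewrite 1 [← t2]
    nth_rewrite 1 [← t3]
    abel
  rw [this]; simp

/-- The usual octahedron argument: skewness in each pair together with four instances of the Bianchi
identity. -/
theorem localCurvature_pair_symm {z : E} (hz : z ∈ Ω) (a b c d : E) :
    g z (localCurvature Γ z a b c) d = g z (localCurvature Γ z c d a) b := by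
  set r : E → E → E → E → ℝ := fun a b c d ↦ g z (localCurvature Γ z a b c) d with hr
  have h1 : ∀ a b c d, r a b c d = -r b a c d := fun a b c d ↦ by
    simp only [hr]; rw [localCurvature_antisymm, map_neg, _root_.neg_apply]
  have h2 : ∀ a b c d, r a b c d = -r a b d c := fun a b c d ↦ by
    simp only [hr]; rw [h.metric_localCurvature_skew hz, h.symm z hz]
  have h3 : ∀ a b c d, r a b c d + r b c a d + r c a b d = 0 := fun a b c d ↦ by
    simp only [hr]
    have := congrArg (fun x ↦ g z x d) (h.localCurvature_bianchi hz a b c)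
    simpa only [map_add, _root_.add_apply, map_zero,
      _root_.zero_apply] using this
  change r a b c d = r c d a b
  linarith [h3 a b c d, h3 b c d a, h3 c d a b, h3 d a b c, h1 a b c d, h2 a b c d, h1 b c a d,
    h2 b c a d, h1 c a b d, h2 c a b d, h1 b c d a, h1 c d b a, h2 c d b a, h1 d b c a, h2 d b c a,
    h1 c d a b, h2 c d a b, h1 d a c b, h2 d a c b, h1 a c d b, h2 a c d b, h1 d a b c, h2 d a b c,
    h1 a b d c, h1 b d a c, h2 b d a c]

/-- For X = R(ξ, v)w, pair symmetry gives g(X, X) = g(R(w, X)ξ, v) = 0, and positivity forces X = 0.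
-/
theorem localCurvature_ξ_left {z : E} (hz : z ∈ Ω)
    (hpos : ∀ v, v ≠ 0 → 0 < g z v v) (v w : E) :
    localCurvature Γ z (ξ z) v w = 0 := by
  by_contra hne
  have h1 := hpos _ hne
  rw [h.localCurvature_pair_symm hz, h.localCurvature_ξ hz, map_zero] at h1
  exact lt_irrefl _ h1

end IsLocalSasakian
end LocalModel

/-! ### Vector fields, functions and Lie brackets in a chart. -/

section Coordinates

variable {E : Type*} [NormedAddCommGroup E] [NormedSpace ℝ E]
  {M : Type*} [TopologicalSpace M] [ChartedSpace E M] [IsManifold 𝓘(ℝ, E) ∞ M]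

/-- The coordinates of the tangent vectors at `x` in the chart at `q`. -/
def coord (q x : M) : TangentSpace 𝓘(ℝ, E) x →L[ℝ] E :=
  (trivializationAt E (TangentSpace 𝓘(ℝ, E) : M → Type _) q).continuousLinearMapAt ℝ x

/-- The tangent vector at `x` with given coordinates in the chart at `q`. -/
def ofCoord (q x : M) : E →L[ℝ] TangentSpace 𝓘(ℝ, E) x :=
  (trivializationAt E (TangentSpace 𝓘(ℝ, E) : M → Type _) q).symmL ℝ x

/-- The coordinate expression of a vector field in the chart at `q`. -/
def rep (q : M) (σ : Π x : M, TangentSpace 𝓘(ℝ, E) x) (z : E) : E :=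
  coord q ((extChartAt 𝓘(ℝ, E) q).symm z) (σ ((extChartAt 𝓘(ℝ, E) q).symm z))

variable {q x : M}

omit [IsManifold 𝓘(ℝ, E) ∞ M] in
theorem mem_source_self (q : M) : q ∈ (extChartAt 𝓘(ℝ, E) q).source := mem_extChartAt_source q

omit [IsManifold 𝓘(ℝ, E) ∞ M] in
theorem source_mem_nhds (hx : x ∈ (extChartAt 𝓘(ℝ, E) q).source) :
    (extChartAt 𝓘(ℝ, E) q).source ∈ 𝓝 x :=
  (isOpen_extChartAt_source q).mem_nhds hx

omit [IsManifold 𝓘(ℝ, E) ∞ M] in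
theorem target_mem_nhds (hx : x ∈ (extChartAt 𝓘(ℝ, E) q).source) :
    (extChartAt 𝓘(ℝ, E) q).target ∈ 𝓝 (extChartAt 𝓘(ℝ, E) q x) :=
  (isOpen_extChartAt_target q).mem_nhds ((extChartAt 𝓘(ℝ, E) q).map_source hx)

theorem mem_baseSet (hx : x ∈ (extChartAt 𝓘(ℝ, E) q).source) :
    x ∈ (trivializationAt E (TangentSpace 𝓘(ℝ, E) : M → Type _) q).baseSet := by
  rw [TangentBundle.trivializationAt_baseSet]
  rwa [extChartAt_source] at hx

theorem coord_apply (hx : x ∈ (extChartAt 𝓘(ℝ, E) q).source) (v : TangentSpace 𝓘(ℝ, E) x) :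
    (trivializationAt E (TangentSpace 𝓘(ℝ, E) : M → Type _) q
      (⟨x, v⟩ : TangentBundle 𝓘(ℝ, E) M)).2 = coord q x v := by
  rw [coord, Trivialization.continuousLinearMapAt_apply,
    Trivialization.coe_linearMapAt_of_mem _ (mem_baseSet hx)]

theorem ofCoord_apply (hx : x ∈ (extChartAt 𝓘(ℝ, E) q).source) (w : E) :
    ofCoord q x w = (trivializationAt E (TangentSpace 𝓘(ℝ, E) : M → Type _) q).symm x w :=
  Trivialization.symmL_apply _ (mem_baseSet hx) w

theorem coord_ofCoord (hx : x ∈ (extChartAt 𝓘(ℝ, E) q).source) (w : E) :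
    coord q x (ofCoord q x w) = w :=
  (trivializationAt E (TangentSpace 𝓘(ℝ, E) : M → Type _) q).continuousLinearMapAt_symmL
    (mem_baseSet hx) w

theorem ofCoord_coord (hx : x ∈ (extChartAt 𝓘(ℝ, E) q).source) (v : TangentSpace 𝓘(ℝ, E) x) :
    ofCoord q x (coord q x v) = v :=
  (trivializationAt E (TangentSpace 𝓘(ℝ, E) : M → Type _) q).symmL_continuousLinearMapAt
    (mem_baseSet hx) v

theorem coord_injective (hx : x ∈ (extChartAt 𝓘(ℝ, E) q).source) :
    Function.Injective (coord q x : TangentSpace 𝓘(ℝ, E) x → E) :=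
  Function.LeftInverse.injective (ofCoord_coord hx)

theorem coord_eq_mfderiv (hx : x ∈ (extChartAt 𝓘(ℝ, E) q).source) :
    coord q x = mfderiv 𝓘(ℝ, E) 𝓘(ℝ, E) (extChartAt 𝓘(ℝ, E) q) x := by
  rw [extChartAt_source] at hx
  exact TangentBundle.continuousLinearMapAt_trivializationAt hx

theorem ofCoord_eq_mfderiv {z : E} (hz : z ∈ (extChartAt 𝓘(ℝ, E) q).target) :
    ofCoord (E := E) q ((extChartAt 𝓘(ℝ, E) q).symm z) =
      mfderiv 𝓘(ℝ, E) 𝓘(ℝ, E) ((extChartAt 𝓘(ℝ, E) q).symm : E → M) z := by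
  have hx := (extChartAt 𝓘(ℝ, E) q).map_target hz
  rw [extChartAt_source] at hx
  have := TangentBundle.symmL_trivializationAt (I := 𝓘(ℝ, E)) hx
  rw [(extChartAt 𝓘(ℝ, E) q).right_inv hz] at this
  simpa only [ofCoord, modelWithCornersSelf_coe, range_id, mfderivWithin_univ] using! this

theorem extend_apply (hx : x ∈ (extChartAt 𝓘(ℝ, E) q).source) (v : TangentSpace 𝓘(ℝ, E) q) :
    extend E v x = ofCoord q x (coord q q v) := by
  simp only [extend, coord_apply (mem_source_self q), ofCoord_apply hx]

omit [IsManifold 𝓘(ℝ, E) ∞ M] in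
/-- A property that holds near `x` holds in coordinates. -/
theorem eventually_coord (hx : x ∈ (extChartAt 𝓘(ℝ, E) q).source) {p : M → Prop}
    (h : ∀ᶠ y in 𝓝 x, p y) :
    ∀ᶠ z in 𝓝 (extChartAt 𝓘(ℝ, E) q x), z ∈ (extChartAt 𝓘(ℝ, E) q).target ∧
      (extChartAt 𝓘(ℝ, E) q).symm z ∈ (extChartAt 𝓘(ℝ, E) q).source ∧
      extChartAt 𝓘(ℝ, E) q ((extChartAt 𝓘(ℝ, E) q).symm z) = z ∧
      p ((extChartAt 𝓘(ℝ, E) q).symm z) := by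
  have h1 : Tendsto (extChartAt 𝓘(ℝ, E) q).symm (𝓝 (extChartAt 𝓘(ℝ, E) q x)) (𝓝 x) := by
    have := (continuousAt_extChartAt_symm' (I := 𝓘(ℝ, E)) hx)
    rw [ContinuousAt, (extChartAt 𝓘(ℝ, E) q).left_inv hx] at this
    exact this
  filter_upwards [h1 h, target_mem_nhds hx] with z hz hz'
  exact ⟨hz', (extChartAt 𝓘(ℝ, E) q).map_target hz', (extChartAt 𝓘(ℝ, E) q).right_inv hz', hz⟩

section Functions

variable {F : Type*} [NormedAddCommGroup F] [NormedSpace ℝ F]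

theorem contMDiffAt_chart {n : ℕ∞ω} (hn : n ≤ ∞) (hx : x ∈ (extChartAt 𝓘(ℝ, E) q).source) :
    ContMDiffAt 𝓘(ℝ, E) 𝓘(ℝ, E) n (extChartAt 𝓘(ℝ, E) q) x := by
  rw [extChartAt_source] at hx
  exact (contMDiffAt_extChartAt' hx).of_le hn

theorem contMDiffAt_chart_symm {n : ℕ∞ω} (hn : n ≤ ∞) {z : E}
    (hz : z ∈ (extChartAt 𝓘(ℝ, E) q).target) :
    ContMDiffAt 𝓘(ℝ, E) 𝓘(ℝ, E) n (extChartAt 𝓘(ℝ, E) q).symm z :=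
  ((contMDiffOn_extChartAt_symm (I := 𝓘(ℝ, E)) (n := ∞) q).contMDiffAt
    ((isOpen_extChartAt_target q).mem_nhds hz)).of_le hn

theorem contMDiffAt_iff_coord {n : ℕ∞ω} (hn : n ≤ ∞) (hx : x ∈ (extChartAt 𝓘(ℝ, E) q).source)
    {f : M → F} : ContMDiffAt 𝓘(ℝ, E) 𝓘(ℝ, F) n f x ↔
      ContDiffAt ℝ n (f ∘ (extChartAt 𝓘(ℝ, E) q).symm) (extChartAt 𝓘(ℝ, E) q x) := by
  rw [← contMDiffAt_iff_contDiffAt]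
  constructor
  · intro h
    refine ContMDiffAt.comp _ ?_ (contMDiffAt_chart_symm hn ((extChartAt 𝓘(ℝ, E) q).map_source hx))
    rwa [(extChartAt 𝓘(ℝ, E) q).left_inv hx]
  · intro h
    refine (h.comp x (contMDiffAt_chart hn hx)).congr_of_eventuallyEq ?_
    filter_upwards [source_mem_nhds hx] with y hy
    simp only [Function.comp_apply, (extChartAt 𝓘(ℝ, E) q).left_inv hy]

theorem mdifferentiableAt_iff_coord (hx : x ∈ (extChartAt 𝓘(ℝ, E) q).source)
    {f : M → F} : MDifferentiableAt 𝓘(ℝ, E) 𝓘(ℝ, F) f x ↔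
      DifferentiableAt ℝ (f ∘ (extChartAt 𝓘(ℝ, E) q).symm) (extChartAt 𝓘(ℝ, E) q x) := by
  rw [← mdifferentiableAt_iff_differentiableAt]
  constructor
  · intro h
    refine MDifferentiableAt.comp (I' := 𝓘(ℝ, E)) _ ?_
      ((contMDiffAt_chart_symm (n := 1) (by simp)
        ((extChartAt 𝓘(ℝ, E) q).map_source hx)).mdifferentiableAt one_ne_zero)
    rwa [(extChartAt 𝓘(ℝ, E) q).left_inv hx]
  · intro h
    refine (h.comp x ((contMDiffAt_chart (n := 1) (by simp) hx).mdifferentiableAt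
      one_ne_zero)).congr_of_eventuallyEq ?_
    filter_upwards [source_mem_nhds hx] with y hy
    simp only [Function.comp_apply, (extChartAt 𝓘(ℝ, E) q).left_inv hy]

theorem mvfderiv_eq_coord (hx : x ∈ (extChartAt 𝓘(ℝ, E) q).source) {f : M → F}
    (hf : MDifferentiableAt 𝓘(ℝ, E) 𝓘(ℝ, F) f x) (u : TangentSpace 𝓘(ℝ, E) x) :
    mvfderiv 𝓘(ℝ, E) f x u =
      fderiv ℝ (f ∘ (extChartAt 𝓘(ℝ, E) q).symm) (extChartAt 𝓘(ℝ, E) q x) (coord q x u) := by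
  have h1 : MDifferentiableAt 𝓘(ℝ, E) 𝓘(ℝ, E) (extChartAt 𝓘(ℝ, E) q) x :=
    (contMDiffAt_chart (n := 1) (by simp) hx).mdifferentiableAt one_ne_zero
  have h2 : MDifferentiableAt 𝓘(ℝ, E) 𝓘(ℝ, F) (f ∘ (extChartAt 𝓘(ℝ, E) q).symm)
      (extChartAt 𝓘(ℝ, E) q x) :=
    mdifferentiableAt_iff_differentiableAt.2 ((mdifferentiableAt_iff_coord hx).1 hf)
  have h3 : f =ᶠ[𝓝 x] (f ∘ (extChartAt 𝓘(ℝ, E) q).symm) ∘ (extChartAt 𝓘(ℝ, E) q) := by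
    filter_upwards [source_mem_nhds hx] with y hy
    simp only [Function.comp_apply, (extChartAt 𝓘(ℝ, E) q).left_inv hy]
  have h4 : mfderiv 𝓘(ℝ, E) 𝓘(ℝ, F) f x =
      (mfderiv 𝓘(ℝ, E) 𝓘(ℝ, F) (f ∘ (extChartAt 𝓘(ℝ, E) q).symm) (extChartAt 𝓘(ℝ, E) q x)).comp
      (mfderiv 𝓘(ℝ, E) 𝓘(ℝ, E) (extChartAt 𝓘(ℝ, E) q) x) := by
    rw [← mfderiv_comp x h2 h1]
    exact h3.mfderiv_eq
  rw [mfderiv_eq_fderiv, ← coord_eq_mfderiv hx] at h4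
  exact congrArg (fun L : E →L[ℝ] F ↦ L u) h4

end Functions

theorem mdifferentiableAt_section_iff_rep (hx : x ∈ (extChartAt 𝓘(ℝ, E) q).source)
    {σ : Π x : M, TangentSpace 𝓘(ℝ, E) x} :
    MDifferentiableAt 𝓘(ℝ, E) (𝓘(ℝ, E).prod 𝓘(ℝ, E))
      (fun y ↦ (⟨y, σ y⟩ : TangentBundle 𝓘(ℝ, E) M)) x ↔
    DifferentiableAt ℝ (rep q σ) (extChartAt 𝓘(ℝ, E) q x) := by
  rw [(trivializationAt E (TangentSpace 𝓘(ℝ, E) : M → Type _) q).mdifferentiableAt_section_iff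
    𝓘(ℝ, E) σ (mem_baseSet hx), mdifferentiableAt_iff_coord hx]
  apply Filter.EventuallyEq.differentiableAt_iff
  filter_upwards [eventually_coord hx (p := fun _ ↦ True) (by simp)] with z hz
  exact coord_apply hz.2.1 _

theorem contMDiffAt_section_iff_rep {n : ℕ∞ω} (hn : n ≤ ∞)
    (hx : x ∈ (extChartAt 𝓘(ℝ, E) q).source)
    {σ : Π x : M, TangentSpace 𝓘(ℝ, E) x} :
    ContMDiffAt 𝓘(ℝ, E) (𝓘(ℝ, E).prod 𝓘(ℝ, E)) n
      (fun y ↦ (⟨y, σ y⟩ : TangentBundle 𝓘(ℝ, E) M)) x ↔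
    ContDiffAt ℝ n (rep q σ) (extChartAt 𝓘(ℝ, E) q x) := by
  have h : (rep q σ) =ᶠ[𝓝 (extChartAt 𝓘(ℝ, E) q x)]
      ((fun y ↦ (trivializationAt E (TangentSpace 𝓘(ℝ, E) : M → Type _) q
        (⟨y, σ y⟩ : TangentBundle 𝓘(ℝ, E) M)).2) ∘ (extChartAt 𝓘(ℝ, E) q).symm) := by
    filter_upwards [eventually_coord hx (p := fun _ ↦ True) (by simp)] with z hz
    exact (coord_apply hz.2.1 _).symm
  have := ContMDiffVectorBundle.of_le hn (IB := 𝓘(ℝ, E)) (F := E)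
    (E := (TangentSpace 𝓘(ℝ, E) : M → Type _))
  rw [show ContDiffAt ℝ n (rep q σ) _ ↔ _ from
    ⟨fun h' ↦ h'.congr_of_eventuallyEq h.symm, fun h' ↦ h'.congr_of_eventuallyEq h⟩,
    ← contMDiffAt_iff_coord hn hx]
  exact (trivializationAt E (TangentSpace 𝓘(ℝ, E) : M → Type _) q).contMDiffAt_section_iff
    (mem_baseSet hx)

theorem rep_ofCoord (hx : x ∈ (extChartAt 𝓘(ℝ, E) q).source) (f : M → E) :
    rep q (fun y ↦ ofCoord q y (f y)) =ᶠ[𝓝 (extChartAt 𝓘(ℝ, E) q x)]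
      f ∘ (extChartAt 𝓘(ℝ, E) q).symm := by
  filter_upwards [eventually_coord hx (p := fun _ ↦ True) (by simp)] with z hz
  exact coord_ofCoord hz.2.1 _

theorem rep_ofCoord_const (hx : x ∈ (extChartAt 𝓘(ℝ, E) q).source) (b : E) :
    rep q (fun y ↦ ofCoord q y b) =ᶠ[𝓝 (extChartAt 𝓘(ℝ, E) q x)] fun _ ↦ b :=
  rep_ofCoord hx fun _ ↦ b

theorem contMDiffAt_ofCoord_const {n : ℕ∞ω} (hn : n ≤ ∞)
    (hx : x ∈ (extChartAt 𝓘(ℝ, E) q).source) (b : E) :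
    ContMDiffAt 𝓘(ℝ, E) (𝓘(ℝ, E).prod 𝓘(ℝ, E)) n
      (fun y ↦ (⟨y, ofCoord q y b⟩ : TangentBundle 𝓘(ℝ, E) M)) x := by
  rw [contMDiffAt_section_iff_rep hn hx]
  exact contDiffAt_const.congr_of_eventuallyEq (rep_ofCoord_const hx b)

theorem mdifferentiableAt_ofCoord_const
    (hx : x ∈ (extChartAt 𝓘(ℝ, E) q).source) (b : E) :
    MDifferentiableAt 𝓘(ℝ, E) (𝓘(ℝ, E).prod 𝓘(ℝ, E))
      (fun y ↦ (⟨y, ofCoord q y b⟩ : TangentBundle 𝓘(ℝ, E) M)) x :=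
  (contMDiffAt_ofCoord_const (n := 1) (by simp) hx b).mdifferentiableAt one_ne_zero

theorem contDiffAt_rep_extend {n : ℕ∞ω} (hn : n ≤ ∞) (hx : x ∈ (extChartAt 𝓘(ℝ, E) q).source)
    (v : TangentSpace 𝓘(ℝ, E) x) :
    ContDiffAt ℝ n (rep q (extend E v)) (extChartAt 𝓘(ℝ, E) q x) := by
  rw [← contMDiffAt_section_iff_rep hn hx]
  exact (contMDiffAt_extend (I := 𝓘(ℝ, E)) (k := ∞) (F := E) v).of_le hn

theorem rep_apply (hx : x ∈ (extChartAt 𝓘(ℝ, E) q).source)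
    (σ : Π x : M, TangentSpace 𝓘(ℝ, E) x) :
    rep q σ (extChartAt 𝓘(ℝ, E) q x) = coord q x (σ x) := by
  rw [rep, (extChartAt 𝓘(ℝ, E) q).left_inv hx]

theorem rep_extend_apply (hx : x ∈ (extChartAt 𝓘(ℝ, E) q).source)
    (v : TangentSpace 𝓘(ℝ, E) x) :
    rep q (extend E v) (extChartAt 𝓘(ℝ, E) q x) = coord q x v := by
  rw [rep_apply hx, extend_apply_self]

/-- The Lie bracket in coordinates. -/
theorem coord_mlieBracket [FiniteDimensional ℝ E] (hx : x ∈ (extChartAt 𝓘(ℝ, E) q).source)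
    {X Y : Π x : M, TangentSpace 𝓘(ℝ, E) x}
    (hX : MDifferentiableAt 𝓘(ℝ, E) (𝓘(ℝ, E).prod 𝓘(ℝ, E))
      (fun y ↦ (⟨y, X y⟩ : TangentBundle 𝓘(ℝ, E) M)) x)
    (hY : MDifferentiableAt 𝓘(ℝ, E) (𝓘(ℝ, E).prod 𝓘(ℝ, E))
      (fun y ↦ (⟨y, Y y⟩ : TangentBundle 𝓘(ℝ, E) M)) x) :
    coord q x (VectorField.mlieBracket 𝓘(ℝ, E) X Y x) =
      fderiv ℝ (rep q Y) (extChartAt 𝓘(ℝ, E) q x) (coord q x (X x))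
      - fderiv ℝ (rep q X) (extChartAt 𝓘(ℝ, E) q x) (coord q x (Y x)) := by
  have : CompleteSpace E := FiniteDimensional.complete ℝ E
  have : IsManifold 𝓘(ℝ, E) (minSmoothness ℝ 3) M := by
    simp only [minSmoothness_of_isRCLikeNormedField]
    exact IsManifold.of_le (n := ∞) (by norm_cast)
  have hinv : ∀ y ∈ (extChartAt 𝓘(ℝ, E) q).source, ∀ v : TangentSpace 𝓘(ℝ, E) y,
      (ofCoord q y).inverse v = coord q y v := by
    intro y hy v
    have : ofCoord q y = ((ContinuousLinearEquiv.equivOfInverse (ofCoord q y) (coord q y)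
        (coord_ofCoord hy) (ofCoord_coord hy) : E ≃L[ℝ] TangentSpace 𝓘(ℝ, E) y) :
        E →L[ℝ] TangentSpace 𝓘(ℝ, E) y) := by
      ext; rfl
    rw [this, ContinuousLinearMap.inverse_equiv]
    rfl
  -- Pulling a field back along the inverse chart gives its coordinate expression, so naturality of
  -- the bracket reduces the claim to the flat formula DY(X) - DX(Y).
  have hpull : ∀ (σ : Π x : M, TangentSpace 𝓘(ℝ, E) x), ∀ z ∈ (extChartAt 𝓘(ℝ, E) q).target,
      VectorField.mpullback 𝓘(ℝ, E) 𝓘(ℝ, E) (extChartAt 𝓘(ℝ, E) q).symm σ z = rep q σ z := by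
    intro σ z hz
    rw [VectorField.mpullback_apply, rep,
      ← hinv _ ((extChartAt 𝓘(ℝ, E) q).map_target hz), ofCoord_eq_mfderiv hz]
    rfl
  have hzt := (extChartAt 𝓘(ℝ, E) q).map_source hx
  have hli := (extChartAt 𝓘(ℝ, E) q).left_inv hx
  have key := VectorField.mpullback_mlieBracket (I := 𝓘(ℝ, E)) (I' := 𝓘(ℝ, E))
    (f := (extChartAt 𝓘(ℝ, E) q).symm)
    (V := X) (W := Y) (x₀ := extChartAt 𝓘(ℝ, E) q x) (n := minSmoothness ℝ 2)
    (by rwa [hli]) (by rwa [hli])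
    (contMDiffAt_chart_symm (by simp [minSmoothness_of_isRCLikeNormedField]; norm_cast) hzt) le_rfl
  rw [hpull _ _ hzt, rep_apply hx] at key
  rw [key]
  have hX' : VectorField.mpullback 𝓘(ℝ, E) 𝓘(ℝ, E) (extChartAt 𝓘(ℝ, E) q).symm X
      =ᶠ[𝓝 (extChartAt 𝓘(ℝ, E) q x)] rep q X := by
    filter_upwards [target_mem_nhds hx] with z hz using hpull X z hz
  have hY' : VectorField.mpullback 𝓘(ℝ, E) 𝓘(ℝ, E) (extChartAt 𝓘(ℝ, E) q).symm Y
      =ᶠ[𝓝 (extChartAt 𝓘(ℝ, E) q x)] rep q Y := by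
    filter_upwards [target_mem_nhds hx] with z hz using hpull Y z hz
  have hflat (A B : E → E) (z : E) : VectorField.mlieBracket 𝓘(ℝ, E) A B z =
      fderiv ℝ B z (A z) - fderiv ℝ A z (B z) := by
    have h1 := congrFun (VectorField.mlieBracketWithin_univ (I := 𝓘(ℝ, E)) (V := A) (W := B)) z
    have h2 := congrFun (VectorField.mlieBracketWithin_eq_lieBracketWithin (𝕜 := ℝ) (E := E)
      (V := A) (W := B) (s := univ)) z
    have h3 := congrFun (VectorField.lieBracketWithin_univ (𝕜 := ℝ) (V := A) (W := B)) z
    exact h1.symm.trans (h2.trans h3)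
  refine (hflat _ _ _).trans ?_
  rw [← rep_apply hx X, ← rep_apply hx Y, ← hX'.eq_of_nhds, ← hY'.eq_of_nhds, ← hX'.fderiv_eq,
    ← hY'.fderiv_eq]

end Coordinates

/-! ### Christoffel symbols; torsion and curvature in coordinates. -/

section Christoffel

set_option synthInstance.maxHeartbeats 400000

variable {E : Type*} [NormedAddCommGroup E] [NormedSpace ℝ E] [FiniteDimensional ℝ E]
  {M : Type*} [TopologicalSpace M] [ChartedSpace E M] [IsManifold 𝓘(ℝ, E) ∞ M]

omit [FiniteDimensional ℝ E] in
theorem rep_add (q : M) (σ τ : Π x : M, TangentSpace 𝓘(ℝ, E) x) :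
    rep q (σ + τ) = rep q σ + rep q τ :=
  funext fun _ ↦ map_add _ _ _

omit [FiniteDimensional ℝ E] in
theorem rep_smul (q : M) (g : M → ℝ) (σ : Π x : M, TangentSpace 𝓘(ℝ, E) x) :
    rep q (g • σ) = fun z ↦ (g ∘ (extChartAt 𝓘(ℝ, E) q).symm) z • rep q σ z :=
  funext fun _ ↦ map_smul _ _ _

/-- The flat connection of the chart at `q`. -/
def flatConnection (q : M) (σ : Π x : M, TangentSpace 𝓘(ℝ, E) x) (x : M) :
    TangentSpace 𝓘(ℝ, E) x →L[ℝ] TangentSpace 𝓘(ℝ, E) x :=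
  (ofCoord q x).comp ((fderiv ℝ (rep q σ) (extChartAt 𝓘(ℝ, E) q x)).comp (coord q x))

omit [FiniteDimensional ℝ E] in
theorem flatConnection_isCovariantDerivativeOn (q : M) :
    IsCovariantDerivativeOn E (flatConnection (E := E) q) (extChartAt 𝓘(ℝ, E) q).source where
  add {σ τ x} hσ hτ hx := by
    rw [mdifferentiableAt_section_iff_rep hx] at hσ hτ
    simp only [flatConnection, rep_add, fderiv_add hσ hτ]
    ext v
    exact map_add (ofCoord q x) _ _
  leibniz {σ g x} hσ hg hx := by
    rw [mdifferentiableAt_section_iff_rep hx] at hσ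
    have hg' := (mdifferentiableAt_iff_coord hx).1 hg
    ext v
    have h1 : ofCoord q x (rep q σ (extChartAt 𝓘(ℝ, E) q x)) = σ x := by
      rw [rep_apply hx, ofCoord_coord hx]
    have h2 := (hg'.hasFDerivAt.smul hσ.hasFDerivAt).fderiv
    change ofCoord q x (fderiv ℝ (rep q (g • σ)) _ _) =
      g x • ofCoord q x (fderiv ℝ (rep q σ) _ _) + (mvfderiv 𝓘(ℝ, E) g x v) • σ x
    have h3 : ∀ (a b : E) (r s : ℝ), ofCoord q x (r • a + s • b) =
        r • ofCoord q x a + s • ofCoord q x b := fun a b r s ↦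
      (map_add _ _ _).trans (congrArg₂ (· + ·) (map_smul _ _ _) (map_smul _ _ _))
    rw [rep_smul, mvfderiv_eq_coord hx hg, ← h1]
    refine Eq.trans (congrArg (ofCoord q x) ?_) (h3 _ _ _ _)
    refine (congrArg (fun L : E →L[ℝ] E ↦ L (coord q x v)) h2).trans ?_
    simp only [_root_.add_apply, _root_.smul_apply, ContinuousLinearMap.smulRight_apply,
      Function.comp_apply, (extChartAt 𝓘(ℝ, E) q).left_inv hx]
    rfl

variable (D : CovariantDerivative 𝓘(ℝ, E) E (TangentSpace 𝓘(ℝ, E) : M → Type _))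

/-- The Christoffel symbols of a connection in the chart at `q`. The first argument is the
direction of differentiation. -/
def christoffel (q : M) (z : E) : E →L[ℝ] E →L[ℝ] E :=
  let x := (extChartAt 𝓘(ℝ, E) q).symm z
  let c : E →L[ℝ] E := coord q x
  let s : E →L[ℝ] E := ofCoord q x
  let A : E →L[ℝ] E →L[ℝ] E :=
    D.isCovariantDerivativeOn.difference (flatConnection_isCovariantDerivativeOn q) x
  -- `difference` takes the value of the section first and the direction second; `flip` puts the
  -- direction first.
  ((ContinuousLinearMap.compL ℝ E E E c).comp (A.bilinearComp s s)).flip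

variable {D} {q x : M}

/-- A connection in coordinates. -/
theorem coord_connection (hx : x ∈ (extChartAt 𝓘(ℝ, E) q).source)
    {σ : Π x : M, TangentSpace 𝓘(ℝ, E) x}
    (hσ : MDifferentiableAt 𝓘(ℝ, E) (𝓘(ℝ, E).prod 𝓘(ℝ, E))
      (fun y ↦ (⟨y, σ y⟩ : TangentBundle 𝓘(ℝ, E) M)) x) (u : TangentSpace 𝓘(ℝ, E) x) :
    coord q x (D σ x u) = fderiv ℝ (rep q σ) (extChartAt 𝓘(ℝ, E) q x) (coord q x u)
      + christoffel D q (extChartAt 𝓘(ℝ, E) q x) (coord q x u) (coord q x (σ x)) := by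
  have h := D.isCovariantDerivativeOn.difference_apply
    (flatConnection_isCovariantDerivativeOn q) hx hσ
  have h1 : christoffel D q (extChartAt 𝓘(ℝ, E) q x) (coord q x u) (coord q x (σ x)) =
      coord q x (D.isCovariantDerivativeOn.difference
        (flatConnection_isCovariantDerivativeOn q) x (σ x) u) := by
    have hli := (extChartAt 𝓘(ℝ, E) q).left_inv hx
    -- The inverse chart applied to the coordinates of x is x only propositionally, and it occurs in
    -- the types; generalising to a base point y allows substitution.
    have h2 : ∀ y : M, y = x →
      coord q y (D.isCovariantDerivativeOn.difference
        (flatConnection_isCovariantDerivativeOn q) y (ofCoord q y (coord q x (σ x)))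
          (ofCoord q y (coord q x u))) = coord q x (D.isCovariantDerivativeOn.difference
        (flatConnection_isCovariantDerivativeOn q) x (σ x) u) := by
      rintro y rfl
      rw [ofCoord_coord hx, ofCoord_coord hx]
    exact h2 _ hli
  rw [h1, h]
  have h3 : coord q x (flatConnection q σ x u) =
      fderiv ℝ (rep q σ) (extChartAt 𝓘(ℝ, E) q x) (coord q x u) := coord_ofCoord hx _
  have h4 : coord q x ((D σ x - flatConnection q σ x) u) =
      coord q x (D σ x u) - coord q x (flatConnection q σ x u) := map_sub _ _ _
  rw [← h3]
  refine (sub_eq_iff_eq_add'.1 h4.symm)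

theorem coord_connection_const (hx : x ∈ (extChartAt 𝓘(ℝ, E) q).source) (a : E)
    (u : TangentSpace 𝓘(ℝ, E) x) :
    coord q x (D (fun y ↦ ofCoord q y a) x u) =
      christoffel D q (extChartAt 𝓘(ℝ, E) q x) (coord q x u) a := by
  rw [coord_connection hx (mdifferentiableAt_ofCoord_const hx a),
    (rep_ofCoord_const hx a).fderiv_eq, coord_ofCoord hx]
  simp

theorem rep_connection {X : Π x : M, TangentSpace 𝓘(ℝ, E) x}
    {σ : Π x : M, TangentSpace 𝓘(ℝ, E) x} {z : E} (hz : z ∈ (extChartAt 𝓘(ℝ, E) q).target)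
    (hσ : DifferentiableAt ℝ (rep q σ) z) :
    rep q (fun y ↦ D σ y (X y)) z = fderiv ℝ (rep q σ) z (rep q X z)
      + christoffel D q z (rep q X z) (rep q σ z) := by
  have hx := (extChartAt 𝓘(ℝ, E) q).map_target hz
  have h := coord_connection (D := D) hx (σ := σ) ((mdifferentiableAt_section_iff_rep hx).2
    (by rwa [(extChartAt 𝓘(ℝ, E) q).right_inv hz])) (X ((extChartAt 𝓘(ℝ, E) q).symm z))
  rwa [(extChartAt 𝓘(ℝ, E) q).right_inv hz] at h

omit [FiniteDimensional ℝ E] in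
theorem mdifferentiableAt_extend_section (v : TangentSpace 𝓘(ℝ, E) x) :
    MDifferentiableAt 𝓘(ℝ, E) (𝓘(ℝ, E).prod 𝓘(ℝ, E))
      (fun y ↦ (⟨y, extend E v y⟩ : TangentBundle 𝓘(ℝ, E) M)) x := by
  rw [mdifferentiableAt_section_iff_rep (mem_source_self x)]
  exact (contDiffAt_rep_extend (n := 1) (by simp) (mem_source_self x) v).differentiableAt one_ne_zero

omit [FiniteDimensional ℝ E] in
theorem differentiableAt_rep_extend (hx : x ∈ (extChartAt 𝓘(ℝ, E) q).source)
    (v : TangentSpace 𝓘(ℝ, E) x) :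
    DifferentiableAt ℝ (rep q (extend E v)) (extChartAt 𝓘(ℝ, E) q x) :=
  (contDiffAt_rep_extend (n := 1) (by simp) hx v).differentiableAt one_ne_zero

/-- The torsion in coordinates. -/
theorem coord_torsion (hx : x ∈ (extChartAt 𝓘(ℝ, E) q).source) (u v : TangentSpace 𝓘(ℝ, E) x) :
    coord q x (D.torsion x u v) =
      localTorsion (christoffel D q) (extChartAt 𝓘(ℝ, E) q x) (coord q x u) (coord q x v) := by
  have : CompleteSpace E := FiniteDimensional.complete ℝ E
  have h1 := mdifferentiableAt_extend_section u
  have h2 := mdifferentiableAt_extend_section v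
  have h := D.torsion_apply h1 h2
  rw [extend_apply_self, extend_apply_self] at h
  rw [h]
  have h3 := coord_connection (D := D) hx h1 v
  have h4 := coord_connection (D := D) hx h2 u
  have h5 := coord_mlieBracket hx h1 h2
  rw [extend_apply_self] at h3 h4 h5
  rw [extend_apply_self] at h5
  have h6 : ∀ a b c : TangentSpace 𝓘(ℝ, E) x,
      coord q x (a - b - c) = coord q x a - coord q x b - coord q x c := by
    intro a b c
    exact (map_sub _ _ _).trans (congrArg (· - _) (map_sub _ _ _))
  rw [h6, h3, h4, h5, localTorsion]
  abel

/-- The curvature in coordinates. -/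
theorem coord_curvature (hx : x ∈ (extChartAt 𝓘(ℝ, E) q).source)
    (hΓ : DifferentiableAt ℝ (christoffel D q) (extChartAt 𝓘(ℝ, E) q x))
    (u v w : TangentSpace 𝓘(ℝ, E) x) :
    coord q x (curvature D x u v w) = localCurvature (christoffel D q) (extChartAt 𝓘(ℝ, E) q x)
      (coord q x u) (coord q x v) (coord q x w) := by
  set z₀ := extChartAt 𝓘(ℝ, E) q x with hz₀
  set W := rep q (extend E w) with hW
  have hW2 : ContDiffAt ℝ 2 W z₀ := contDiffAt_rep_extend (by norm_cast) hx w
  have hWd : ∀ᶠ z in 𝓝 z₀, DifferentiableAt ℝ W z := by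
    filter_upwards [hW2.eventually (by simp)] with z hz
    exact hz.differentiableAt two_ne_zero
  have hdW : DifferentiableAt ℝ (fderiv ℝ W) z₀ :=
    (hW2.fderiv_right (m := 1) (by norm_num)).differentiableAt one_ne_zero
  have hrep : ∀ p : TangentSpace 𝓘(ℝ, E) x,
      rep q (fun y ↦ D (extend E w) y (extend E p y)) =ᶠ[𝓝 z₀] fun z ↦
        fderiv ℝ W z (rep q (extend E p) z)
          + christoffel D q z (rep q (extend E p) z) (W z) := by
    intro p
    filter_upwards [hWd, target_mem_nhds hx] with z hz hz'
    exact rep_connection hz' hz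
  have hder : ∀ p : TangentSpace 𝓘(ℝ, E) x, ∃ L : E →L[ℝ] E, HasFDerivAt
      (rep q (fun y ↦ D (extend E w) y (extend E p y))) L z₀ ∧
      ∀ a, L a = fderiv ℝ (fderiv ℝ W) z₀ a (rep q (extend E p) z₀)
        + fderiv ℝ W z₀ (fderiv ℝ (rep q (extend E p)) z₀ a)
        + (fderiv ℝ (christoffel D q) z₀ a (rep q (extend E p) z₀) (W z₀)
        + christoffel D q z₀ (fderiv ℝ (rep q (extend E p)) z₀ a) (W z₀)
        + christoffel D q z₀ (rep q (extend E p) z₀) (fderiv ℝ W z₀ a)) := by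
    intro p
    have hp := (differentiableAt_rep_extend hx p).hasFDerivAt
    have h1 := (hdW.hasFDerivAt.clm_apply hp).add
      ((hΓ.hasFDerivAt.clm_apply hp).clm_apply (hW2.differentiableAt two_ne_zero).hasFDerivAt)
    refine ⟨_, h1.congr_of_eventuallyEq (hrep p), fun a ↦ ?_⟩
    simp only [← hz₀, _root_.add_apply, ContinuousLinearMap.comp_apply,
      ContinuousLinearMap.flip_apply]
    abel
  have hcov : ∀ p r : TangentSpace 𝓘(ℝ, E) x,
      coord q x (D (fun y ↦ D (extend E w) y (extend E p y)) x r) =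
        fderiv ℝ (rep q (fun y ↦ D (extend E w) y (extend E p y))) z₀ (coord q x r)
        + christoffel D q z₀ (coord q x r) (fderiv ℝ W z₀ (rep q (extend E p) z₀)
          + christoffel D q z₀ (rep q (extend E p) z₀) (W z₀)) := by
    intro p r
    obtain ⟨L, hL, -⟩ := hder p
    refine (coord_connection (D := D) hx
      ((mdifferentiableAt_section_iff_rep hx).2 hL.differentiableAt) r).trans ?_
    rw [← hz₀, ← rep_apply hx (fun y ↦ D (extend E w) y (extend E p y)), ← hz₀,
      (hrep p).eq_of_nhds]
  have hder' : ∀ (p : TangentSpace 𝓘(ℝ, E) x) (a : E),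
      fderiv ℝ (rep q (fun y ↦ D (extend E w) y (extend E p y))) z₀ a = _ := fun p a ↦ by
    rw [(hder p).choose_spec.1.fderiv, (hder p).choose_spec.2 a]
  have hbr := coord_connection (D := D) hx (mdifferentiableAt_extend_section w)
    (VectorField.mlieBracket 𝓘(ℝ, E) (extend E u) (extend E v) x)
  rw [coord_mlieBracket hx (mdifferentiableAt_extend_section u)
    (mdifferentiableAt_extend_section v), extend_apply_self, extend_apply_self,
    extend_apply_self] at hbr
  have h6 : ∀ a b c : TangentSpace 𝓘(ℝ, E) x,
      coord q x (a - b - c) = coord q x a - coord q x b - coord q x c := by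
    intro a b c
    exact (map_sub _ _ _).trans (congrArg (· - _) (map_sub _ _ _))
  -- The second derivatives of W cancel by symmetry, and the bracket term cancels the derivatives of
  -- the other two extensions; only tensorial terms survive.
  have hsym : ∀ a b, fderiv ℝ (fderiv ℝ W) z₀ a b = fderiv ℝ (fderiv ℝ W) z₀ b a := by
    intro a b
    exact (hW2.isSymmSndFDerivAt (by simp)) a b
  have hval : ∀ p : TangentSpace 𝓘(ℝ, E) x, rep q (extend E p) z₀ = coord q x p :=
    fun p ↦ rep_extend_apply hx p
  rw [curvature, h6, hcov, hcov, hbr, hder', hder']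
  simp only [← hz₀, hval, map_add, map_sub, _root_.sub_apply, localCurvature, hW]
  rw [← hW, hsym (coord q x u) (coord q x v)]
  abel

variable [T2Space M]

/-- A vector field with given coordinates near a point. -/
theorem exists_contMDiff_section
    (hx : x ∈ (extChartAt 𝓘(ℝ, E) q).source) (b : E) :
    ∃ σ : Π x : M, TangentSpace 𝓘(ℝ, E) x,
      ContMDiff 𝓘(ℝ, E) (𝓘(ℝ, E).prod 𝓘(ℝ, E)) ∞
        (fun y ↦ (⟨y, σ y⟩ : TangentBundle 𝓘(ℝ, E) M)) ∧
      ∀ᶠ y in 𝓝 x, σ y = ofCoord q y b := by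
  obtain ⟨f, -, hf⟩ := (SmoothBumpFunction.nhds_basis_tsupport (I := 𝓘(ℝ, E)) x).mem_iff.1
    (source_mem_nhds hx)
  refine ⟨fun y ↦ f y • ofCoord q y b, fun y ↦ ?_, ?_⟩
  · by_cases hy : y ∈ (extChartAt 𝓘(ℝ, E) q).source
    · exact ContMDiffAt.smul_section (f.contMDiff y) (contMDiffAt_ofCoord_const le_rfl hy b)
    · have h1 : (0 : M → ℝ) =ᶠ[𝓝 y] f :=
        (notMem_tsupport_iff_eventuallyEq.1 fun h ↦ hy (hf h)).symm
      refine (Bundle.contMDiff_zeroSection ℝ (TangentSpace 𝓘(ℝ, E) : M → Type _)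
        y).congr_of_eventuallyEq ?_
      filter_upwards [h1] with p hp
      simp [← hp, zeroSection]
  · filter_upwards [f.eventuallyEq_one] with y hy
    rw [hy, Pi.one_apply, one_smul]

/-- Γ(a, b) is, near each point, the coordinate expression of the derivative along a of the constant
field b. Smoothness of the connection is used on globally smooth sections, so b is first cut off by
a bump function, which exists as M is Hausdorff. -/
theorem contDiffOn_christoffel (hD : CovariantDerivative.ContMDiffCovariantDerivative D ∞) (q : M) :
    ContDiffOn ℝ ∞ (christoffel D q) (extChartAt 𝓘(ℝ, E) q).target := by
  refine contDiffOn_clm_apply.2 fun a ↦ contDiffOn_clm_apply.2 fun b ↦ fun z hz ↦ ?_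
  refine ContDiffAt.contDiffWithinAt ?_
  have hx := (extChartAt 𝓘(ℝ, E) q).map_target hz
  set x := (extChartAt 𝓘(ℝ, E) q).symm z with hxz
  have hri : extChartAt 𝓘(ℝ, E) q x = z := (extChartAt 𝓘(ℝ, E) q).right_inv hz
  obtain ⟨σ, hσ, hσb⟩ := exists_contMDiff_section hx b
  have h1 := (hD.contMDiff.contMDiff (contMDiffOn_univ.2 (by simpa using hσ))).contMDiffAt
    (x := x) univ_mem
  have h2 := h1.clm_bundle_apply (contMDiffAt_ofCoord_const le_rfl hx a)
  have h3 := (contMDiffAt_section_iff_rep le_rfl hx).1 h2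
  rw [hri] at h3
  refine h3.congr_of_eventuallyEq ?_
  have h4 := eventually_coord hx hσb.eventually_nhds
  rw [hri] at h4
  filter_upwards [h4] with w hw
  have h5 : rep q σ =ᶠ[𝓝 w] fun _ ↦ b := by
    have := eventually_coord hw.2.1 hw.2.2.2
    rw [hw.2.2.1] at this
    filter_upwards [this] with w' hw'
    rw [rep, hw'.2.2.2, coord_ofCoord hw'.2.1]
  rw [rep_connection hw.1 (h5.differentiableAt_iff.2 (by fun_prop)), h5.fderiv_eq, h5.eq_of_nhds,
    rep, coord_ofCoord hw.2.1]
  simp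

end Christoffel

/-! ### One-forms, endomorphism fields and exterior derivatives in a chart. -/

section OneForms

set_option synthInstance.maxHeartbeats 400000

variable {E : Type*} [NormedAddCommGroup E] [NormedSpace ℝ E] [FiniteDimensional ℝ E]
  {M : Type*} [TopologicalSpace M] [ChartedSpace E M] [IsManifold 𝓘(ℝ, E) ∞ M]

/-- The coordinate expression of a `1`-form in the chart at `q`. -/
def formRep (q : M) (η : Π x : M, TangentSpace 𝓘(ℝ, E) x →L[ℝ] ℝ) (z : E) : E →L[ℝ] ℝ :=
  let x := (extChartAt 𝓘(ℝ, E) q).symm z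
  let s : E →L[ℝ] E := ofCoord q x
  let t : E →L[ℝ] ℝ := η x
  t.comp s

/-- The coordinate expression of a field of endomorphisms in the chart at `q`. -/
def endoRep (q : M) (J : Π x : M, TangentSpace 𝓘(ℝ, E) x →L[ℝ] TangentSpace 𝓘(ℝ, E) x) (z : E) :
    E →L[ℝ] E :=
  let x := (extChartAt 𝓘(ℝ, E) q).symm z
  let s : E →L[ℝ] E := ofCoord q x
  let c : E →L[ℝ] E := coord q x
  let t : E →L[ℝ] E := J x
  c.comp (t.comp s)

variable {q x : M}

omit [FiniteDimensional ℝ E] in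
theorem formRep_rep {η : Π x : M, TangentSpace 𝓘(ℝ, E) x →L[ℝ] ℝ} {z : E}
    (hz : z ∈ (extChartAt 𝓘(ℝ, E) q).target) (σ : Π x : M, TangentSpace 𝓘(ℝ, E) x) :
    formRep q η z (rep q σ z) =
      η ((extChartAt 𝓘(ℝ, E) q).symm z) (σ ((extChartAt 𝓘(ℝ, E) q).symm z)) :=
  congrArg (η _) (ofCoord_coord ((extChartAt 𝓘(ℝ, E) q).map_target hz) _)

omit [FiniteDimensional ℝ E] in
theorem endoRep_rep {J : Π x : M, TangentSpace 𝓘(ℝ, E) x →L[ℝ] TangentSpace 𝓘(ℝ, E) x} {z : E}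
    (hz : z ∈ (extChartAt 𝓘(ℝ, E) q).target) (σ : Π x : M, TangentSpace 𝓘(ℝ, E) x) :
    endoRep q J z (rep q σ z) = rep q (fun y ↦ J y (σ y)) z :=
  congrArg (fun v ↦ coord q _ (J _ v))
    (ofCoord_coord ((extChartAt 𝓘(ℝ, E) q).map_target hz) _)

omit [FiniteDimensional ℝ E] in
theorem formRep_coord {η : Π x : M, TangentSpace 𝓘(ℝ, E) x →L[ℝ] ℝ}
    (hx : x ∈ (extChartAt 𝓘(ℝ, E) q).source) (v : TangentSpace 𝓘(ℝ, E) x) :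
    formRep q η (extChartAt 𝓘(ℝ, E) q x) (coord q x v) = η x v := by
  have h : ∀ y : M, y = x → η y (ofCoord q y (coord q x v)) = η x v := by
    rintro y rfl
    rw [ofCoord_coord hx]
  exact h _ ((extChartAt 𝓘(ℝ, E) q).left_inv hx)

omit [FiniteDimensional ℝ E] in
theorem endoRep_coord {J : Π x : M, TangentSpace 𝓘(ℝ, E) x →L[ℝ] TangentSpace 𝓘(ℝ, E) x}
    (hx : x ∈ (extChartAt 𝓘(ℝ, E) q).source) (v : TangentSpace 𝓘(ℝ, E) x) :
    endoRep q J (extChartAt 𝓘(ℝ, E) q x) (coord q x v) = coord q x (J x v) := by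
  have h : ∀ y : M, y = x → coord q y (J y (ofCoord q y (coord q x v))) = coord q x (J x v) := by
    rintro y rfl
    rw [ofCoord_coord hx]
  exact h _ ((extChartAt 𝓘(ℝ, E) q).left_inv hx)

theorem contDiffOn_formRep {η : Π x : M, TangentSpace 𝓘(ℝ, E) x →L[ℝ] ℝ}
    (hη : ContMDiff 𝓘(ℝ, E) (𝓘(ℝ, E).prod 𝓘(ℝ, E →L[ℝ] ℝ)) ∞
    (fun x ↦ (⟨x, η x⟩ : TotalSpace (E →L[ℝ] ℝ)
      (fun x ↦ TangentSpace 𝓘(ℝ, E) x →L[ℝ] Bundle.Trivial M ℝ x)))) (q : M) :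
    ContDiffOn ℝ ∞ (formRep q η) (extChartAt 𝓘(ℝ, E) q).target := by
  refine contDiffOn_clm_apply.2 fun a z hz ↦ ContDiffAt.contDiffWithinAt ?_
  have hx := (extChartAt 𝓘(ℝ, E) q).map_target hz
  have h1 := (hη _).clm_bundle_apply (contMDiffAt_ofCoord_const le_rfl hx a)
  simp only [contMDiffAt_totalSpace] at h1
  have h2 := (contMDiffAt_iff_coord le_rfl hx).1 h1.2
  rw [(extChartAt 𝓘(ℝ, E) q).right_inv hz] at h2
  exact h2

theorem contDiffOn_endoRep
    {J : Π x : M, TangentSpace 𝓘(ℝ, E) x →L[ℝ] TangentSpace 𝓘(ℝ, E) x}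
    (hJ : ContMDiff 𝓘(ℝ, E) (𝓘(ℝ, E).prod 𝓘(ℝ, E →L[ℝ] E)) ∞
    (fun x ↦ (⟨x, J x⟩ : TotalSpace (E →L[ℝ] E)
      (fun x : M ↦ TangentSpace 𝓘(ℝ, E) x →L[ℝ] TangentSpace 𝓘(ℝ, E) x)))) (q : M) :
    ContDiffOn ℝ ∞ (endoRep q J) (extChartAt 𝓘(ℝ, E) q).target := by
  refine contDiffOn_clm_apply.2 fun a z hz ↦ ContDiffAt.contDiffWithinAt ?_
  have hx := (extChartAt 𝓘(ℝ, E) q).map_target hz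
  have h1 := (hJ _).clm_bundle_apply (contMDiffAt_ofCoord_const le_rfl hx a)
  have h2 := (contMDiffAt_section_iff_rep le_rfl hx).1 h1
  rw [(extChartAt 𝓘(ℝ, E) q).right_inv hz] at h2
  exact h2

/-- The exterior derivative in coordinates. -/
def localExtDeriv (θ : E → E →L[ℝ] ℝ) (z : E) : E →L[ℝ] E →L[ℝ] ℝ :=
  (1 / 2 : ℝ) • (fderiv ℝ θ z - (fderiv ℝ θ z).flip)

omit [FiniteDimensional ℝ E] in
theorem localExtDeriv_apply (θ : E → E →L[ℝ] ℝ) (z u v : E) :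
    localExtDeriv θ z u v = 1 / 2 * (fderiv ℝ θ z u v - fderiv ℝ θ z v u) := rfl

omit [FiniteDimensional ℝ E] in
theorem localExtDeriv_antisymm (θ : E → E →L[ℝ] ℝ) (z u v : E) :
    localExtDeriv θ z u v = -localExtDeriv θ z v u := by
  simp only [localExtDeriv_apply]; ring

section Smooth

variable {η : Π x : M, TangentSpace 𝓘(ℝ, E) x →L[ℝ] ℝ}
    (hη : ContMDiff 𝓘(ℝ, E) (𝓘(ℝ, E).prod 𝓘(ℝ, E →L[ℝ] ℝ)) ∞
    (fun x ↦ (⟨x, η x⟩ : TotalSpace (E →L[ℝ] ℝ)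
      (fun x ↦ TangentSpace 𝓘(ℝ, E) x →L[ℝ] Bundle.Trivial M ℝ x))))

include hη

theorem differentiableAt_formRep (hx : x ∈ (extChartAt 𝓘(ℝ, E) q).source) :
    DifferentiableAt ℝ (formRep q η) (extChartAt 𝓘(ℝ, E) q x) :=
  ((contDiffOn_formRep hη q).contDiffAt (target_mem_nhds hx)).differentiableAt (by simp)

theorem hasFDerivAt_form_apply (hx : x ∈ (extChartAt 𝓘(ℝ, E) q).source)
    {X : Π x : M, TangentSpace 𝓘(ℝ, E) x}
    (hX : MDifferentiableAt 𝓘(ℝ, E) (𝓘(ℝ, E).prod 𝓘(ℝ, E))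
      (fun y ↦ (⟨y, X y⟩ : TangentBundle 𝓘(ℝ, E) M)) x) :
    MDifferentiableAt 𝓘(ℝ, E) 𝓘(ℝ, ℝ) (fun y ↦ η y (X y)) x ∧ ∀ u : TangentSpace 𝓘(ℝ, E) x,
      mvfderiv 𝓘(ℝ, E) (fun y ↦ η y (X y)) x u =
        fderiv ℝ (formRep q η) (extChartAt 𝓘(ℝ, E) q x) (coord q x u) (coord q x (X x))
        + formRep q η (extChartAt 𝓘(ℝ, E) q x)
          (fderiv ℝ (rep q X) (extChartAt 𝓘(ℝ, E) q x) (coord q x u)) := by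
  rw [mdifferentiableAt_section_iff_rep hx] at hX
  have h1 := (differentiableAt_formRep hη hx).hasFDerivAt.clm_apply hX.hasFDerivAt
  have h2 : (fun y ↦ η y (X y)) ∘ (extChartAt 𝓘(ℝ, E) q).symm =ᶠ[𝓝 (extChartAt 𝓘(ℝ, E) q x)]
      fun z ↦ formRep q η z (rep q X z) := by
    filter_upwards [target_mem_nhds hx] with z hz
    exact (formRep_rep hz X).symm
  have h3 := h1.congr_of_eventuallyEq h2
  have h4 := (mdifferentiableAt_iff_coord hx).2 h3.differentiableAt
  refine ⟨h4, fun u ↦ ?_⟩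
  rw [mvfderiv_eq_coord hx h4, h3.fderiv, ← rep_apply hx]
  simp only [_root_.add_apply, ContinuousLinearMap.comp_apply, ContinuousLinearMap.flip_apply]
  exact add_comm _ _

/-- The exterior derivative can be computed with arbitrary extensions. -/
theorem localExtDeriv_formRep (hx : x ∈ (extChartAt 𝓘(ℝ, E) q).source)
    {X Y : Π x : M, TangentSpace 𝓘(ℝ, E) x}
    (hX : MDifferentiableAt 𝓘(ℝ, E) (𝓘(ℝ, E).prod 𝓘(ℝ, E))
      (fun y ↦ (⟨y, X y⟩ : TangentBundle 𝓘(ℝ, E) M)) x)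
    (hY : MDifferentiableAt 𝓘(ℝ, E) (𝓘(ℝ, E).prod 𝓘(ℝ, E))
      (fun y ↦ (⟨y, Y y⟩ : TangentBundle 𝓘(ℝ, E) M)) x) :
    localExtDeriv (formRep q η) (extChartAt 𝓘(ℝ, E) q x) (coord q x (X x)) (coord q x (Y x)) =
      1 / 2 * (mvfderiv 𝓘(ℝ, E) (fun y ↦ η y (Y y)) x (X x)
      - mvfderiv 𝓘(ℝ, E) (fun y ↦ η y (X y)) x (Y x)
      - η x (VectorField.mlieBracket 𝓘(ℝ, E) X Y x)) := by
  rw [(hasFDerivAt_form_apply hη hx hX).2, (hasFDerivAt_form_apply hη hx hY).2,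
    ← formRep_coord hx, coord_mlieBracket hx hX hY, localExtDeriv_apply, map_sub]
  ring

theorem extDerivOneForm_eq (hx : x ∈ (extChartAt 𝓘(ℝ, E) q).source)
    (u v : TangentSpace 𝓘(ℝ, E) x) : extDerivOneForm η x u v =
    localExtDeriv (formRep q η) (extChartAt 𝓘(ℝ, E) q x) (coord q x u) (coord q x v) := by
  have h := localExtDeriv_formRep hη hx (mdifferentiableAt_extend_section u)
    (mdifferentiableAt_extend_section v)
  rw [extend_apply_self, extend_apply_self] at h
  exact h.symm

end Smooth

end OneForms

/-! ### The Webster metric in coordinates: smoothness and positivity. -/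

namespace PseudoHermitian

set_option synthInstance.maxHeartbeats 400000

variable {E : Type*} [NormedAddCommGroup E] [NormedSpace ℝ E] [FiniteDimensional ℝ E]
  {M : Type*} [TopologicalSpace M] [ChartedSpace E M] [IsManifold 𝓘(ℝ, E) ∞ M]
  (S : PseudoHermitian E M)

/-- The projection to the horizontal distribution in the chart at `q`. -/
def projRep (q : M) (z : E) : E →L[ℝ] E :=
  ContinuousLinearMap.id ℝ E - (formRep q S.θ z).smulRight (rep q S.ξ z)

/-- The Webster metric in the chart at `q`. -/
def metricRep (q : M) (z : E) : E →L[ℝ] E →L[ℝ] ℝ :=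
  (formRep q S.θ z).smulRight (formRep q S.θ z) +
    (localExtDeriv (formRep q S.θ) z).bilinearComp (S.projRep q z)
      ((endoRep q S.J z).comp (S.projRep q z))

variable {q x : M} {S}

theorem projRep_apply (z v : E) :
    S.projRep q z v = v - formRep q S.θ z v • rep q S.ξ z := rfl

theorem metricRep_apply (z u v : E) : S.metricRep q z u v =
    formRep q S.θ z u * formRep q S.θ z v + localExtDeriv (formRep q S.θ) z (S.projRep q z u)
      (endoRep q S.J z (S.projRep q z v)) := rfl

theorem coord_proj (hx : x ∈ (extChartAt 𝓘(ℝ, E) q).source) (v : TangentSpace 𝓘(ℝ, E) x) :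
    coord q x (S.proj x v) = S.projRep q (extChartAt 𝓘(ℝ, E) q x) (coord q x v) := by
  rw [projRep_apply, formRep_coord hx, rep_apply hx]
  exact (map_sub _ _ _).trans (congrArg (_ - ·) (map_smul _ _ _))

theorem metric_eq (hx : x ∈ (extChartAt 𝓘(ℝ, E) q).source) (u v : TangentSpace 𝓘(ℝ, E) x) :
    S.metric x u v =
      S.metricRep q (extChartAt 𝓘(ℝ, E) q x) (coord q x u) (coord q x v) := by
  rw [metric, metricRep_apply, formRep_coord hx, formRep_coord hx,
    extDerivOneForm_eq S.contMDiff_θ hx, ← coord_proj hx, ← coord_proj hx, endoRep_coord hx]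

theorem contDiffOn_rep_ξ : ContDiffOn ℝ ∞ (rep q S.ξ) (extChartAt 𝓘(ℝ, E) q).target := by
  intro z hz
  have h := (contMDiffAt_section_iff_rep le_rfl ((extChartAt 𝓘(ℝ, E) q).map_target hz)).1
    (S.contMDiff_ξ _)
  rw [(extChartAt 𝓘(ℝ, E) q).right_inv hz] at h
  exact h.contDiffWithinAt

theorem contDiffOn_metricRep :
    ContDiffOn ℝ ∞ (S.metricRep q) (extChartAt 𝓘(ℝ, E) q).target := by
  refine contDiffOn_clm_apply.2 fun a ↦ contDiffOn_clm_apply.2 fun b ↦ ?_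
  have hθ := contDiffOn_formRep S.contMDiff_θ q
  have hJ := contDiffOn_endoRep S.contMDiff_J q
  have hξ := contDiffOn_rep_ξ (S := S) (q := q)
  have hdθ : ContDiffOn ℝ ∞ (fderiv ℝ (formRep q S.θ)) (extChartAt 𝓘(ℝ, E) q).target :=
    hθ.fderiv_of_isOpen (isOpen_extChartAt_target q) (by simp)
  have hp : ∀ v, ContDiffOn ℝ ∞ (fun z ↦ S.projRep q z v) (extChartAt 𝓘(ℝ, E) q).target :=
    fun v ↦ contDiffOn_const.sub ((hθ.clm_apply contDiffOn_const).smul hξ)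
  have hJp := hJ.clm_apply (hp b)
  refine ((hθ.clm_apply contDiffOn_const).mul (hθ.clm_apply contDiffOn_const)).add ?_
  exact contDiffOn_const.mul (((hdθ.clm_apply (hp a)).clm_apply hJp).sub
    ((hdθ.clm_apply hJp).clm_apply (hp a)))

theorem θ_J_apply (x : M) (v : TangentSpace 𝓘(ℝ, E) x) : S.θ x (S.J x v) = 0 := by
  have h1 : S.θ x (v - S.θ x v • S.ξ x) = 0 := by
    refine (map_sub _ _ _).trans ?_
    rw [map_smul, S.θ_ξ]
    simp
  have h2 : S.J x (v - S.θ x v • S.ξ x) = S.J x v := by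
    refine (map_sub _ _ _).trans ?_
    rw [map_smul, S.J_ξ, smul_zero, sub_zero]
  rw [← h2]
  exact S.θ_J x _ h1

theorem formRep_ξ {z : E} (hz : z ∈ (extChartAt 𝓘(ℝ, E) q).target) :
    formRep q S.θ z (rep q S.ξ z) = 1 := by
  rw [formRep_rep hz, S.θ_ξ]

theorem formRep_J {z : E} (hz : z ∈ (extChartAt 𝓘(ℝ, E) q).target) (v : E) :
    formRep q S.θ z (endoRep q S.J z v) = 0 := by
  have hx := (extChartAt 𝓘(ℝ, E) q).map_target hz
  have h := formRep_coord (η := S.θ) hx (S.J _ (ofCoord q _ v))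
  rw [θ_J_apply, (extChartAt 𝓘(ℝ, E) q).right_inv hz] at h
  exact h

theorem endoRep_ξ {z : E} (hz : z ∈ (extChartAt 𝓘(ℝ, E) q).target) :
    endoRep q S.J z (rep q S.ξ z) = 0 := by
  rw [endoRep_rep hz, rep, S.J_ξ]
  exact map_zero _

theorem endoRep_endoRep {z : E} (hz : z ∈ (extChartAt 𝓘(ℝ, E) q).target) {v : E}
    (hv : formRep q S.θ z v = 0) :
    endoRep q S.J z (endoRep q S.J z v) = -v := by
  have hx := (extChartAt 𝓘(ℝ, E) q).map_target hz
  have h := S.J_J _ (ofCoord q _ v) hv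
  have h1 := endoRep_coord (J := S.J) hx (S.J _ (ofCoord q _ v))
  have h2 := endoRep_coord (J := S.J) hx (ofCoord q _ v)
  rw [coord_ofCoord hx] at h2
  rw [h, ← h2, (extChartAt 𝓘(ℝ, E) q).right_inv hz] at h1
  exact h1.trans ((map_neg _ _).trans (congrArg Neg.neg (coord_ofCoord hx v)))

theorem formRep_projRep {z : E} (hz : z ∈ (extChartAt 𝓘(ℝ, E) q).target) (v : E) :
    formRep q S.θ z (S.projRep q z v) = 0 := by
  rw [projRep_apply, map_sub, map_smul, formRep_ξ hz, smul_eq_mul, mul_one, sub_self]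

theorem endoRep_projRep {z : E} (hz : z ∈ (extChartAt 𝓘(ℝ, E) q).target) (v : E) :
    endoRep q S.J z (S.projRep q z v) = endoRep q S.J z v := by
  rw [projRep_apply, map_sub, map_smul, endoRep_ξ hz, smul_zero, sub_zero]

theorem projRep_of_horizontal {z v : E} (hv : formRep q S.θ z v = 0) :
    S.projRep q z v = v := by
  rw [projRep_apply, hv, zero_smul, sub_zero]

theorem projRep_ξ {z : E} (hz : z ∈ (extChartAt 𝓘(ℝ, E) q).target) :
    S.projRep q z (rep q S.ξ z) = 0 := by
  rw [projRep_apply, formRep_ξ hz, one_smul, sub_self]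

theorem metricRep_ξ_left {z : E} (hz : z ∈ (extChartAt 𝓘(ℝ, E) q).target) (v : E) :
    S.metricRep q z (rep q S.ξ z) v = formRep q S.θ z v := by
  rw [metricRep_apply, formRep_ξ hz, projRep_ξ hz, map_zero]; simp

theorem metricRep_ξ_right {z : E} (hz : z ∈ (extChartAt 𝓘(ℝ, E) q).target) (v : E) :
    S.metricRep q z v (rep q S.ξ z) = formRep q S.θ z v := by
  rw [metricRep_apply, formRep_ξ hz, projRep_ξ hz, map_zero, map_zero]; simp

theorem localExtDeriv_J_pos {z : E} (hz : z ∈ (extChartAt 𝓘(ℝ, E) q).target) {v : E}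
    (hv : formRep q S.θ z v = 0) (hv0 : v ≠ 0) :
    0 < localExtDeriv (formRep q S.θ) z v (endoRep q S.J z v) := by
  have hx := (extChartAt 𝓘(ℝ, E) q).map_target hz
  have h := S.levi_pos _ (ofCoord q _ v) hv (fun h ↦ hv0 <| by
    rw [← coord_ofCoord hx v, h]; exact map_zero _)
  rw [extDerivOneForm_eq S.contMDiff_θ hx, ← endoRep_coord hx, coord_ofCoord hx,
    (extChartAt 𝓘(ℝ, E) q).right_inv hz] at h
  exact h

theorem metricRep_pos {z : E} (hz : z ∈ (extChartAt 𝓘(ℝ, E) q).target) {v : E} (hv : v ≠ 0) :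
    0 < S.metricRep q z v v := by
  rw [metricRep_apply]
  by_cases h : S.projRep q z v = 0
  · have h1 : formRep q S.θ z v ≠ 0 := fun h1 ↦ hv <| by
      rw [projRep_apply, h1, zero_smul, sub_zero] at h; exact h
    rw [h, map_zero, _root_.zero_apply, add_zero]
    exact mul_self_pos.2 h1
  · have := localExtDeriv_J_pos (S := S) hz (formRep_projRep hz v) h
    nlinarith [mul_self_nonneg (formRep q S.θ z v)]

end PseudoHermitian

/-! ### The Levi form is symmetric; the Tanaka-Webster connection fits the local model. -/

namespace PseudoHermitian

set_option synthInstance.maxHeartbeats 400000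

variable {E : Type*} [NormedAddCommGroup E] [NormedSpace ℝ E] [FiniteDimensional ℝ E]
  {M : Type*} [TopologicalSpace M] [ChartedSpace E M] [IsManifold 𝓘(ℝ, E) ∞ M]
  {S : PseudoHermitian E M}
  {D : CovariantDerivative 𝓘(ℝ, E) E (TangentSpace 𝓘(ℝ, E) : M → Type _)} {q x : M}

theorem metric_ξ_left (x : M) (v : TangentSpace 𝓘(ℝ, E) x) :
    S.metric x (S.ξ x) v = S.θ x v := by
  have hx := mem_source_self (E := E) x
  have h := metricRep_ξ_left (S := S) ((extChartAt 𝓘(ℝ, E) x).map_source hx) (coord x x v)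
  rw [rep_apply hx] at h
  rw [metric_eq hx, h, formRep_coord hx]

theorem metric_ξ_right (x : M) (v : TangentSpace 𝓘(ℝ, E) x) :
    S.metric x v (S.ξ x) = S.θ x v := by
  have hx := mem_source_self (E := E) x
  have h := metricRep_ξ_right (S := S) ((extChartAt 𝓘(ℝ, E) x).map_source hx) (coord x x v)
  rw [rep_apply hx] at h
  rw [metric_eq hx, h, formRep_coord hx]

theorem metric_pos (x : M) {v : TangentSpace 𝓘(ℝ, E) x} (hv : v ≠ 0) : 0 < S.metric x v v := by
  have hx := mem_source_self (E := E) x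
  rw [metric_eq hx]
  refine metricRep_pos ((extChartAt 𝓘(ℝ, E) x).map_source hx) fun h ↦ hv ?_
  exact coord_injective hx (h.trans (map_zero _).symm)

theorem θ_proj (x : M) (v : TangentSpace 𝓘(ℝ, E) x) : S.θ x (S.proj x v) = 0 := by
  refine (map_sub _ _ _).trans ?_
  rw [map_smul, S.θ_ξ]
  simp

theorem mdifferentiableAt_ξ (x : M) : MDifferentiableAt 𝓘(ℝ, E) (𝓘(ℝ, E).prod 𝓘(ℝ, E))
    (fun y ↦ (⟨y, S.ξ y⟩ : TangentBundle 𝓘(ℝ, E) M)) x :=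
  (S.contMDiff_ξ x).mdifferentiableAt (by simp)

theorem mdifferentiableAt_proj {X : Π x : M, TangentSpace 𝓘(ℝ, E) x}
    (hX : MDifferentiableAt 𝓘(ℝ, E) (𝓘(ℝ, E).prod 𝓘(ℝ, E))
      (fun y ↦ (⟨y, X y⟩ : TangentBundle 𝓘(ℝ, E) M)) x) :
    MDifferentiableAt 𝓘(ℝ, E) (𝓘(ℝ, E).prod 𝓘(ℝ, E))
      (fun y ↦ (⟨y, S.proj y (X y)⟩ : TangentBundle 𝓘(ℝ, E) M)) x := by
  have hx := mem_source_self (E := E) x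
  have hξ := (mdifferentiableAt_section_iff_rep hx).1 (mdifferentiableAt_ξ (S := S) x)
  rw [mdifferentiableAt_section_iff_rep hx] at hX ⊢
  have h1 : DifferentiableAt ℝ (fun z ↦ rep x X z - formRep x S.θ z (rep x X z) • rep x S.ξ z)
      (extChartAt 𝓘(ℝ, E) x x) :=
    hX.sub (((differentiableAt_formRep S.contMDiff_θ hx).clm_apply hX).smul hξ)
  refine h1.congr_of_eventuallyEq ?_
  filter_upwards [target_mem_nhds hx] with z hz
  rw [formRep_rep hz]
  exact (map_sub _ _ _).trans (congrArg (_ - ·) (map_smul _ _ _))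

theorem mdifferentiableAt_J {X : Π x : M, TangentSpace 𝓘(ℝ, E) x}
    (hX : MDifferentiableAt 𝓘(ℝ, E) (𝓘(ℝ, E).prod 𝓘(ℝ, E))
      (fun y ↦ (⟨y, X y⟩ : TangentBundle 𝓘(ℝ, E) M)) x) :
    MDifferentiableAt 𝓘(ℝ, E) (𝓘(ℝ, E).prod 𝓘(ℝ, E))
      (fun y ↦ (⟨y, S.J y (X y)⟩ : TangentBundle 𝓘(ℝ, E) M)) x :=
  ((S.contMDiff_J x).mdifferentiableAt (by simp)).clm_bundle_apply hX

/-- The Levi form is symmetric. -/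
theorem localExtDeriv_J_symm {z : E} (hz : z ∈ (extChartAt 𝓘(ℝ, E) q).target) {u v : E}
    (hu : formRep q S.θ z u = 0) (hv : formRep q S.θ z v = 0) :
    localExtDeriv (formRep q S.θ) z u (endoRep q S.J z v) =
      localExtDeriv (formRep q S.θ) z v (endoRep q S.J z u) := by
  have hx := (extChartAt 𝓘(ℝ, E) q).map_target hz
  set x := (extChartAt 𝓘(ℝ, E) q).symm z with hxz
  have hri : extChartAt 𝓘(ℝ, E) q x = z := (extChartAt 𝓘(ℝ, E) q).right_inv hz
  -- Integrability gives θ([X, Y]) = θ([JX, JY]) for horizontal X and Y, that is, dθ(a, b) = dθ(Ja,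
  -- Jb). The vectors are extended by projections of constant fields, so θ vanishes identically on
  -- the extensions and only bracket terms remain. Replacing b by Jv and using J² = -1 yields the
  -- symmetry.
  have key : ∀ a b : E, formRep q S.θ z a = 0 → formRep q S.θ z b = 0 →
      localExtDeriv (formRep q S.θ) z a b =
      localExtDeriv (formRep q S.θ) z (endoRep q S.J z a) (endoRep q S.J z b) := by
    intro a b ha hb
    set X : Π x : M, TangentSpace 𝓘(ℝ, E) x := fun y ↦ S.proj y (ofCoord q y a) with hX
    set Y : Π x : M, TangentSpace 𝓘(ℝ, E) x := fun y ↦ S.proj y (ofCoord q y b) with hY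
    have hXd := mdifferentiableAt_proj (S := S) (mdifferentiableAt_ofCoord_const hx a)
    have hYd := mdifferentiableAt_proj (S := S) (mdifferentiableAt_ofCoord_const hx b)
    have hval : ∀ c : E, formRep q S.θ z c = 0 → coord q x (S.proj x (ofCoord q x c)) = c := by
      intro c hc
      rw [coord_proj hx, hri, coord_ofCoord hx, projRep_of_horizontal hc]
    have h1 := localExtDeriv_formRep S.contMDiff_θ hx hXd hYd
    have h2 := localExtDeriv_formRep S.contMDiff_θ hx (mdifferentiableAt_J (S := S) hXd)
      (mdifferentiableAt_J (S := S) hYd)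
    have h3 := (S.integrable X Y x (fun y ↦ θ_proj y _) (fun y ↦ θ_proj y _) hXd hYd).1
    rw [← endoRep_coord hx, ← endoRep_coord hx, hval a ha, hval b hb, hri] at h2
    rw [hval a ha, hval b hb, hri] at h1
    have h4 : ∀ c : E, (fun y ↦ S.θ y (S.proj y (ofCoord q y c))) = fun _ ↦ (0 : ℝ) :=
      fun c ↦ funext fun y ↦ θ_proj y _
    have h5 : ∀ c : E, (fun y ↦ S.θ y (S.J y (S.proj y (ofCoord q y c)))) = fun _ ↦ (0 : ℝ) :=
      fun c ↦ funext fun y ↦ θ_J_apply y _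
    rw [h4, h4, mvfderiv_const] at h1
    rw [h5, h5, mvfderiv_const] at h2
    have h6 : S.θ x (VectorField.mlieBracket 𝓘(ℝ, E) X Y x) =
        S.θ x (VectorField.mlieBracket 𝓘(ℝ, E) (fun y ↦ S.J y (X y)) (fun y ↦ S.J y (Y y)) x) :=
      sub_eq_zero.1 ((map_sub _ _ _).symm.trans h3)
    rw [h1, h2, h6]
    simp
    rfl
  rw [key u _ hu (formRep_J hz v), endoRep_endoRep hz hv, map_neg,
    localExtDeriv_antisymm, neg_neg]

theorem metricRep_symm {z : E} (hz : z ∈ (extChartAt 𝓘(ℝ, E) q).target) (u v : E) :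
    S.metricRep q z u v = S.metricRep q z v u := by
  rw [metricRep_apply, metricRep_apply,
    localExtDeriv_J_symm hz (formRep_projRep hz u) (formRep_projRep hz v), mul_comm]

namespace IsTanakaWebster

variable (hD : S.IsTanakaWebster D)

include hD

/-- Differentiating ⟨ξ, ξ⟩ = 1 shows that the derivative of ξ is horizontal. Differentiating ⟨ξ, Z⟩
= 0 for horizontal Z, whose derivative stays horizontal, shows that it is orthogonal to H. Hence it
is zero. -/
theorem connection_ξ (x : M) (u : TangentSpace 𝓘(ℝ, E) x) : D S.ξ x u = 0 := by
  set w := D S.ξ x u with hw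
  have hξ := mdifferentiableAt_ξ (S := S) x
  have h1 := hD.metric_parallel S.ξ S.ξ x hξ hξ u
  have h2 : (fun y ↦ S.metric y (S.ξ y) (S.ξ y)) = fun _ ↦ (1 : ℝ) := by
    funext y; rw [metric_ξ_left, S.θ_ξ]
  rw [h2, mvfderiv_const, ← hw, metric_ξ_left, metric_ξ_right] at h1
  have h3 : S.θ x w = 0 := by
    have : (0 : ℝ) = S.θ x w + S.θ x w := h1
    linarith
  have hZ := mdifferentiableAt_proj (S := S) (mdifferentiableAt_extend_section w)
  have hhor : ∀ y, S.θ y (S.proj y (extend E w y)) = 0 := fun y ↦ θ_proj y _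
  have h4 := hD.metric_parallel S.ξ (fun y ↦ S.proj y (extend E w y)) x hξ hZ u
  have h5 : (fun y ↦ S.metric y (S.ξ y) (S.proj y (extend E w y))) = fun _ ↦ (0 : ℝ) := by
    funext y; rw [metric_ξ_left, hhor]
  have h6 : S.proj x (extend E w x) = w := by
    rw [extend_apply_self, proj, h3, zero_smul, sub_zero]
  rw [h5, mvfderiv_const, ← hw, metric_ξ_left, hD.horizontal _ x hhor hZ u, h6] at h4
  by_contra hne
  have h7 : (0 : ℝ) = S.metric x w w + 0 := h4
  linarith [metric_pos (S := S) x hne]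

/-- Compatibility is tested on fields with constant coordinates a and b, whose covariant derivatives
are pure Christoffel terms. -/
theorem fderiv_metricRep {z : E} (hz : z ∈ (extChartAt 𝓘(ℝ, E) q).target) (u a b : E) :
    fderiv ℝ (S.metricRep q) z u a b = S.metricRep q z (christoffel D q z u a) b
      + S.metricRep q z a (christoffel D q z u b) := by
  have hx := (extChartAt 𝓘(ℝ, E) q).map_target hz
  set x := (extChartAt 𝓘(ℝ, E) q).symm z with hxz
  have hri : extChartAt 𝓘(ℝ, E) q x = z := (extChartAt 𝓘(ℝ, E) q).right_inv hz
  have h := hD.metric_parallel _ _ x (mdifferentiableAt_ofCoord_const hx a)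
    (mdifferentiableAt_ofCoord_const hx b) (ofCoord q x u)
  have hg : HasFDerivAt (S.metricRep q) (fderiv ℝ (S.metricRep q) z) z :=
    ((contDiffOn_metricRep.contDiffAt (target_mem_nhds hx)).differentiableAt
      (by simp)).hasFDerivAt.congr_fderiv (by rw [hri]) |> fun h ↦ by rwa [hri] at h
  have h1 := (hg.clm_apply (hasFDerivAt_const a z)).clm_apply (hasFDerivAt_const b z)
  have h2 : (fun y ↦ S.metric y (ofCoord q y a) (ofCoord q y b)) ∘ (extChartAt 𝓘(ℝ, E) q).symm
      =ᶠ[𝓝 z] fun z ↦ S.metricRep q z a b := by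
    rw [← hri]
    filter_upwards [target_mem_nhds hx] with w hw
    have hw' := (extChartAt 𝓘(ℝ, E) q).map_target hw
    rw [Function.comp_apply, metric_eq hw', coord_ofCoord hw', coord_ofCoord hw',
      (extChartAt 𝓘(ℝ, E) q).right_inv hw]
  have h3 := h1.congr_of_eventuallyEq h2
  have h4 : MDifferentiableAt 𝓘(ℝ, E) 𝓘(ℝ, ℝ)
      (fun y ↦ S.metric y (ofCoord q y a) (ofCoord q y b)) x :=
    (mdifferentiableAt_iff_coord hx).2 (by rw [hri]; exact h3.differentiableAt)
  rw [mvfderiv_eq_coord hx h4, hri, h3.fderiv, metric_eq hx, metric_eq hx,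
    coord_connection_const hx, coord_connection_const hx, hri, coord_ofCoord hx,
    coord_ofCoord hx, coord_ofCoord hx] at h
  simpa using h

theorem fderiv_endoRep {z : E} (hz : z ∈ (extChartAt 𝓘(ℝ, E) q).target) (u a : E) :
    fderiv ℝ (endoRep q S.J) z u a = endoRep q S.J z (christoffel D q z u a)
      - christoffel D q z u (endoRep q S.J z a) := by
  have hx := (extChartAt 𝓘(ℝ, E) q).map_target hz
  set x := (extChartAt 𝓘(ℝ, E) q).symm z with hxz
  have hri : extChartAt 𝓘(ℝ, E) q x = z := (extChartAt 𝓘(ℝ, E) q).right_inv hz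
  have hσ := mdifferentiableAt_ofCoord_const hx a
  have h := congrArg (coord q x) (hD.J_parallel _ x hσ (ofCoord q x u))
  have hg : DifferentiableAt ℝ (endoRep q S.J) z := by
    have := ((contDiffOn_endoRep S.contMDiff_J q).contDiffAt (target_mem_nhds hx)).differentiableAt
      (by simp)
    rwa [hri] at this
  have h1 := hg.hasFDerivAt.clm_apply (hasFDerivAt_const a z)
  have h2 : rep q (fun y ↦ S.J y (ofCoord q y a)) =ᶠ[𝓝 z] fun z ↦ endoRep q S.J z a := by
    rw [← hri]
    filter_upwards [target_mem_nhds hx] with w hw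
    rfl
  rw [coord_connection hx (mdifferentiableAt_J hσ), hri, (h1.congr_of_eventuallyEq h2).fderiv,
    ← endoRep_coord hx, ← endoRep_coord hx, coord_connection_const hx, hri, coord_ofCoord hx,
    coord_ofCoord hx] at h
  rw [eq_sub_iff_add_eq, ← h]
  simp

theorem fderiv_rep_ξ {z : E} (hz : z ∈ (extChartAt 𝓘(ℝ, E) q).target) (u : E) :
    fderiv ℝ (rep q S.ξ) z u = -christoffel D q z u (rep q S.ξ z) := by
  have hx := (extChartAt 𝓘(ℝ, E) q).map_target hz
  have h := coord_connection (D := D) hx (mdifferentiableAt_ξ (S := S) _) (ofCoord q _ u)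
  rw [hD.connection_ξ, coord_ofCoord hx, (extChartAt 𝓘(ℝ, E) q).right_inv hz] at h
  exact eq_neg_of_add_eq_zero_left (h.symm.trans (map_zero _))

/-- By the Sasakian condition ξ contributes nothing, so both arguments may be projected to H. There
T = 2dθ ξ, and J² = -1 turns dθ(u, v) into -⟨u, Jv⟩. In this form T is visibly a product of parallel
tensors. -/
theorem localTorsion_christoffel (hS : S.IsSasakian D) {z : E}
    (hz : z ∈ (extChartAt 𝓘(ℝ, E) q).target) (u v : E) :
    localTorsion (christoffel D q) z u v =
      (-2 * S.metricRep q z u (endoRep q S.J z v)) • rep q S.ξ z := by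
  have hx := (extChartAt 𝓘(ℝ, E) q).map_target hz
  have hri : extChartAt 𝓘(ℝ, E) q _ = z := (extChartAt 𝓘(ℝ, E) q).right_inv hz
  have hcoord : ∀ a b, localTorsion (christoffel D q) z a b =
      coord q ((extChartAt 𝓘(ℝ, E) q).symm z)
        (D.torsion ((extChartAt 𝓘(ℝ, E) q).symm z) (ofCoord q _ a) (ofCoord q _ b)) := by
    intro a b
    rw [coord_torsion hx, coord_ofCoord hx, coord_ofCoord hx, hri]
  have hξ : ∀ b, localTorsion (christoffel D q) z (rep q S.ξ z) b = 0 := by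
    intro b
    rw [hcoord]
    have : ofCoord q ((extChartAt 𝓘(ℝ, E) q).symm z) (rep q S.ξ z) = S.ξ _ := ofCoord_coord hx _
    rw [this, hS]
    exact map_zero _
  have hhor : ∀ a b, formRep q S.θ z a = 0 → formRep q S.θ z b = 0 →
      localTorsion (christoffel D q) z a b =
        (2 * localExtDeriv (formRep q S.θ) z a b) • rep q S.ξ z := by
    intro a b ha hb
    rw [hcoord, hD.torsion_horizontal _ (ofCoord q _ a) (ofCoord q _ b) ha hb, extDerivOneForm_eq S.contMDiff_θ hx,
      coord_ofCoord hx, coord_ofCoord hx, hri]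
    exact map_smul _ _ _
  have hsplit : ∀ a, a = S.projRep q z a + formRep q S.θ z a • rep q S.ξ z := by
    intro a; rw [projRep_apply]; abel
  have h1 : localTorsion (christoffel D q) z u v =
      localTorsion (christoffel D q) z (S.projRep q z u) (S.projRep q z v) := by
    have e1 : ∀ a b, localTorsion (christoffel D q) z a b =
        localTorsion (christoffel D q) z (S.projRep q z a) b := by
      intro a b
      have h0 := hξ b
      simp only [localTorsion] at h0 ⊢
      conv_lhs => rw [hsplit a]
      rw [sub_eq_zero] at h0
      simp only [map_add, map_smul, _root_.add_apply, _root_.smul_apply, h0]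
      abel
    have e2 : ∀ a b, localTorsion (christoffel D q) z a b =
        -localTorsion (christoffel D q) z b a := by
      intro a b; simp [localTorsion]
    rw [e1, e2, e1, e2, neg_neg]
  rw [h1, hhor _ _ (formRep_projRep hz u) (formRep_projRep hz v), metricRep_apply,
    formRep_J hz, projRep_of_horizontal (formRep_J hz v), ← endoRep_projRep hz v,
    endoRep_endoRep hz (formRep_projRep hz v), map_neg]
  congr 1
  ring

theorem isLocalSasakian [T2Space M] (hS : S.IsSasakian D) (q : M) :
    IsLocalSasakian (extChartAt 𝓘(ℝ, E) q).target (christoffel D q) (S.metricRep q)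
      (endoRep q S.J) (rep q S.ξ) where
  isOpen := isOpen_extChartAt_target q
  contDiffOn_christoffel := (contDiffOn_christoffel hD.smooth q).of_le (by simp)
  contDiffOn_metric := contDiffOn_metricRep.of_le (by simp)
  contDiffOn_J := (contDiffOn_endoRep S.contMDiff_J q).of_le (by simp)
  contDiffOn_ξ := contDiffOn_rep_ξ.of_le (by simp)
  fderiv_metric _ hz := hD.fderiv_metricRep hz
  fderiv_J _ hz := hD.fderiv_endoRep hz
  fderiv_ξ _ hz := hD.fderiv_rep_ξ hz
  torsion _ hz := hD.localTorsion_christoffel hS hz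
  metric_ξ_J _ hz v := by rw [metricRep_ξ_left hz, formRep_J hz]
  symm _ hz := metricRep_symm hz

end IsTanakaWebster

end PseudoHermitian

/-! ### Covariant derivatives along curves, independently of the chart. -/

section Curves

set_option synthInstance.maxHeartbeats 400000

variable {E : Type*} [NormedAddCommGroup E] [NormedSpace ℝ E] [FiniteDimensional ℝ E]
  {M : Type*} [TopologicalSpace M] [ChartedSpace E M] [IsManifold 𝓘(ℝ, E) ∞ M]

/-- The coordinates of a tangent vector, given as a point and an element of the model space. -/
def lift (q : M) (p : M × E) : E × E := (extChartAt 𝓘(ℝ, E) q p.1, coord q p.1 p.2)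

/-- The tangent vector with given coordinates. -/
def unlift (q : M) (z : E × E) : M × E :=
  ((extChartAt 𝓘(ℝ, E) q).symm z.1, ofCoord q ((extChartAt 𝓘(ℝ, E) q).symm z.1) z.2)

/-- The change of coordinates of the tangent bundle. -/
def transition (q q' : M) (z : E × E) : E × E :=
  (extChartAt 𝓘(ℝ, E) q' ((extChartAt 𝓘(ℝ, E) q).symm z.1),
    fderiv ℝ (extChartAt 𝓘(ℝ, E) q' ∘ (extChartAt 𝓘(ℝ, E) q).symm) z.1 z.2)

variable {D : CovariantDerivative 𝓘(ℝ, E) E (TangentSpace 𝓘(ℝ, E) : M → Type _)}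

variable (D) in
/-- The derivative of the coordinates of a vector field with value `u` at `x`, in the direction `y`
in which its covariant derivative is `w`. -/
def liftDeriv (q x : M) (u y w : E) : E × E :=
  (coord q x y, coord q x w -
    christoffel D q (extChartAt 𝓘(ℝ, E) q x) (coord q x y) (coord q x u))

variable {q q' x : M}

theorem unlift_lift {p : M × E} (hp : p.1 ∈ (extChartAt 𝓘(ℝ, E) q).source) :
    unlift q (lift q p) = p := by
  have h1 := (extChartAt 𝓘(ℝ, E) q).left_inv hp
  have h2 : ∀ y : M, y = p.1 → ((y, (ofCoord q y (coord q p.1 p.2) : E)) : M × E) = p := by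
    rintro y rfl
    exact Prod.ext rfl (ofCoord_coord hp p.2)
  exact h2 _ h1

theorem lift_unlift {z : E × E} (hz : z.1 ∈ (extChartAt 𝓘(ℝ, E) q).target) :
    lift q (unlift q z) = z :=
  Prod.ext ((extChartAt 𝓘(ℝ, E) q).right_inv hz)
    (coord_ofCoord ((extChartAt 𝓘(ℝ, E) q).map_target hz) z.2)

theorem contDiffAt_chart_transition (hx : x ∈ (extChartAt 𝓘(ℝ, E) q).source)
    (hx' : x ∈ (extChartAt 𝓘(ℝ, E) q').source) :
    ContDiffAt ℝ ∞ (extChartAt 𝓘(ℝ, E) q' ∘ (extChartAt 𝓘(ℝ, E) q).symm)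
      (extChartAt 𝓘(ℝ, E) q x) :=
  (contMDiffAt_iff_coord le_rfl hx).1 (contMDiffAt_chart le_rfl hx')

theorem coord_change (hx : x ∈ (extChartAt 𝓘(ℝ, E) q).source)
    (hx' : x ∈ (extChartAt 𝓘(ℝ, E) q').source) (v : TangentSpace 𝓘(ℝ, E) x) :
    coord q' x v = fderiv ℝ (extChartAt 𝓘(ℝ, E) q' ∘ (extChartAt 𝓘(ℝ, E) q).symm)
      (extChartAt 𝓘(ℝ, E) q x) (coord q x v) := by
  have h := mvfderiv_eq_coord hx
    ((contMDiffAt_chart (n := 1) (by simp) hx').mdifferentiableAt one_ne_zero) v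
  rw [← h, coord_eq_mfderiv hx']
  rfl

theorem lift_change {p : M × E} (hp : p.1 ∈ (extChartAt 𝓘(ℝ, E) q).source)
    (hp' : p.1 ∈ (extChartAt 𝓘(ℝ, E) q').source) :
    lift q' p = transition q q' (lift q p) :=
  Prod.ext (congrArg (extChartAt 𝓘(ℝ, E) q') ((extChartAt 𝓘(ℝ, E) q).left_inv hp).symm)
    (coord_change hp hp' _)

/-- The transformation rule for Christoffel symbols. -/
theorem christoffel_change (hx : x ∈ (extChartAt 𝓘(ℝ, E) q).source)
    (hx' : x ∈ (extChartAt 𝓘(ℝ, E) q').source) (a b : E) :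
    fderiv ℝ (extChartAt 𝓘(ℝ, E) q' ∘ (extChartAt 𝓘(ℝ, E) q).symm) (extChartAt 𝓘(ℝ, E) q x)
      (christoffel D q (extChartAt 𝓘(ℝ, E) q x) a b) =
    fderiv ℝ (fderiv ℝ (extChartAt 𝓘(ℝ, E) q' ∘ (extChartAt 𝓘(ℝ, E) q).symm))
      (extChartAt 𝓘(ℝ, E) q x) a b +
    christoffel D q' (extChartAt 𝓘(ℝ, E) q' x)
      (fderiv ℝ (extChartAt 𝓘(ℝ, E) q' ∘ (extChartAt 𝓘(ℝ, E) q).symm) (extChartAt 𝓘(ℝ, E) q x) a)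
      (fderiv ℝ (extChartAt 𝓘(ℝ, E) q' ∘ (extChartAt 𝓘(ℝ, E) q).symm)
        (extChartAt 𝓘(ℝ, E) q x) b) := by
  set κ := extChartAt 𝓘(ℝ, E) q' ∘ (extChartAt 𝓘(ℝ, E) q).symm with hκ
  have hκd := contDiffAt_chart_transition hx hx'
  rw [← hκ] at hκd
  have hσ := mdifferentiableAt_ofCoord_const hx b
  have h1 := coord_connection (D := D) hx' hσ (ofCoord q x a)
  rw [coord_change hx hx', coord_connection_const hx, coord_change hx hx' (ofCoord q x a),
    coord_change hx hx' (ofCoord q x b), coord_ofCoord hx, coord_ofCoord hx, ← hκ] at h1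
  rw [h1]
  congr 1
  have hrep := (mdifferentiableAt_section_iff_rep hx').1 hσ
  -- A field with constant coordinates b in one chart has coordinates Dκ(·)b in the other;
  -- differentiating this produces the inhomogeneous term D²κ.
  have h2 : rep q' (fun y ↦ ofCoord q y b) ∘ κ =ᶠ[𝓝 (extChartAt 𝓘(ℝ, E) q x)]
      fun z ↦ fderiv ℝ κ z b := by
    filter_upwards [eventually_coord hx (source_mem_nhds hx')] with z hz
    have h3 : (extChartAt 𝓘(ℝ, E) q').symm (κ z) = (extChartAt 𝓘(ℝ, E) q).symm z :=
      (extChartAt 𝓘(ℝ, E) q').left_inv hz.2.2.2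
    have h4 : ∀ y, y = (extChartAt 𝓘(ℝ, E) q).symm z →
        coord q' y (ofCoord q y b) = fderiv ℝ κ z b := by
      rintro y rfl
      rw [coord_change hz.2.1 hz.2.2.2, coord_ofCoord hz.2.1, hz.2.2.1]
    exact h4 _ h3
  have hκx : κ (extChartAt 𝓘(ℝ, E) q x) = extChartAt 𝓘(ℝ, E) q' x :=
    congrArg (extChartAt 𝓘(ℝ, E) q') ((extChartAt 𝓘(ℝ, E) q).left_inv hx)
  have hdκ : DifferentiableAt ℝ (fderiv ℝ κ) (extChartAt 𝓘(ℝ, E) q x) :=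
    (hκd.fderiv_right (m := 1) (by norm_cast)).differentiableAt one_ne_zero
  have h5 := (hκx.symm ▸ hrep.hasFDerivAt : HasFDerivAt (rep q' (fun y ↦ ofCoord q y b))
    (fderiv ℝ (rep q' (fun y ↦ ofCoord q y b)) (extChartAt 𝓘(ℝ, E) q' x))
    (κ (extChartAt 𝓘(ℝ, E) q x))).comp _ (hκd.differentiableAt (by simp)).hasFDerivAt
  have h6 := (hdκ.hasFDerivAt.clm_apply (hasFDerivAt_const b _)).congr_of_eventuallyEq h2
  have h7 := congrArg (fun L : E →L[ℝ] E ↦ L a) (h5.unique h6)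
  simpa using h7

/-- The second derivative of the chart change, which enters the derivative of the transition map,
cancels the inhomogeneous term in the transformation rule of Γ. Covariant differentiation along
curves is therefore independent of the chart. -/
theorem exists_hasFDerivAt_transition (hx : x ∈ (extChartAt 𝓘(ℝ, E) q).source)
    (hx' : x ∈ (extChartAt 𝓘(ℝ, E) q').source) (u : E) :
    ∃ L : E × E →L[ℝ] E × E, HasFDerivAt (transition q q') L (lift q (x, u)) ∧
      ∀ y w : E, L (liftDeriv D q x u y w) = liftDeriv D q' x u y w := by
  set κ := extChartAt 𝓘(ℝ, E) q' ∘ (extChartAt 𝓘(ℝ, E) q).symm with hκ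
  have hκd := contDiffAt_chart_transition hx hx'
  rw [← hκ] at hκd
  have hdκ : DifferentiableAt ℝ (fderiv ℝ κ) (extChartAt 𝓘(ℝ, E) q x) :=
    (hκd.fderiv_right (m := 1) (by norm_cast)).differentiableAt one_ne_zero
  have h1 : HasFDerivAt (fun p : E × E ↦ κ p.1)
      ((fderiv ℝ κ (extChartAt 𝓘(ℝ, E) q x)).comp (ContinuousLinearMap.fst ℝ E E))
      (lift q (x, u)) :=
    HasFDerivAt.comp (𝕜 := ℝ) (g := κ) (f := fun p : E × E ↦ p.1) (lift q (x, u))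
      (hκd.differentiableAt (by simp)).hasFDerivAt hasFDerivAt_fst
  have h2 : HasFDerivAt (fun p : E × E ↦ fderiv ℝ κ p.1)
      ((fderiv ℝ (fderiv ℝ κ) (extChartAt 𝓘(ℝ, E) q x)).comp (ContinuousLinearMap.fst ℝ E E))
      (lift q (x, u)) := by
    have := HasFDerivAt.comp (𝕜 := ℝ) (g := fderiv ℝ κ)
      (g' := fderiv ℝ (fderiv ℝ κ) (extChartAt 𝓘(ℝ, E) q x)) (f := fun p : E × E ↦ p.1)
      (lift q (x, u)) (f' := ContinuousLinearMap.fst ℝ E E)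
    exact this hdκ.hasFDerivAt hasFDerivAt_fst
  have h3 := h1.prodMk (h2.clm_apply hasFDerivAt_snd)
  refine ⟨_, h3, fun y w ↦ ?_⟩
  have hc := christoffel_change (D := D) hx hx' (coord q x y) (coord q x u)
  have hy : coord q' x y = fderiv ℝ κ (extChartAt 𝓘(ℝ, E) q x) (coord q x y) :=
    coord_change hx hx' y
  have hu : coord q' x u = fderiv ℝ κ (extChartAt 𝓘(ℝ, E) q x) (coord q x u) :=
    coord_change hx hx' u
  have hw : coord q' x w = fderiv ℝ κ (extChartAt 𝓘(ℝ, E) q x) (coord q x w) :=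
    coord_change hx hx' w
  rw [← hκ] at hc
  refine Prod.ext hy.symm ?_
  simp only [liftDeriv, lift, ContinuousLinearMap.prod_apply, _root_.add_apply,
    ContinuousLinearMap.comp_apply, ContinuousLinearMap.flip_apply, ContinuousLinearMap.coe_fst',
    ContinuousLinearMap.coe_snd', map_sub, hc, hy, hu, hw]
  abel

variable (D) in
/-- The curve `c` in the tangent bundle, regarded as a vector field along its projection to `M`, has
covariant derivative `w` at time `t`, when the velocity of its projection is `y`. -/
structure HasCovDerivWithinAt (c : ℝ → M × E) (y w : E) (s : Set ℝ) (t : ℝ) : Prop where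
  continuousWithinAt : ContinuousWithinAt (fun r ↦ (c r).1) s t
  hasDerivWithinAt : ∀ q, (c t).1 ∈ (extChartAt 𝓘(ℝ, E) q).source →
    HasDerivWithinAt (fun r ↦ lift q (c r)) (liftDeriv D q (c t).1 (c t).2 y w) s t

theorem lift_change_of_tendsto {ι : Type*} {l : Filter ι} {f : ι → M × E}
    (hx : x ∈ (extChartAt 𝓘(ℝ, E) q).source)
    (hx' : x ∈ (extChartAt 𝓘(ℝ, E) q').source) (hf : Tendsto (fun i ↦ (f i).1) l (𝓝 x)) :
    (fun i ↦ lift q' (f i)) =ᶠ[l] fun i ↦ transition q q' (lift q (f i)) := by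
  filter_upwards [hf (source_mem_nhds hx), hf (source_mem_nhds hx')] with i h1 h2
  exact lift_change h1 h2

/-- One chart suffices, by the chain rule for the transition map. Continuity of the base curve is
assumed separately, since the formula for the coordinates carries no information where the curve is
outside the chart domain. -/
theorem HasCovDerivWithinAt.of_chart {c : ℝ → M × E} {y w : E} {s : Set ℝ} {t : ℝ}
    (hc : ContinuousWithinAt (fun r ↦ (c r).1) s t)
    (hq : (c t).1 ∈ (extChartAt 𝓘(ℝ, E) q).source)
    (h : HasDerivWithinAt (fun r ↦ lift q (c r)) (liftDeriv D q (c t).1 (c t).2 y w) s t) :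
    HasCovDerivWithinAt D c y w s t := by
  refine ⟨hc, fun q' hq' ↦ ?_⟩
  obtain ⟨L, hL, hL'⟩ := exists_hasFDerivAt_transition (D := D) hq hq' (c t).2
  rw [← hL' y w]
  refine (HasFDerivAt.comp_hasDerivWithinAt (l := transition q q') t hL h).congr_of_eventuallyEq
    (lift_change_of_tendsto hq hq' hc) (lift_change hq hq')

/-- The derivative of a family of tangent vectors, in another chart. -/
theorem hasFDerivAt_lift_change {G : Type*} [NormedAddCommGroup G] [NormedSpace ℝ G]
    {f : G → M × E} {v : G} {A : G →L[ℝ] E × E} (hc : ContinuousAt (fun r ↦ (f r).1) v)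
    (hq : (f v).1 ∈ (extChartAt 𝓘(ℝ, E) q).source)
    (hq' : (f v).1 ∈ (extChartAt 𝓘(ℝ, E) q').source)
    (hA : HasFDerivAt (fun r ↦ lift q (f r)) A v) :
    ∃ A' : G →L[ℝ] E × E, HasFDerivAt (fun r ↦ lift q' (f r)) A' v ∧
      ∀ g y w, A g = liftDeriv D q (f v).1 (f v).2 y w →
        A' g = liftDeriv D q' (f v).1 (f v).2 y w := by
  obtain ⟨L, hL, hL'⟩ := exists_hasFDerivAt_transition (D := D) hq hq' (f v).2
  refine ⟨L.comp A, ?_, fun g y w h ↦ ?_⟩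
  · exact (HasFDerivAt.comp (g := transition q q') v hL hA).congr_of_eventuallyEq
      (lift_change_of_tendsto hq hq' hc)
  · rw [ContinuousLinearMap.comp_apply, h, hL']

end Curves

/-! ### Gluing, and comparison with velocities and derivatives along curves of `M`. -/

section Curves

set_option synthInstance.maxHeartbeats 400000

variable {E : Type*} [NormedAddCommGroup E] [NormedSpace ℝ E] [FiniteDimensional ℝ E]
  {M : Type*} [TopologicalSpace M] [ChartedSpace E M] [IsManifold 𝓘(ℝ, E) ∞ M]
  {D : CovariantDerivative 𝓘(ℝ, E) E (TangentSpace 𝓘(ℝ, E) : M → Type _)}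
  {q x : M} {c c' : ℝ → M × E} {y y' w w' : E} {s s' : Set ℝ} {t : ℝ}

theorem liftDeriv_geodesic (u : E) :
    liftDeriv D q x u u 0 = localSpray (christoffel D q) (lift q (x, u)) := by
  refine Prod.ext rfl ?_
  change coord q x (0 : TangentSpace 𝓘(ℝ, E) x) - _ = - _
  rw [map_zero, zero_sub]
  rfl

theorem mem_target_of_lift {p : M × E} (hp : p.1 ∈ (extChartAt 𝓘(ℝ, E) q).source) :
    (lift q p).1 ∈ (extChartAt 𝓘(ℝ, E) q).target :=
  (extChartAt 𝓘(ℝ, E) q).map_source hp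

namespace HasCovDerivWithinAt

theorem congr_nhds (h : HasCovDerivWithinAt D c' y w s t) (hs : s ∈ 𝓝[s'] t)
    (he : c =ᶠ[𝓝[s'] t] c') (ht : c t = c' t) : HasCovDerivWithinAt D c y w s' t where
  continuousWithinAt := by
    refine (h.continuousWithinAt.mono_of_mem_nhdsWithin hs).congr_of_eventuallyEq ?_
      (congrArg Prod.fst ht)
    filter_upwards [he] with r hr
    rw [hr]
  hasDerivWithinAt q hq := by
    rw [ht] at hq ⊢
    refine ((h.hasDerivWithinAt q hq).mono_of_mem_nhdsWithin hs).congr_of_eventuallyEq ?_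
      (congrArg (lift q) ht)
    filter_upwards [he] with r hr
    rw [hr]

theorem congr (h : HasCovDerivWithinAt D c' y w s t) (he : ∀ r ∈ s, c r = c' r)
    (ht : c t = c' t) : HasCovDerivWithinAt D c y w s t :=
  h.congr_nhds self_mem_nhdsWithin (eventually_mem_nhdsWithin.mono he) ht

theorem mono (h : HasCovDerivWithinAt D c y w s t) (hs : s' ⊆ s) :
    HasCovDerivWithinAt D c y w s' t :=
  ⟨h.continuousWithinAt.mono hs, fun q hq ↦ (h.hasDerivWithinAt q hq).mono hs⟩

theorem union (h : HasCovDerivWithinAt D c y w s t) (h' : HasCovDerivWithinAt D c y w s' t) :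
    HasCovDerivWithinAt D c y w (s ∪ s') t :=
  ⟨h.continuousWithinAt.union h'.continuousWithinAt,
    fun q hq ↦ (h.hasDerivWithinAt q hq).union (h'.hasDerivWithinAt q hq)⟩

theorem singleton (c : ℝ → M × E) (y w : E) (t : ℝ) : HasCovDerivWithinAt D c y w {t} t :=
  ⟨continuousWithinAt_singleton, fun _ _ ↦ HasFDerivWithinAt.singleton⟩

theorem continuousWithinAt_lift (h : HasCovDerivWithinAt D c y w s t)
    (hq : (c t).1 ∈ (extChartAt 𝓘(ℝ, E) q).source) :
    ContinuousWithinAt (fun r ↦ lift q (c r)) s t :=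
  (h.hasDerivWithinAt q hq).continuousWithinAt

theorem glue {c c' : ℝ → M × E} {y y' w w' : ℝ → E} {a s t : ℝ} (has : a ≤ s) (hst : s ≤ t)
    (h : ∀ r ∈ Icc a s, HasCovDerivWithinAt D c (y r) (w r) (Icc a s) r)
    (h' : ∀ r ∈ Icc s t, HasCovDerivWithinAt D c' (y' r) (w' r) (Icc s t) r)
    (hc : c s = c' s) (hy : y s = y' s) (hw : w s = w' s) :
    ∀ r ∈ Icc a t, HasCovDerivWithinAt D (fun r ↦ if r ≤ s then c r else c' r)
      (if r ≤ s then y r else y' r) (if r ≤ s then w r else w' r) (Icc a t) r := by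
  intro r hr
  rcases lt_trichotomy r s with hrs | rfl | hrs
  · simp only [hrs.le, if_true]
    refine (h r ⟨hr.1, hrs.le⟩).congr_nhds ?_ ?_ (by simp [hrs.le])
    · filter_upwards [self_mem_nhdsWithin, mem_nhdsWithin_of_mem_nhds (Iio_mem_nhds hrs)]
        with τ h1 h2 using ⟨h1.1, le_of_lt h2⟩
    · filter_upwards [mem_nhdsWithin_of_mem_nhds (Iio_mem_nhds hrs)] with τ h2
      simp [le_of_lt (mem_Iio.1 h2)]
  · simp only [le_refl, if_true]
    rw [← Icc_union_Icc_eq_Icc has hst]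
    refine ((h r ⟨has, le_rfl⟩).congr ?_ (by simp)).union
      ((hy ▸ hw ▸ h' r ⟨le_rfl, hst⟩).congr ?_ (by simp [hc]))
    · intro τ hτ; simp [hτ.2]
    · intro τ hτ
      by_cases h1 : τ ≤ r
      · have : τ = r := le_antisymm h1 hτ.1
        simp [this, hc]
      · simp [h1]
  · simp only [not_le.2 hrs, if_false]
    refine (h' r ⟨hrs.le, hr.2⟩).congr_nhds ?_ ?_ (by simp [not_le.2 hrs])
    · filter_upwards [self_mem_nhdsWithin, mem_nhdsWithin_of_mem_nhds (Ioi_mem_nhds hrs)]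
        with τ h1 h2 using ⟨le_of_lt h2, h1.2⟩
    · filter_upwards [mem_nhdsWithin_of_mem_nhds (Ioi_mem_nhds hrs)] with τ h2
      simp [not_le.2 (mem_Ioi.1 h2)]

end HasCovDerivWithinAt

/-- The standard extension of a vector at x has constant coordinates in the chart at x, so its
derivative is the Christoffel term alone. -/
theorem coord_connection_extend (V u : TangentSpace 𝓘(ℝ, E) x) :
    coord x x (D (extend E V) x u) =
      christoffel D x (extChartAt 𝓘(ℝ, E) x x) (coord x x u) (coord x x V) := by
  have hq := mem_source_self (E := E) x
  have h5 : rep x (extend E V) =ᶠ[𝓝 (extChartAt 𝓘(ℝ, E) x x)] fun _ ↦ coord x x V := by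
    filter_upwards [target_mem_nhds hq] with z hz
    have hz' := (extChartAt 𝓘(ℝ, E) x).map_target hz
    rw [rep, extend_apply hz', coord_ofCoord hz']
  rw [coord_connection hq (mdifferentiableAt_extend_section V), h5.fderiv_eq, extend_apply_self]
  simp

theorem hasDerivWithinAt_fst {f : ℝ → E × E} {f' : E × E} (h : HasDerivWithinAt f f' s t) :
    HasDerivWithinAt (fun r ↦ (f r).1) f'.1 s t :=
  (hasFDerivAt_fst (𝕜 := ℝ) (p := f t)).comp_hasDerivWithinAt t h

theorem hasDerivWithinAt_snd {f : ℝ → E × E} {f' : E × E} (h : HasDerivWithinAt f f' s t) :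
    HasDerivWithinAt (fun r ↦ (f r).2) f'.2 s t :=
  (hasFDerivAt_snd (𝕜 := ℝ) (p := f t)).comp_hasDerivWithinAt t h

section Velocity

variable {γ : ℝ → M}

theorem hasDerivWithinAt_chart_velocity (hγ : MDifferentiableWithinAt 𝓘(ℝ, ℝ) 𝓘(ℝ, E) γ s t)
    (hq : γ t ∈ (extChartAt 𝓘(ℝ, E) q).source) :
    HasDerivWithinAt (fun r ↦ extChartAt 𝓘(ℝ, E) q (γ r)) (coord q (γ t) (velocity E γ s t)) s t := by
  have h1 := ((contMDiffAt_chart (n := 1) (by simp) hq).mdifferentiableAt one_ne_zero).hasMFDerivAt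
  have h2 := h1.comp_hasMFDerivWithinAt t hγ.hasMFDerivWithinAt
  rw [hasMFDerivWithinAt_iff_hasFDerivWithinAt, ← coord_eq_mfderiv hq] at h2
  have h3 : HasFDerivWithinAt (fun r ↦ extChartAt 𝓘(ℝ, E) q (γ r))
    (((coord q (γ t) : E →L[ℝ] E)).comp (mfderivWithin 𝓘(ℝ, ℝ) 𝓘(ℝ, E) γ s t : ℝ →L[ℝ] E)) s t := h2
  exact h3.hasDerivWithinAt

theorem mdifferentiableWithinAt_of_chart (hγ : ContinuousWithinAt γ s t)
    (hq : γ t ∈ (extChartAt 𝓘(ℝ, E) q).source) {v : E}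
    (h : HasDerivWithinAt (fun r ↦ extChartAt 𝓘(ℝ, E) q (γ r)) v s t) :
    MDifferentiableWithinAt 𝓘(ℝ, ℝ) 𝓘(ℝ, E) γ s t := by
  have h1 : MDifferentiableWithinAt 𝓘(ℝ, ℝ) 𝓘(ℝ, E) (fun r ↦ extChartAt 𝓘(ℝ, E) q (γ r)) s t :=
    mdifferentiableWithinAt_iff_differentiableWithinAt.2 h.differentiableWithinAt
  have h2 : MDifferentiableAt 𝓘(ℝ, E) 𝓘(ℝ, E) ((extChartAt 𝓘(ℝ, E) q).symm : E → M)
      (extChartAt 𝓘(ℝ, E) q (γ t)) :=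
    (contMDiffAt_chart_symm (n := 1) (by simp) ((extChartAt 𝓘(ℝ, E) q).map_source
      hq)).mdifferentiableAt one_ne_zero
  refine (h2.comp_mdifferentiableWithinAt t h1).congr_of_eventuallyEq ?_
    ((extChartAt 𝓘(ℝ, E) q).left_inv hq).symm
  filter_upwards [hγ (source_mem_nhds hq)] with r hr
  exact ((extChartAt 𝓘(ℝ, E) q).left_inv hr).symm

theorem velocity_eq_of_chart (hs : UniqueDiffWithinAt ℝ s t) (hγ : ContinuousWithinAt γ s t)
    (hq : γ t ∈ (extChartAt 𝓘(ℝ, E) q).source) {y : E}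
    (h : HasDerivWithinAt (fun r ↦ extChartAt 𝓘(ℝ, E) q (γ r)) (coord q (γ t) y) s t) :
    velocity E γ s t = y := by
  have h1 := hasDerivWithinAt_chart_velocity (mdifferentiableWithinAt_of_chart hγ hq h) hq
  exact coord_injective hq (hs.eq_deriv s h1 h)

theorem hasCovDerivWithinAt_of_along {V : Π t : ℝ, TangentSpace 𝓘(ℝ, E) (γ t)}
    {W : TangentSpace 𝓘(ℝ, E) (γ t)}
    (hγ : MDifferentiableWithinAt 𝓘(ℝ, ℝ) 𝓘(ℝ, E) γ s t)
    (h : HasCovDerivAlong D γ s V t W) :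
    HasCovDerivWithinAt D (fun r ↦ ((γ r, (V r : E)) : M × E)) (velocity E γ s t) W s t := by
  have hq := mem_source_self (E := E) (γ t)
  obtain ⟨V', hV', hW⟩ := h
  refine HasCovDerivWithinAt.of_chart hγ.continuousWithinAt hq ?_
  have h1 : (fun r ↦ coord (γ t) (γ r) (V r)) =ᶠ[𝓝[s] t]
      (fun r ↦ (trivializationAt E (TangentSpace 𝓘(ℝ, E) : M → Type _) (γ t)
        (⟨γ r, V r⟩ : TangentBundle 𝓘(ℝ, E) M)).2) := by
    filter_upwards [hγ.continuousWithinAt (source_mem_nhds hq)] with r hr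
    exact (coord_apply hr _).symm
  have h2 : HasDerivWithinAt (fun r ↦ coord (γ t) (γ r) (V r)) V' s t :=
    hV'.congr_of_eventuallyEq h1 (coord_apply hq _).symm
  have h3 := (hasDerivWithinAt_chart_velocity hγ hq).prodMk h2
  refine h3.congr_deriv (Prod.ext rfl (Eq.symm ?_))
  have h6 : coord (γ t) (γ t) W = V' + coord (γ t) (γ t) (D (extend E (V t)) (γ t)
      (velocity E γ s t)) := by
    rw [hW, ← ofCoord_apply hq]
    exact (map_add _ _ _).trans (congrArg (· + _) (coord_ofCoord hq V'))
  rw [coord_connection_extend] at h6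
  change coord (γ t) (γ t) W - christoffel D (γ t) (extChartAt 𝓘(ℝ, E) (γ t) (γ t))
    (coord (γ t) (γ t) (velocity E γ s t)) (coord (γ t) (γ t) (V t)) = V'
  rw [h6]
  simp

theorem HasCovDerivWithinAt.velocity_eq (h : HasCovDerivWithinAt D c y w s t)
    (hs : UniqueDiffWithinAt ℝ s t) : velocity E (fun r ↦ (c r).1) s t = y :=
  velocity_eq_of_chart hs h.continuousWithinAt (mem_source_self (c t).1)
    (hasDerivWithinAt_fst (h.hasDerivWithinAt _ (mem_source_self (c t).1)))

theorem HasCovDerivWithinAt.along (h : HasCovDerivWithinAt D c y w s t)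
    (hs : UniqueDiffWithinAt ℝ s t) :
    HasCovDerivAlong D (fun r ↦ (c r).1) s (fun r ↦ (c r).2) t w := by
  have hq := mem_source_self (E := E) (c t).1
  have h1 := hasDerivWithinAt_snd (h.hasDerivWithinAt _ hq)
  refine ⟨_, h1.congr_of_eventuallyEq ?_ (coord_apply hq _), ?_⟩
  · filter_upwards [h.continuousWithinAt (source_mem_nhds hq)] with r hr
    exact coord_apply hr _
  · refine coord_injective hq ?_
    refine Eq.trans ?_ (map_add (coord (c t).1 (c t).1) _ _).symm
    rw [← ofCoord_apply hq, coord_ofCoord hq]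
    have h2 := coord_connection_extend (D := D) (x := (c t).1) (c t).2
      (velocity E (fun r ↦ (c r).1) s t)
    rw [h.velocity_eq hs] at h2 ⊢
    refine (sub_eq_iff_eq_add.1 ?_).trans (congrArg (_ + ·) h2.symm)
    rfl

end Velocity

end Curves

/-! ### Geodesics as integral curves of the spray; their uniqueness. -/

section SprayCurves

set_option synthInstance.maxHeartbeats 400000

variable {E : Type*} [NormedAddCommGroup E] [NormedSpace ℝ E] [FiniteDimensional ℝ E]
  {M : Type*} [TopologicalSpace M] [ChartedSpace E M] [IsManifold 𝓘(ℝ, E) ∞ M]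
  {D : CovariantDerivative 𝓘(ℝ, E) E (TangentSpace 𝓘(ℝ, E) : M → Type _)}
  {q x : M} {c c' : ℝ → M × E} {s s' : Set ℝ} {t : ℝ}

variable (D) in
/-- The curve `c` in the tangent bundle consists of the velocities of a geodesic. -/
def IsSprayCurve (c : ℝ → M × E) (s : Set ℝ) : Prop :=
  ∀ t ∈ s, HasCovDerivWithinAt D c (c t).2 0 s t

namespace IsSprayCurve

theorem mono (h : IsSprayCurve D c s) (hs : s' ⊆ s) : IsSprayCurve D c s' :=
  fun t ht ↦ (h t (hs ht)).mono hs

theorem hasDerivWithinAt_lift (h : IsSprayCurve D c s) (ht : t ∈ s)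
    (hq : (c t).1 ∈ (extChartAt 𝓘(ℝ, E) q).source) :
    HasDerivWithinAt (fun r ↦ lift q (c r)) (localSpray (christoffel D q) (lift q (c t))) s t := by
  have := (h t ht).hasDerivWithinAt q hq
  rwa [liftDeriv_geodesic] at this

theorem of_chart {Z : ℝ → E × E} (hZ : ∀ τ ∈ s, (Z τ).1 ∈ (extChartAt 𝓘(ℝ, E) q).target ∧
    HasDerivWithinAt Z (localSpray (christoffel D q) (Z τ)) s τ) :
    IsSprayCurve D (fun τ ↦ unlift q (Z τ)) s := by
  intro τ hτ
  obtain ⟨h1, h2⟩ := hZ τ hτ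
  refine HasCovDerivWithinAt.of_chart (q := q) ?_ ((extChartAt 𝓘(ℝ, E) q).map_target h1) ?_
  · have h3 : ContinuousAt (extChartAt 𝓘(ℝ, E) q).symm (Z τ).1 :=
      (contMDiffAt_chart_symm (n := 0) (by simp) h1).continuousAt
    exact ContinuousAt.comp_continuousWithinAt (g := (extChartAt 𝓘(ℝ, E) q).symm)
      (f := fun r ↦ (Z r).1) h3 (hasDerivWithinAt_fst h2).continuousWithinAt
  · rw [liftDeriv_geodesic]
    change HasDerivWithinAt _ (localSpray _ (lift q (unlift q (Z τ)))) _ _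
    rw [lift_unlift h1]
    refine h2.congr_of_eventuallyEq ?_ (lift_unlift h1)
    have h4 := (hasDerivWithinAt_fst h2).continuousWithinAt
      ((isOpen_extChartAt_target q).mem_nhds h1)
    filter_upwards [h4] with r hr
    exact lift_unlift hr

theorem glue {a s t : ℝ} (has : a ≤ s) (hst : s ≤ t) (h : IsSprayCurve D c (Icc a s))
    (h' : IsSprayCurve D c' (Icc s t)) (hc : c s = c' s) :
    IsSprayCurve D (fun r ↦ if r ≤ s then c r else c' r) (Icc a t) := by
  intro r hr
  have := HasCovDerivWithinAt.glue has hst h h' hc (congrArg Prod.snd hc) rfl r hr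
  simp only [ite_self] at this
  rwa [← apply_ite Prod.snd] at this

theorem of_isGeodesicOn {γ : ℝ → M} (h : IsGeodesicOn D γ s) :
    IsSprayCurve D (fun r ↦ ((γ r, (velocity E γ s r : E)) : M × E)) s := fun t ht ↦
  hasCovDerivWithinAt_of_along ((h.1 t ht).mdifferentiableWithinAt one_ne_zero) (h.2 t ht)

theorem contMDiffOn (h : IsSprayCurve D c s) :
    ContMDiffOn 𝓘(ℝ, ℝ) 𝓘(ℝ, E) 1 (fun r ↦ (c r).1) s := by
  intro t ht
  set q := (c t).1 with hq
  have hqs : (c t).1 ∈ (extChartAt 𝓘(ℝ, E) q).source := mem_source_self q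
  -- In the chart, the derivative of the position is the fibre coordinate, which is itself
  -- differentiable and hence continuous; so the position is C¹.
  have h1 : ContDiffWithinAt ℝ (0 + 1) (fun r ↦ (lift q (c r)).1) s t := by
    rw [contDiffWithinAt_succ_iff_hasFDerivWithinAt (by simp)]
    refine ⟨s ∩ {r | (c r).1 ∈ (extChartAt 𝓘(ℝ, E) q).source}, ?_, by simp,
      fun r ↦ ContinuousLinearMap.toSpanSingleton ℝ (lift q (c r)).2, ?_, ?_⟩
    · rw [insert_eq_of_mem ht]
      exact inter_mem self_mem_nhdsWithin ((h t ht).continuousWithinAt (source_mem_nhds hqs))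
    · intro r hr
      exact (hasDerivWithinAt_fst ((h.hasDerivWithinAt_lift hr.1 hr.2).mono
        inter_subset_left)).hasFDerivWithinAt
    · refine (contDiffWithinAt_zero (show t ∈ s ∩ {r | (c r).1 ∈
        (extChartAt 𝓘(ℝ, E) q).source} from ⟨ht, hqs⟩)).2 ⟨univ, univ_mem, fun r hr ↦ ?_⟩
      have h2 := ((h r hr.1.1).continuousWithinAt_lift hr.1.2).snd
      exact ((ContinuousLinearMap.toSpanSingletonCLE (𝕜 := ℝ) (E := E)).continuous.continuousAt
        |>.comp_continuousWithinAt h2).mono fun τ hτ ↦ hτ.1.1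
  rw [zero_add] at h1
  have h3 : ContMDiffAt 𝓘(ℝ, E) 𝓘(ℝ, E) 1 ((extChartAt 𝓘(ℝ, E) q).symm : E → M)
      (lift q (c t)).1 :=
    contMDiffAt_chart_symm (by simp) (mem_target_of_lift hqs)
  refine (ContMDiffAt.comp_contMDiffWithinAt t h3
    (contMDiffWithinAt_iff_contDiffWithinAt.2 h1)).congr_of_eventuallyEq ?_
    ((extChartAt 𝓘(ℝ, E) q).left_inv hqs).symm
  filter_upwards [(h t ht).continuousWithinAt (source_mem_nhds hqs)] with r hr
  exact ((extChartAt 𝓘(ℝ, E) q).left_inv hr).symm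

theorem isGeodesicOn (h : IsSprayCurve D c s) (hs : UniqueDiffOn ℝ s) :
    IsGeodesicOn D (fun r ↦ (c r).1) s ∧
      ∀ t ∈ s, velocity E (fun r ↦ (c r).1) s t = (c t).2 := by
  have h1 : ∀ t ∈ s, velocity E (fun r ↦ (c r).1) s t = (c t).2 :=
    fun t ht ↦ (h t ht).velocity_eq (hs t ht)
  refine ⟨⟨h.contMDiffOn, fun t ht ↦ ?_⟩, h1⟩
  have h2 : HasCovDerivWithinAt D (fun r ↦ (((c r).1, (velocity E (fun r ↦ (c r).1) s r : E)) :
      M × E)) (c t).2 0 s t :=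
    (h t ht).congr (fun r hr ↦ Prod.ext rfl (h1 r hr)) (Prod.ext rfl (h1 t ht))
  exact h2.along (hs t ht)

/-- Affine reparametrisation to the unit interval, the form in which the exponential map is defined.
-/
theorem rescale {a L : ℝ} (h : IsSprayCurve D c (Icc a (a + L))) (hL : 0 ≤ L) :
    IsSprayCurve D (fun τ ↦ ((c (a + τ * L)).1, L • (c (a + τ * L)).2)) (Icc 0 1) := by
  intro τ hτ
  have hmem : MapsTo (fun τ : ℝ ↦ a + τ * L) (Icc 0 1) (Icc a (a + L)) := fun r hr ↦
    ⟨by nlinarith [hr.1], by nlinarith [hr.2]⟩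
  have hd : HasDerivWithinAt (fun τ : ℝ ↦ a + τ * L) L (Icc 0 1) τ := by
    simpa using (((hasDerivAt_id τ).mul_const L).const_add a).hasDerivWithinAt
  set q := (c (a + τ * L)).1 with hq
  have hqs : (c (a + τ * L)).1 ∈ (extChartAt 𝓘(ℝ, E) q).source := mem_source_self q
  refine HasCovDerivWithinAt.of_chart (q := q)
    (ContinuousWithinAt.comp (g := fun r ↦ (c r).1) (f := fun τ : ℝ ↦ a + τ * L)
      (h _ (hmem hτ)).continuousWithinAt hd.continuousWithinAt hmem) hqs ?_
  have h1 := (h.hasDerivWithinAt_lift (hmem hτ) hqs).scomp τ hd hmem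
  have h2 := (hasDerivWithinAt_fst h1).prodMk ((hasDerivWithinAt_snd h1).const_smul L)
  have h3 : ∀ r, lift q ((c (a + r * L)).1, L • (c (a + r * L)).2) =
      ((lift q (c (a + r * L))).1, L • (lift q (c (a + r * L))).2) := fun r ↦
    Prod.ext rfl (map_smul (coord q (c (a + r * L)).1) L _)
  rw [liftDeriv_geodesic]
  change HasDerivWithinAt _ (localSpray _ (lift q ((c (a + τ * L)).1, L • (c (a + τ * L)).2))) _ _
  simp only [h3]
  convert! h2 using 1
  refine Prod.ext rfl ?_
  simp [localSpray]

end IsSprayCurve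

theorem contDiffOn_localSpray {Γ : E → E →L[ℝ] E →L[ℝ] E} {Ω : Set E} (hΓ : ContDiffOn ℝ 1 Γ Ω) :
    ContDiffOn ℝ 1 (localSpray Γ) (Ω ×ˢ univ) := by
  have h1 : ContDiffOn ℝ 1 (fun p : E × E ↦ Γ p.1) (Ω ×ˢ univ) :=
    ContDiffOn.comp (g := Γ) hΓ contDiffOn_fst fun p hp ↦ hp.1
  exact contDiffOn_snd.prodMk ((h1.clm_apply contDiffOn_snd).clm_apply contDiffOn_snd).neg

variable [T2Space M]

/-- Near each t₀ there are two cases. If the curves differ at t₀ they differ nearby (for the base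
points this uses that M is Hausdorff), and there is no equality to propagate. If they agree at t₀,
both follow the same local flow in one chart. -/
theorem IsSprayCurve.eqOn (hD : CovariantDerivative.ContMDiffCovariantDerivative D ∞) {a b : ℝ}
    (h : IsSprayCurve D c (Icc a b)) (h' : IsSprayCurve D c' (Icc a b)) (ha : c a = c' a) :
    ∀ t ∈ Icc a b, c t = c' t := by
  refine Icc_step_induction (fun t ↦ c t = c' t) ha fun t₀ ht₀ ↦ ?_
  have hcont := (h t₀ ht₀).continuousWithinAt
  have hcont' := (h' t₀ ht₀).continuousWithinAt
  by_cases hne : (c t₀).1 = (c' t₀).1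
  swap
  · have h1 : ∀ᶠ τ in 𝓝[Icc a b] t₀, (c τ).1 ≠ (c' τ).1 :=
      (hcont.prodMk hcont').eventually (isClosed_diagonal.isOpen_compl.mem_nhds hne)
    obtain ⟨ε, hε, h2⟩ := Metric.mem_nhdsWithin_iff.1 h1
    refine ⟨ε, hε, fun s hs t ht hs' ht' hst heq ↦ ?_⟩
    exact absurd (congrArg Prod.fst heq) (h2 ⟨by simpa [Real.dist_eq] using hs', hs⟩)
  set q := (c t₀).1 with hq
  have hqs : (c t₀).1 ∈ (extChartAt 𝓘(ℝ, E) q).source := mem_source_self q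
  have hqs' : (c' t₀).1 ∈ (extChartAt 𝓘(ℝ, E) q).source := hne ▸ hqs
  have hlift := (h t₀ ht₀).continuousWithinAt_lift hqs
  have hlift' := (h' t₀ ht₀).continuousWithinAt_lift hqs'
  by_cases hne2 : lift q (c t₀) = lift q (c' t₀)
  swap
  · have h1 : ∀ᶠ τ in 𝓝[Icc a b] t₀, lift q (c τ) ≠ lift q (c' τ) :=
      (hlift.prodMk hlift').eventually (isClosed_diagonal.isOpen_compl.mem_nhds hne2)
    obtain ⟨ε, hε, h2⟩ := Metric.mem_nhdsWithin_iff.1 h1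
    refine ⟨ε, hε, fun s hs t ht hs' ht' hst heq ↦ ?_⟩
    exact absurd (congrArg (lift q) heq) (h2 ⟨by simpa [Real.dist_eq] using hs', hs⟩)
  have hΓ := (contDiffOn_christoffel hD q).of_le (by simp : (1 : ℕ∞ω) ≤ ∞)
  obtain ⟨ε, hε, r, hr, α, hα, Φ, -, -, hΦ, -⟩ := exists_flow_hasFDerivAt
    ((isOpen_extChartAt_target (I := 𝓘(ℝ, E)) q).prod isOpen_univ) (contDiffOn_localSpray hΓ)
    (x₀ := lift q (c t₀)) ⟨mem_target_of_lift hqs, mem_univ _⟩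
  have hnear : ∀ᶠ τ in 𝓝[Icc a b] t₀, ((c τ).1 ∈ (extChartAt 𝓘(ℝ, E) q).source ∧
      lift q (c τ) ∈ Metric.ball (lift q (c t₀)) (min r α)) ∧
      ((c' τ).1 ∈ (extChartAt 𝓘(ℝ, E) q).source ∧
      lift q (c' τ) ∈ Metric.ball (lift q (c t₀)) (min r α)) := by
    have hb := Metric.ball_mem_nhds (lift q (c t₀)) (lt_min hr hα)
    have hb' := hb
    rw [hne2] at hb'
    exact ((hcont.eventually_mem (source_mem_nhds hqs)).and (hlift.eventually_mem hb)).and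
      ((hcont'.eventually_mem (source_mem_nhds hqs')).and (hlift'.eventually_mem (hne2 ▸ hb')))
  obtain ⟨δ, hδ, h2⟩ := Metric.mem_nhdsWithin_iff.1 hnear
  -- Within δ of t₀ both curves stay in the chart and in the ball of the local flow; within ε/2 on
  -- either side, the elapsed time is at most the lifetime ε of that flow.
  refine ⟨min δ (ε / 2), by positivity, fun s hs t ht hs' ht' hst heq ↦ ?_⟩
  have habs := abs_lt.1 hs'
  have habt := abs_lt.1 ht'
  have hm1 := min_le_left δ (ε / 2)
  have hm2 := min_le_right δ (ε / 2)
  have hmem : ∀ τ ∈ Icc s t, τ ∈ Icc a b ∧ τ ∈ Metric.ball t₀ δ := by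
    intro τ hτ
    refine ⟨⟨hs.1.trans hτ.1, hτ.2.trans ht.2⟩, ?_⟩
    rw [Metric.mem_ball, Real.dist_eq, abs_lt]
    constructor <;> linarith [hτ.1, hτ.2]
  have hsub : Icc s t ⊆ Icc a b := fun τ hτ ↦ (hmem τ hτ).1
  have e1 := hΦ s t (fun τ ↦ lift q (c τ)) (by linarith)
    (Metric.ball_subset_ball (min_le_left _ _) (h2 (hmem s ⟨le_rfl, hst⟩).symm).1.2)
    (fun τ hτ ↦ ⟨Metric.ball_subset_closedBall (Metric.ball_subset_ball (min_le_right _ _)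
      (h2 (hmem τ hτ).symm).1.2), (h.mono hsub).hasDerivWithinAt_lift hτ
      (h2 (hmem τ hτ).symm).1.1⟩) t ⟨hst, le_rfl⟩
  have e2 := hΦ s t (fun τ ↦ lift q (c' τ)) (by linarith)
    (Metric.ball_subset_ball (min_le_left _ _) (h2 (hmem s ⟨le_rfl, hst⟩).symm).2.2)
    (fun τ hτ ↦ ⟨Metric.ball_subset_closedBall (Metric.ball_subset_ball (min_le_right _ _)
      (h2 (hmem τ hτ).symm).2.2), (h'.mono hsub).hasDerivWithinAt_lift hτ
      (h2 (hmem τ hτ).symm).2.1⟩) t ⟨hst, le_rfl⟩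
  rw [heq] at e1
  have e3 := e1.trans e2.symm
  rw [← unlift_lift (h2 (hmem t ⟨hst, le_rfl⟩).symm).1.1,
    ← unlift_lift (h2 (hmem t ⟨hst, le_rfl⟩).symm).2.1]
  exact congrArg (unlift q) e3

end SprayCurves

/-! ### Jacobi fields and the differentiable dependence of geodesics on the initial velocity. -/

section Jacobi

set_option synthInstance.maxHeartbeats 400000

variable {E : Type*} [NormedAddCommGroup E] [NormedSpace ℝ E] [FiniteDimensional ℝ E]
  {M : Type*} [TopologicalSpace M] [ChartedSpace E M] [IsManifold 𝓘(ℝ, E) ∞ M]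
  {D : CovariantDerivative 𝓘(ℝ, E) E (TangentSpace 𝓘(ℝ, E) : M → Type _)}
  {q x : M} {c : ℝ → M × E} {V W : ℝ → E} {s s' : Set ℝ} {t : ℝ}

variable (D) in
/-- The torsion of `D` is parallel; expressed in coordinates. -/
def HasParallelTorsion : Prop :=
  ∀ (q : M), ∀ z ∈ (extChartAt 𝓘(ℝ, E) q).target, ∀ a u v : E,
    fderiv ℝ (christoffel D q) z a u v - fderiv ℝ (christoffel D q) z a v u
      + christoffel D q z a (localTorsion (christoffel D q) z u v)
      - localTorsion (christoffel D q) z (christoffel D q z a u) v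
      - localTorsion (christoffel D q) z u (christoffel D q z a v) = 0

variable (D) in
/-- `V` is a Jacobi field with covariant derivative `W` along the geodesic with velocity curve
`c`. -/
structure IsJacobiField (c : ℝ → M × E) (V W : ℝ → E) (s : Set ℝ) : Prop where
  hasCovDeriv : ∀ t ∈ s, HasCovDerivWithinAt D (fun r ↦ ((c r).1, V r)) (c t).2 (W t) s t
  hasCovDeriv_snd : ∀ t ∈ s, HasCovDerivWithinAt D (fun r ↦ ((c r).1, W r)) (c t).2
    (-(curvature D (c t).1 (V t) (c t).2 (c t).2 : E) + D.torsion (c t).1 (c t).2 (W t)) s t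

theorem coord_jacobi_operator (hx : x ∈ (extChartAt 𝓘(ℝ, E) q).source)
    (hΓ : DifferentiableAt ℝ (christoffel D q) (extChartAt 𝓘(ℝ, E) q x))
    (v u w : TangentSpace 𝓘(ℝ, E) x) :
    coord q x (-(curvature D x v u u) + D.torsion x u w) =
      -localCurvature (christoffel D q) (extChartAt 𝓘(ℝ, E) q x) (coord q x v) (coord q x u)
        (coord q x u) +
      localTorsion (christoffel D q) (extChartAt 𝓘(ℝ, E) q x) (coord q x u) (coord q x w) := by
  rw [← coord_torsion hx, ← coord_curvature hx hΓ]
  exact (map_add _ _ _).trans (congrArg (· + _) (map_neg _ _))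

theorem differentiableAt_christoffel [T2Space M]
    (hD : CovariantDerivative.ContMDiffCovariantDerivative D ∞) {z : E}
    (hz : z ∈ (extChartAt 𝓘(ℝ, E) q).target) : DifferentiableAt ℝ (christoffel D q) z :=
  ((contDiffOn_christoffel hD q).contDiffAt
    ((isOpen_extChartAt_target (I := 𝓘(ℝ, E)) q).mem_nhds hz)).differentiableAt (by simp)

variable (D) in
/-- The derivative of the coordinates of the velocity `u` of a geodesic at `x` when the geodesic
varies in the direction of a Jacobi field with value `v` and covariant derivative `w`. -/
def jacobiDeriv (q x : M) (u v : E) (w : TangentSpace 𝓘(ℝ, E) x) : E × E :=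
  liftDeriv D q x u v (w - D.torsion x u v : TangentSpace 𝓘(ℝ, E) x)

/-- The torsion term swaps the arguments of Γ. The second component thus becomes the ordinary
derivative along the geodesic of the coordinates of the Jacobi field, as commuting mixed partial
derivatives require. -/
theorem jacobiDeriv_eq (hx : x ∈ (extChartAt 𝓘(ℝ, E) q).source) (u v w : E) :
    jacobiDeriv D q x u v w = (coord q x v, coord q x w -
      christoffel D q (extChartAt 𝓘(ℝ, E) q x) (coord q x u) (coord q x v)) := by
  have h1 : ∀ u v w : TangentSpace 𝓘(ℝ, E) x, coord q x (w - D.torsion x u v) = coord q x w -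
      localTorsion (christoffel D q) (extChartAt 𝓘(ℝ, E) q x) (coord q x u) (coord q x v) := fun u v w ↦
    (map_sub _ _ _).trans (congrArg (coord q x w - ·) (coord_torsion hx u v))
  refine Prod.ext rfl ?_
  refine (congrArg (· - christoffel D q (extChartAt 𝓘(ℝ, E) q x) (coord q x v) (coord q x u))
    (h1 u v w)).trans ?_
  simp only [localTorsion]
  abel

variable [T2Space M]

/-- A Jacobi field solves the linearised geodesic equation in coordinates. -/
theorem IsJacobiField.hasDerivWithinAt_jacobiDeriv
    (hD : CovariantDerivative.ContMDiffCovariantDerivative D ∞) (hT : HasParallelTorsion D)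
    (hJ : IsJacobiField D c V W s) (h : IsSprayCurve D c s) (ht : t ∈ s)
    (hq : (c t).1 ∈ (extChartAt 𝓘(ℝ, E) q).source) :
    HasDerivWithinAt (fun r ↦ jacobiDeriv D q (c r).1 (c r).2 (V r) (W r))
      (fderiv ℝ (localSpray (christoffel D q)) (lift q (c t))
        (jacobiDeriv D q (c t).1 (c t).2 (V t) (W t))) s t := by
  have hz := mem_target_of_lift hq
  have h1 := h.hasDerivWithinAt_lift ht hq
  have h2 := hasDerivWithinAt_snd ((hJ.hasCovDeriv t ht).hasDerivWithinAt q hq)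
  have h3 := hasDerivWithinAt_snd ((hJ.hasCovDeriv_snd t ht).hasDerivWithinAt q hq)
  have h4 := coord_jacobi_operator hq (differentiableAt_christoffel hD hz) (V t) (c t).2 (W t)
  have h5 := hasDerivWithinAt_linearised_spray (Γ := christoffel D q) (x := fun r ↦ (lift q (c r)).1)
    (c := fun r ↦ (lift q (c r)).2) (y := fun r ↦ coord q (c r).1 (V r))
    (w := fun r ↦ coord q (c r).1 (W r)) (differentiableAt_christoffel hD hz)
    (hT q _ hz) (hasDerivWithinAt_fst h1) (hasDerivWithinAt_snd h1) h2
    (h3.congr_deriv (congrArg (· - _) h4))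
  rw [jacobiDeriv_eq hq]
  refine h5.congr_of_eventuallyEq ?_ (jacobiDeriv_eq hq _ _ _)
  filter_upwards [(h t ht).continuousWithinAt.eventually_mem (source_mem_nhds hq)] with r hr
  exact jacobiDeriv_eq hr _ _ _

/-- The geodesics with initial point `c a` depend differentiably on the initial velocity, and the
derivative is given by Jacobi fields. -/
theorem IsSprayCurve.exists_family
    (hD : CovariantDerivative.ContMDiffCovariantDerivative D ∞) (hT : HasParallelTorsion D)
    {a b : ℝ} (h : IsSprayCurve D c (Icc a b)) (hJ : IsJacobiField D c V W (Icc a b))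
    (hV : V a = 0) : ∀ t ∈ Icc a b, ∃ ε > 0, ∃ C : E → ℝ → M × E,
      (∀ v ∈ Metric.ball (c a).2 ε, C v a = ((c a).1, v) ∧ IsSprayCurve D (C v) (Icc a t)) ∧
      ContinuousAt (fun v ↦ (C v t).1) (c a).2 ∧
      ∃ q : M, (c t).1 ∈ (extChartAt 𝓘(ℝ, E) q).source ∧ ∃ A : E →L[ℝ] E × E,
        HasFDerivAt (fun v ↦ lift q (C v t)) A (c a).2 ∧
        A (W a) = jacobiDeriv D q (c t).1 (c t).2 (V t) (W t) := by
  -- Only what is needed at the end point t is carried along: one chart around it, the derivative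
  -- there at the given initial velocity, and its value on the single vector W a. The ball of
  -- admissible velocities may shrink at each step. At t = a the family is v ↦ (c a, v).
  refine Icc_step_induction _ ?_ fun t₀ ht₀ ↦ ?_
  · refine ⟨1, one_pos, fun v _ ↦ ((c a).1, v), fun v _ ↦ ⟨rfl, ?_⟩, continuousAt_const,
      (c a).1, mem_source_self _,
      (ContinuousLinearMap.inr ℝ E E).comp (coord (c a).1 (c a).1 : E →L[ℝ] E), ?_, ?_⟩
    · rw [Icc_self]
      rintro t rfl
      exact HasCovDerivWithinAt.singleton _ _ _ _
    · have h1 := (hasFDerivAt_const (𝕜 := ℝ) (extChartAt 𝓘(ℝ, E) (c a).1 (c a).1) (c a).2).prodMk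
        (ContinuousLinearMap.hasFDerivAt (𝕜 := ℝ) (E := E) (F := E) (coord (c a).1 (c a).1)
          (x := (c a).2))
      exact h1
    · refine Eq.trans ?_ (jacobiDeriv_eq (mem_source_self _) _ _ _).symm
      rw [hV]
      have h0 : (coord (c a).1 (c a).1 (0 : TangentSpace 𝓘(ℝ, E) (c a).1)) = (0 : E) := map_zero _
      refine Prod.ext h0.symm ?_
      change coord (c a).1 (c a).1 (W a) = coord (c a).1 (c a).1 (W a) -
        christoffel D (c a).1 _ _ (coord (c a).1 (c a).1 (0 : TangentSpace 𝓘(ℝ, E) (c a).1))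
      rw [h0]
      simp
  set q := (c t₀).1 with hq
  have hqs : (c t₀).1 ∈ (extChartAt 𝓘(ℝ, E) q).source := mem_source_self q
  have hcont := (h t₀ ht₀).continuousWithinAt
  have hlift := (h t₀ ht₀).continuousWithinAt_lift hqs
  have hΓ := (contDiffOn_christoffel hD q).of_le (by simp : (1 : ℕ∞ω) ≤ ∞)
  obtain ⟨ε, hε, r, hr, α, hα, Φ, hΩ, hΦ0, hΦ, hΦd⟩ := exists_flow_hasFDerivAt
    ((isOpen_extChartAt_target (I := 𝓘(ℝ, E)) q).prod isOpen_univ) (contDiffOn_localSpray hΓ)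
    (x₀ := lift q (c t₀)) ⟨mem_target_of_lift hqs, mem_univ _⟩
  have hnear : ∀ᶠ τ in 𝓝[Icc a b] t₀, (c τ).1 ∈ (extChartAt 𝓘(ℝ, E) q).source ∧
      lift q (c τ) ∈ Metric.ball (lift q (c t₀)) (min r α) :=
    (hcont.eventually_mem (source_mem_nhds hqs)).and
      (hlift.eventually_mem (Metric.ball_mem_nhds _ (lt_min hr hα)))
  obtain ⟨δ, hδ, h2⟩ := Metric.mem_nhdsWithin_iff.1 hnear
  refine ⟨min δ (ε / 2), by positivity, ?_⟩
  rintro s hs t ht hs' ht' hst ⟨ε₁, hε₁, C, hC, hCc, q₁, hq₁, A₁, hA₁, hA₁W⟩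
  have habs := abs_lt.1 hs'
  have habt := abs_lt.1 ht'
  have hm1 := min_le_left δ (ε / 2)
  have hm2 := min_le_right δ (ε / 2)
  have hmem : ∀ τ ∈ Icc s t, τ ∈ Metric.ball t₀ δ ∧ τ ∈ Icc a b := by
    intro τ hτ
    refine ⟨?_, hs.1.trans hτ.1, hτ.2.trans ht.2⟩
    rw [Metric.mem_ball, Real.dist_eq, abs_lt]
    constructor <;> linarith [hτ.1, hτ.2]
  have hsub : Icc s t ⊆ Icc a b := fun τ hτ ↦ (hmem τ hτ).2
  have hss : s ∈ Icc s t := ⟨le_rfl, hst⟩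
  have hcs := h2 (hmem s hss)
  set v₀ := (c a).2 with hv₀
  have hCs : C v₀ s = c s := by
    have h3 := hC v₀ (Metric.mem_ball_self hε₁)
    exact h3.2.eqOn hD (h.mono (Icc_subset_Icc_right hs.2)) h3.1 s ⟨hs.1, le_rfl⟩
  obtain ⟨A, hA, hAW⟩ := hasFDerivAt_lift_change (D := D) (q := q₁) (q' := q) (f := fun v ↦ C v s)
    hCc (by rwa [hCs]) (by rw [hCs]; exact hcs.1) hA₁
  have hAW' : A (W a) = jacobiDeriv D q (c s).1 (c s).2 (V s) (W s) := by
    have h3 := hAW (W a) (V s) _ (by rw [hCs]; exact hA₁W)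
    rwa [hCs] at h3
  set f : E → E × E := fun v ↦ lift q (C v s) with hf
  have hfv : f v₀ = lift q (c s) := congrArg (lift q) hCs
  have hev : ∀ᶠ v in 𝓝 v₀, v ∈ Metric.ball v₀ ε₁ ∧ (C v s).1 ∈ (extChartAt 𝓘(ℝ, E) q).source ∧
      f v ∈ Metric.ball (lift q (c t₀)) r := by
    refine (show ∀ᶠ v in 𝓝 v₀, v ∈ Metric.ball v₀ ε₁ from Metric.ball_mem_nhds v₀ hε₁).and
      ((hCc.eventually_mem (source_mem_nhds (by rw [hCs]; exact hcs.1))).and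
      (hA.continuousAt.eventually_mem (Metric.isOpen_ball.mem_nhds ?_)))
    rw [hfv]
    exact Metric.ball_subset_ball (min_le_left _ _) hcs.2
  obtain ⟨ε₂, hε₂, hε₂'⟩ := Metric.eventually_nhds_iff_ball.1 hev
  have hts : t - s ∈ Icc 0 ε := ⟨by linarith, by linarith⟩
  have hflow : ∀ τ ∈ Icc s t, lift q (c τ) = Φ (f v₀) (τ - s) := by
    rw [hfv]
    exact hΦ s t (fun τ ↦ lift q (c τ)) hts.2
      (Metric.ball_subset_ball (min_le_left _ _) hcs.2)
      (fun τ hτ ↦ ⟨Metric.ball_subset_closedBall (Metric.ball_subset_ball (min_le_right _ _)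
        (h2 (hmem τ hτ)).2), (h.mono hsub).hasDerivWithinAt_lift hτ (h2 (hmem τ hτ)).1⟩)
  -- If t = s the glued curve still takes the old branch at t, which agrees with the flow at time 0.
  have hend : ∀ v ∈ Metric.ball v₀ ε₂,
      (if t ≤ s then C v t else unlift q (Φ (f v) (t - s))) = unlift q (Φ (f v) (t - s)) := by
    intro v hv
    obtain ⟨-, h5, h6⟩ := hε₂' v hv
    split_ifs with hts'
    · obtain rfl : t = s := le_antisymm hts' hst
      rw [sub_self, (hΦ0 _ h6).1, unlift_lift h5]
    · rfl
  have htar : ∀ v ∈ Metric.ball v₀ ε₂, (Φ (f v) (t - s)).1 ∈ (extChartAt 𝓘(ℝ, E) q).target :=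
    fun v hv ↦ (hΩ ((hΦ0 _ (hε₂' v hv).2.2).2 _ hts).1).1
  obtain ⟨B, hB, hBη⟩ := hΦd (f v₀) (hε₂' v₀ (Metric.mem_ball_self hε₂)).2.2 (t - s) hts
  have hBA : HasFDerivAt (fun v ↦ Φ (f v) (t - s)) (B.comp A) v₀ :=
    HasFDerivAt.comp (𝕜 := ℝ) (g := fun z ↦ Φ z (t - s)) (f := f) v₀ hB hA
  refine ⟨ε₂, hε₂, fun v τ ↦ if τ ≤ s then C v τ else unlift q (Φ (f v) (τ - s)),
    fun v hv ↦ ⟨?_, ?_⟩, ?_, q, (h2 (hmem t ⟨hst, le_rfl⟩)).1, B.comp A, ?_, ?_⟩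
  · simp only [hs.1, if_true]
    exact (hC v (hε₂' v hv).1).1
  · obtain ⟨h4, h5, h6⟩ := hε₂' v hv
    obtain ⟨h7, h8⟩ := hΦ0 _ h6
    refine IsSprayCurve.glue hs.1 hst (hC v h4).2
      (IsSprayCurve.of_chart (Z := fun τ ↦ Φ (f v) (τ - s)) fun τ hτ ↦ ?_) ?_
    · have hτ' : τ - s ∈ Icc 0 ε := ⟨by linarith [hτ.1], by linarith [hτ.2, hts.2]⟩
      refine ⟨(hΩ (h8 _ hτ').1).1, ?_⟩
      have h9 := (h8 _ hτ').2.scomp τ (h := fun τ : ℝ ↦ τ - s) (s := Icc s t) (h' := 1)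
        ((hasDerivAt_id τ).sub_const s).hasDerivWithinAt
        fun r hr ↦ ⟨by linarith [hr.1], by linarith [hr.2, hts.2]⟩
      rwa [one_smul] at h9
    · rw [sub_self, h7, unlift_lift h5]
  · have h3 : ContinuousAt (fun v ↦ ((extChartAt 𝓘(ℝ, E) q).symm (Φ (f v) (t - s)).1)) v₀ :=
      ContinuousAt.comp (g := (extChartAt 𝓘(ℝ, E) q).symm) (f := fun v ↦ (Φ (f v) (t - s)).1)
        (contMDiffAt_chart_symm (n := 0) (by simp) (htar v₀ (Metric.mem_ball_self hε₂))).continuousAt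
        hBA.continuousAt.fst
    refine h3.congr ?_
    filter_upwards [Metric.ball_mem_nhds v₀ hε₂] with v hv
    exact (congrArg Prod.fst (hend v hv)).symm
  · refine hBA.congr_of_eventuallyEq ?_
    filter_upwards [Metric.ball_mem_nhds v₀ hε₂] with v hv
    change lift q (if t ≤ s then C v t else unlift q (Φ (f v) (t - s))) = _
    rw [hend v hv, lift_unlift (htar v hv)]
  -- The coordinates of the Jacobi field solve the linearised spray equation, so the derivative B of
  -- the local flow carries their value at s to their value at t; the chain rule composes B with A.
  · have h3 := hBη (fun τ ↦ jacobiDeriv D q (c (s + τ)).1 (c (s + τ)).2 (V (s + τ)) (W (s + τ)))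
      fun τ hτ ↦ ?_
    · rw [add_zero, add_sub_cancel] at h3
      rw [ContinuousLinearMap.comp_apply, hAW', h3]
    · have hτ' : s + τ ∈ Icc s t := ⟨by linarith [hτ.1], by linarith [hτ.2]⟩
      have h4 := hJ.hasDerivWithinAt_jacobiDeriv hD hT h (hsub hτ') (h2 (hmem _ hτ')).1
      have h5 := h4.scomp τ (h := fun τ : ℝ ↦ s + τ) (s := Icc 0 (t - s)) (h' := 1)
        ((hasDerivAt_id τ).const_add s).hasDerivWithinAt
        fun r hr ↦ hsub ⟨by linarith [hr.1], by linarith [hr.2]⟩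
      rw [one_smul, hflow _ hτ', add_sub_cancel_left] at h5
      exact h5

end Jacobi

/-! ### From Jacobi fields to singular points of the exponential map. -/

section Conjugate

set_option synthInstance.maxHeartbeats 400000

variable {E : Type*} [NormedAddCommGroup E] [NormedSpace ℝ E] [FiniteDimensional ℝ E]
  {M : Type*} [TopologicalSpace M] [ChartedSpace E M] [IsManifold 𝓘(ℝ, E) ∞ M] [T2Space M]
  {D : CovariantDerivative 𝓘(ℝ, E) E (TangentSpace 𝓘(ℝ, E) : M → Type _)}

/-- The exponential map is defined by an arbitrary choice of geodesic; uniqueness identifies the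
chosen one with c. -/
theorem expMap_eq_of_geodesic (hD : CovariantDerivative.ContMDiffCovariantDerivative D ∞)
    {c : ℝ → M × E} (h : IsSprayCurve D c (Icc 0 1)) : expMap D (c 0).1 (c 0).2 = (c 1).1 := by
  have huniq : UniqueDiffOn ℝ (Icc (0 : ℝ) 1) := uniqueDiffOn_Icc one_pos
  obtain ⟨h1, h2⟩ := h.isGeodesicOn huniq
  have hex : ∃ c' : ℝ → M, IsGeodesicOn D c' (Icc 0 1) ∧
      (⟨c' 0, velocity E c' (Icc 0 1) 0⟩ : TangentBundle 𝓘(ℝ, E) M) = ⟨(c 0).1, (c 0).2⟩ :=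
    ⟨fun r ↦ (c r).1, h1, congrArg (fun v : TangentSpace 𝓘(ℝ, E) (c 0).1 ↦
      (⟨(c 0).1, v⟩ : TangentBundle 𝓘(ℝ, E) M)) (h2 0 ⟨le_rfl, zero_le_one⟩)⟩
  rw [expMap, dif_pos hex]
  have h3 := congrArg (fun p : TangentBundle 𝓘(ℝ, E) M ↦ ((p.proj, (p.2 : E)) : M × E))
    hex.choose_spec.2
  exact congrArg Prod.fst ((IsSprayCurve.of_isGeodesicOn hex.choose_spec.1).eqOn hD h h3 1
    ⟨zero_le_one, le_rfl⟩)

theorem expMap_smul_eq (hD : CovariantDerivative.ContMDiffCovariantDerivative D ∞)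
    {c : ℝ → M × E} {a t : ℝ} (hat : a ≤ t) (h : IsSprayCurve D c (Icc a t)) :
    expMap D (c a).1 ((t - a) • (c a).2) = (c t).1 := by
  have h1 := IsSprayCurve.rescale (L := t - a) (by rwa [add_sub_cancel]) (sub_nonneg.2 hat)
  have h2 := expMap_eq_of_geodesic hD h1
  simpa using h2

/-- A Jacobi field which vanishes at two points gives rise to a conjugate point. -/
theorem isConjugateAlong_of_jacobi (hD : CovariantDerivative.ContMDiffCovariantDerivative D ∞)
    (hT : HasParallelTorsion D) {γ : ℝ → M} {a b t : ℝ} (hγ : IsGeodesicOn D γ (Icc a b))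
    {V W : ℝ → E} (hJ : IsJacobiField D (fun r ↦ (γ r, (velocity E γ (Icc a b) r : E))) V W (Icc a b))
    (ht : t ∈ Ioc a b) (hVa : V a = 0) (hVt : V t = 0) (hWa : W a ≠ 0) :
    IsConjugateAlong D γ a b t := by
  have hc := IsSprayCurve.of_isGeodesicOn hγ
  obtain ⟨ε, hε, C, hC, hCc, q, hq, A, hA, hAW⟩ :=
    hc.exists_family hD hT hJ hVa t ⟨ht.1.le, ht.2⟩
  set v₀ : E := velocity E γ (Icc a b) a with hv₀
  set L := t - a with hL
  have hL0 : 0 < L := sub_pos.2 ht.1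
  have hCt : C v₀ t = (γ t, (velocity E γ (Icc a b) t : E)) := by
    have h3 := hC v₀ (Metric.mem_ball_self hε)
    exact h3.2.eqOn hD (hc.mono (Icc_subset_Icc_right ht.2)) h3.1 t ⟨ht.1.le, le_rfl⟩
  set u₀ : E := L • v₀ with hu₀
  have hu : L⁻¹ • u₀ = v₀ := inv_smul_smul₀ hL0.ne' v₀
  have hσ : HasFDerivAt (fun u : E ↦ L⁻¹ • u) (L⁻¹ • ContinuousLinearMap.id ℝ E) u₀ :=
    (hasFDerivAt_id u₀).const_smul L⁻¹
  -- By homogeneity of geodesics, exp u near u₀ is the position at time t of the geodesic with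
  -- initial velocity u/(t - a). This is that map in a chart; its differential sends (t - a)W(a) to
  -- the coordinates of V t = 0.
  have hG : HasFDerivAt (fun u : E ↦ (lift q (C (L⁻¹ • u) t)).1)
      ((ContinuousLinearMap.fst ℝ E E).comp (A.comp (L⁻¹ • ContinuousLinearMap.id ℝ E))) u₀ := by
    have h1 : HasFDerivAt (fun u : E ↦ lift q (C (L⁻¹ • u) t))
        (A.comp (L⁻¹ • ContinuousLinearMap.id ℝ E)) u₀ :=
      HasFDerivAt.comp (𝕜 := ℝ) (g := fun v ↦ lift q (C v t)) (f := fun u : E ↦ L⁻¹ • u) u₀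
        (by rw [hu]; exact hA) hσ
    exact HasFDerivAt.comp (𝕜 := ℝ) (g := Prod.fst) u₀ hasFDerivAt_fst h1
  set G' := (ContinuousLinearMap.fst ℝ E E).comp (A.comp (L⁻¹ • ContinuousLinearMap.id ℝ E))
  have hG'0 : G' (L • W a) = 0 := by
    change (A (L⁻¹ • (L • W a))).1 = 0
    rw [inv_smul_smul₀ hL0.ne', hAW]
    change coord q (γ t) (V t) = 0
    rw [hVt]
    exact map_zero (coord q (γ t))
  have hsymm : MDifferentiableAt 𝓘(ℝ, E) 𝓘(ℝ, E) ((extChartAt 𝓘(ℝ, E) q).symm : E → M)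
      (lift q (C (L⁻¹ • u₀) t)).1 :=
    (contMDiffAt_chart_symm (n := 1) (by simp) (mem_target_of_lift (by rw [hu, hCt]; exact hq))
      ).mdifferentiableAt one_ne_zero
  have h2 := HasMFDerivAt.comp (f := fun u : E ↦ (lift q (C (L⁻¹ • u) t)).1) u₀
    hsymm.hasMFDerivAt hG.hasMFDerivAt
  have hev : expMap D (γ a) =ᶠ[𝓝 u₀]
      (extChartAt 𝓘(ℝ, E) q).symm ∘ fun u : E ↦ (lift q (C (L⁻¹ • u) t)).1 := by
    have h3 : Tendsto (fun u : E ↦ L⁻¹ • u) (𝓝 u₀) (𝓝 v₀) := by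
      have := hσ.continuousAt.tendsto
      rwa [hu] at this
    filter_upwards [h3 (Metric.ball_mem_nhds v₀ hε),
      h3 (hCc.eventually_mem (source_mem_nhds (q := q) (by rw [hCt]; exact hq)))] with u hu1 hu2
    obtain ⟨h4, h5⟩ := hC _ hu1
    have h6 := expMap_smul_eq hD ht.1.le h5
    rw [h4] at h6
    rw [Function.comp_apply, lift, (extChartAt 𝓘(ℝ, E) q).left_inv hu2, ← h6]
    change expMap D (γ a) u = expMap D (γ a) (L • L⁻¹ • u)
    rw [smul_inv_smul₀ hL0.ne']
  have h3 := h2.congr_of_eventuallyEq hev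
  refine ⟨h3.mdifferentiableAt, fun hinj ↦ ?_⟩
  have h4 := h3.mfderiv
  have h5 : ∀ u : E, G' u = 0 →
      (mfderiv 𝓘(ℝ, E) 𝓘(ℝ, E) (expMap D (γ a)) u₀ : E → E) u = 0 := by
    intro u hu
    have h6 := congrArg (fun B : E →L[ℝ] E ↦ B u) h4
    refine h6.trans ?_
    change (mfderiv 𝓘(ℝ, E) 𝓘(ℝ, E) ((extChartAt 𝓘(ℝ, E) q).symm : E → M) _ : E → E) (G' u) = 0
    rw [hu]
    exact map_zero (mfderiv 𝓘(ℝ, E) 𝓘(ℝ, E) ((extChartAt 𝓘(ℝ, E) q).symm : E → M) _)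
  have h7 : L • W a = 0 := hinj ((h5 _ hG'0).trans (h5 0 (map_zero _)).symm)
  exact hWa ((smul_eq_zero.1 h7).resolve_left hL0.ne')

end Conjugate

/-! ### Fields along a geodesic and parallel transport. -/

section FieldsAlong

set_option synthInstance.maxHeartbeats 400000

variable {E : Type*} [NormedAddCommGroup E] [NormedSpace ℝ E] [FiniteDimensional ℝ E]
  {M : Type*} [TopologicalSpace M] [ChartedSpace E M] [IsManifold 𝓘(ℝ, E) ∞ M]
  {D : CovariantDerivative 𝓘(ℝ, E) E (TangentSpace 𝓘(ℝ, E) : M → Type _)}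
  {q x : M} {c : ℝ → M × E} {V V' : ℝ → E} {v v' : E} {s : Set ℝ} {t : ℝ}

variable (D) in
/-- The field `V` along the geodesic with velocity curve `c` has covariant derivative `v` at
time `t`. -/
def HasFieldDeriv (c : ℝ → M × E) (V : ℝ → E) (v : E) (s : Set ℝ) (t : ℝ) : Prop :=
  HasCovDerivWithinAt D (fun r ↦ ((c r).1, V r)) (c t).2 v s t

/-- The base component of the derivative is automatic along a geodesic; only the fibre component is
a condition on the field. -/
theorem IsSprayCurve.hasFieldDeriv_iff (h : IsSprayCurve D c s) (ht : t ∈ s)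
    (hq : (c t).1 ∈ (extChartAt 𝓘(ℝ, E) q).source) :
    HasFieldDeriv D c V v s t ↔ HasDerivWithinAt (fun r ↦ coord q (c r).1 (V r))
      (coord q (c t).1 v - christoffel D q (extChartAt 𝓘(ℝ, E) q (c t).1) (coord q (c t).1 (c t).2)
        (coord q (c t).1 (V t))) s t := by
  refine ⟨fun h1 ↦ hasDerivWithinAt_snd (h1.hasDerivWithinAt q hq), fun h1 ↦
    HasCovDerivWithinAt.of_chart (h t ht).continuousWithinAt hq ?_⟩
  exact (hasDerivWithinAt_fst (h.hasDerivWithinAt_lift ht hq)).prodMk h1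

theorem coord_smul (r : ℝ) (v : E) : coord q x (r • v) = r • coord q x v :=
  map_smul (coord q x) r v

theorem coord_add (u v : E) : coord q x (u + v) = coord q x u + coord q x v :=
  map_add (coord q x) u v

theorem coord_zero : coord q x (0 : E) = 0 := map_zero (coord q x)

namespace HasFieldDeriv

theorem add (h : IsSprayCurve D c s) (ht : t ∈ s) (hV : HasFieldDeriv D c V v s t)
    (hV' : HasFieldDeriv D c V' v' s t) :
    HasFieldDeriv D c (fun r ↦ V r + V' r) (v + v') s t := by
  have hq := mem_source_self (E := E) (c t).1
  rw [h.hasFieldDeriv_iff ht hq] at *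
  simp only [coord_add]
  refine (hV.add hV').congr_deriv ?_
  rw [map_add]
  abel

theorem smul (h : IsSprayCurve D c s) (ht : t ∈ s) {f : ℝ → ℝ} {f' : ℝ}
    (hf : HasDerivWithinAt f f' s t) (hV : HasFieldDeriv D c V v s t) :
    HasFieldDeriv D c (fun r ↦ f r • V r) (f' • V t + f t • v) s t := by
  have hq := mem_source_self (E := E) (c t).1
  rw [h.hasFieldDeriv_iff ht hq] at *
  simp only [coord_add, coord_smul]
  refine (hf.smul hV).congr_deriv ?_
  rw [map_smul, smul_sub]
  abel

theorem zero (h : IsSprayCurve D c s) (ht : t ∈ s) : HasFieldDeriv D c (fun _ ↦ 0) 0 s t := by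
  have hq := mem_source_self (E := E) (c t).1
  rw [h.hasFieldDeriv_iff ht hq]
  simp only [coord_zero, map_zero, sub_zero]
  exact hasDerivWithinAt_const _ _ _

theorem sum (h : IsSprayCurve D c s) (ht : t ∈ s) {ι : Type*} (I : Finset ι) {V : ι → ℝ → E}
    {v : ι → E} (hV : ∀ i ∈ I, HasFieldDeriv D c (V i) (v i) s t) :
    HasFieldDeriv D c (fun r ↦ ∑ i ∈ I, V i r) (∑ i ∈ I, v i) s t := by
  classical
  induction I using Finset.induction_on with
  | empty => simpa using zero h ht
  | insert i I hi ih =>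
    simp only [Finset.sum_insert hi]
    exact add h ht (hV i (Finset.mem_insert_self i I))
      (ih fun j hj ↦ hV j (Finset.mem_insert_of_mem hj))

end HasFieldDeriv

/-- Parallel transport along a geodesic. -/
theorem IsSprayCurve.exists_parallel [T2Space M]
    (hD : CovariantDerivative.ContMDiffCovariantDerivative D ∞) {a b : ℝ} (hab : a ≤ b)
    (h : IsSprayCurve D c (Icc a b)) (v₀ : E) :
    ∃ V : ℝ → E, V a = v₀ ∧ ∀ t ∈ Icc a b, HasFieldDeriv D c V 0 (Icc a b) t := by
  refine Icc_step_induction (b := b) (fun t ↦ ∃ V : ℝ → E, V a = v₀ ∧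
    ∀ r ∈ Icc a t, HasFieldDeriv D c V 0 (Icc a t) r) ?_ (fun t₀ ht₀ ↦ ?_) b ⟨hab, le_rfl⟩
  · refine ⟨fun _ ↦ v₀, rfl, ?_⟩
    rw [Icc_self]
    rintro t rfl
    exact HasCovDerivWithinAt.singleton _ _ _ _
  set q := (c t₀).1 with hq
  have hqs : (c t₀).1 ∈ (extChartAt 𝓘(ℝ, E) q).source := mem_source_self q
  obtain ⟨ε, hε, hεs⟩ := Metric.mem_nhdsWithin_iff.1
    ((h t₀ ht₀).continuousWithinAt.eventually_mem (source_mem_nhds hqs))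
  refine ⟨ε, hε, ?_⟩
  rintro s hs t ht hs' ht' hst ⟨V, hVa, hV⟩
  have hmem : ∀ τ ∈ Icc s t, (c τ).1 ∈ (extChartAt 𝓘(ℝ, E) q).source := by
    intro τ hτ
    refine hεs ⟨?_, hs.1.trans hτ.1, hτ.2.trans ht.2⟩
    have h1 := abs_lt.1 hs'
    have h2 := abs_lt.1 ht'
    rw [Metric.mem_ball, Real.dist_eq, abs_lt]
    constructor <;> linarith [hτ.1, hτ.2]
  have hst' : IsSprayCurve D c (Icc s t) := h.mono (Icc_subset_Icc hs.1 ht.2)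
  -- Within one chart, parallel transport is the linear equation y' = -Γ(c', y), with continuous
  -- coefficients.
  have hB : ContinuousOn (fun r ↦ -christoffel D q (lift q (c r)).1 (lift q (c r)).2) (Icc s t) := by
    intro τ hτ
    have h1 := (hst' τ hτ).continuousWithinAt_lift (hmem τ hτ)
    have h2 : ContinuousAt (christoffel D q) (lift q (c τ)).1 :=
      (differentiableAt_christoffel hD (mem_target_of_lift (hmem τ hτ))).continuousAt
    have h3 : ContinuousWithinAt (fun r ↦ christoffel D q (lift q (c r)).1) (Icc s t) τ :=
      ContinuousAt.comp_continuousWithinAt (g := christoffel D q) (f := fun r ↦ (lift q (c r)).1)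
        h2 h1.fst
    exact (h3.clm_apply h1.snd).neg
  have : CompleteSpace E := FiniteDimensional.complete ℝ E
  obtain ⟨y, hys, hy⟩ := exists_linearODE_solution hst hB (coord q (c s).1 (V s))
  obtain ⟨Y, hY⟩ : ∃ Y : ℝ → E, ∀ r, Y r = ofCoord q (c r).1 (y r) := ⟨_, fun _ ↦ rfl⟩
  have hVs : ∀ τ ∈ Icc s t, coord q (c τ).1 (Y τ) = y τ := fun τ hτ ↦
    (congrArg (coord q (c τ).1) (hY τ)).trans (coord_ofCoord (hmem τ hτ) (y τ))
  refine ⟨fun r ↦ if r ≤ s then V r else Y r, by simp [hs.1, hVa], ?_⟩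
  have hV' : ∀ r ∈ Icc s t, HasFieldDeriv D c Y 0 (Icc s t) r := by
    intro r hr
    rw [hst'.hasFieldDeriv_iff hr (hmem r hr)]
    refine ((hy r hr).congr hVs (hVs r hr)).congr_deriv ?_
    rw [hVs r hr, coord_zero, zero_sub]
    rfl
  have hcs : ((c s).1, V s) = ((c s).1, Y s) := by
    refine Prod.ext rfl ?_
    change V s = Y s
    rw [hY, hys]
    exact (ofCoord_coord (hmem s ⟨le_rfl, hst⟩) (V s)).symm
  intro r hr
  have h1 := HasCovDerivWithinAt.glue hs.1 hst hV hV' hcs rfl rfl r hr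
  simp only [ite_self] at h1
  have h2 : (fun r ↦ if r ≤ s then ((c r).1, V r) else ((c r).1, Y r)) =
      fun r ↦ ((c r).1, if r ≤ s then V r else Y r) := by
    funext r
    split_ifs <;> rfl
  rw [h2] at h1
  exact h1

end FieldsAlong

/-! ### Parallel tensors along geodesics, and the Jacobi operator. -/

section Tensors

set_option synthInstance.maxHeartbeats 400000

variable {E : Type*} [NormedAddCommGroup E] [NormedSpace ℝ E] [FiniteDimensional ℝ E]
  {M : Type*} [TopologicalSpace M] [ChartedSpace E M] [IsManifold 𝓘(ℝ, E) ∞ M]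
  {D : CovariantDerivative 𝓘(ℝ, E) E (TangentSpace 𝓘(ℝ, E) : M → Type _)}
  {q x : M} {c : ℝ → M × E} {V V' : ℝ → E} {v v' : E} {s : Set ℝ} {t : ℝ}

namespace PseudoHermitian

variable (S : PseudoHermitian E M)

/-- The Webster metric as a bilinear form on the model space. -/
def form (x : M) : E →L[ℝ] E →L[ℝ] ℝ :=
  (S.metricRep x (extChartAt 𝓘(ℝ, E) x x)).bilinearComp (coord x x : E →L[ℝ] E)
    (coord x x : E →L[ℝ] E)

/-- The endomorphism `J` on the model space. -/
def endo (x : M) : E →L[ℝ] E := S.J x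

/-- The Reeb field as an element of the model space. -/
def reeb (x : M) : E := S.ξ x

theorem form_eq_metric (x : M) (u v : E) : S.form x u v = S.metric x u v :=
  (metric_eq (mem_source_self x) u v).symm

variable {S}

theorem form_coord (hx : x ∈ (extChartAt 𝓘(ℝ, E) q).source) (u v : E) :
    S.form x u v = S.metricRep q (extChartAt 𝓘(ℝ, E) q x) (coord q x u) (coord q x v) :=
  (S.form_eq_metric x u v).trans (metric_eq hx u v)

theorem form_symm (x : M) (u v : E) : S.form x u v = S.form x v u :=
  metricRep_symm ((extChartAt 𝓘(ℝ, E) x).map_source (mem_source_self x)) _ _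

theorem form_pos (x : M) {v : E} (hv : v ≠ 0) : 0 < S.form x v v := by
  rw [form_eq_metric]
  exact metric_pos x hv

theorem form_reeb_reeb (x : M) : S.form x (S.reeb x) (S.reeb x) = 1 := by
  rw [form_eq_metric]
  exact (metric_ξ_left x _).trans (S.θ_ξ x)

theorem form_reeb_right (x : M) (v : E) : S.form x v (S.reeb x) = S.θ x v := by
  rw [form_eq_metric]
  exact metric_ξ_right x v

theorem coord_endo (hx : x ∈ (extChartAt 𝓘(ℝ, E) q).source) (v : E) :
    coord q x (S.endo x v) = endoRep q S.J (extChartAt 𝓘(ℝ, E) q x) (coord q x v) :=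
  (endoRep_coord hx v).symm

theorem coord_reeb (hx : x ∈ (extChartAt 𝓘(ℝ, E) q).source) :
    coord q x (S.reeb x) = rep q S.ξ (extChartAt 𝓘(ℝ, E) q x) :=
  (rep_apply hx S.ξ).symm

namespace IsTanakaWebster

variable (hD : S.IsTanakaWebster D)
include hD

section Derivatives

variable (h : IsSprayCurve D c s) (ht : t ∈ s)
include h ht

theorem hasFieldDeriv_reeb : HasFieldDeriv D c (fun r ↦ S.reeb (c r).1) 0 s t := by
  have hq := mem_source_self (E := E) (c t).1
  set q := (c t).1
  rw [h.hasFieldDeriv_iff ht hq]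
  have h1 : HasFDerivAt (rep q S.ξ) (fderiv ℝ (rep q S.ξ) (lift q (c t)).1) (lift q (c t)).1 :=
    ((contDiffOn_rep_ξ.contDiffAt ((isOpen_extChartAt_target q).mem_nhds
      (mem_target_of_lift hq))).differentiableAt (by simp)).hasFDerivAt
  have h2 := h1.comp_hasDerivWithinAt t (hasDerivWithinAt_fst (h.hasDerivWithinAt_lift ht hq))
  rw [hD.fderiv_rep_ξ (mem_target_of_lift hq)] at h2
  refine (h2.congr_of_eventuallyEq ?_ (coord_reeb hq)).congr_deriv ?_
  · filter_upwards [(h t ht).continuousWithinAt.eventually_mem (source_mem_nhds hq)] with r hr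
    exact coord_reeb hr
  · rw [coord_zero, zero_sub, coord_reeb hq]
    rfl

theorem hasFieldDeriv_endo (hV : HasFieldDeriv D c V v s t) :
    HasFieldDeriv D c (fun r ↦ S.endo (c r).1 (V r)) (S.endo (c t).1 v) s t := by
  have hq := mem_source_self (E := E) (c t).1
  set q := (c t).1
  rw [h.hasFieldDeriv_iff ht hq] at *
  have h1 : HasFDerivAt (endoRep q S.J) (fderiv ℝ (endoRep q S.J) (lift q (c t)).1)
      (lift q (c t)).1 :=
    (((contDiffOn_endoRep S.contMDiff_J q).contDiffAt ((isOpen_extChartAt_target q).mem_nhds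
      (mem_target_of_lift hq))).differentiableAt (by simp)).hasFDerivAt
  have h2 : HasDerivWithinAt (fun r ↦ endoRep q S.J (lift q (c r)).1)
      (fderiv ℝ (endoRep q S.J) (lift q (c t)).1 (lift q (c t)).2) s t :=
    HasFDerivAt.comp_hasDerivWithinAt (l := endoRep q S.J) (f := fun r ↦ (lift q (c r)).1) t h1
      (hasDerivWithinAt_fst (h.hasDerivWithinAt_lift ht hq))
  have h3 := h2.clm_apply hV
  rw [hD.fderiv_endoRep (mem_target_of_lift hq)] at h3
  refine (h3.congr_of_eventuallyEq ?_ (coord_endo hq _)).congr_deriv ?_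
  · filter_upwards [(h t ht).continuousWithinAt.eventually_mem (source_mem_nhds hq)] with r hr
    exact coord_endo hr _
  · rw [coord_endo hq, coord_endo hq, map_sub]
    simp only [lift]
    abel

theorem hasDerivWithinAt_form (hV : HasFieldDeriv D c V v s t)
    (hV' : HasFieldDeriv D c V' v' s t) :
    HasDerivWithinAt (fun r ↦ S.form (c r).1 (V r) (V' r))
      (S.form (c t).1 v (V' t) + S.form (c t).1 (V t) v') s t := by
  have hq := mem_source_self (E := E) (c t).1
  set q := (c t).1
  rw [h.hasFieldDeriv_iff ht hq] at hV hV'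
  have h1 : HasFDerivAt (S.metricRep q) (fderiv ℝ (S.metricRep q) (lift q (c t)).1)
      (lift q (c t)).1 :=
    ((contDiffOn_metricRep.contDiffAt ((isOpen_extChartAt_target q).mem_nhds
      (mem_target_of_lift hq))).differentiableAt (by simp)).hasFDerivAt
  have h2 : HasDerivWithinAt (fun r ↦ S.metricRep q (lift q (c r)).1)
      (fderiv ℝ (S.metricRep q) (lift q (c t)).1 (lift q (c t)).2) s t :=
    HasFDerivAt.comp_hasDerivWithinAt (l := S.metricRep q) (f := fun r ↦ (lift q (c r)).1) t h1
      (hasDerivWithinAt_fst (h.hasDerivWithinAt_lift ht hq))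
  have h3 := (h2.clm_apply hV).clm_apply hV'
  rw [_root_.add_apply, hD.fderiv_metricRep (mem_target_of_lift hq)] at h3
  refine (h3.congr_of_eventuallyEq ?_ (form_coord hq _ _)).congr_deriv ?_
  · filter_upwards [(h t ht).continuousWithinAt.eventually_mem (source_mem_nhds hq)] with r hr
    exact form_coord hr _ _
  · rw [form_coord hq, form_coord hq]
    simp only [map_sub, _root_.sub_apply, lift]
    ring

end Derivatives

variable [T2Space M] (hS : S.IsSasakian D)
include hS

theorem hasParallelTorsion : HasParallelTorsion D := fun q _ hz ↦
  (hD.isLocalSasakian hS q).torsion_parallel hz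

theorem torsion_eq (x : M) (u v : E) :
    (D.torsion x u v : E) = (-2 * S.form x u (S.endo x v)) • S.reeb x := by
  have hx := mem_source_self (E := E) x
  refine coord_injective hx ?_
  refine (coord_torsion hx u v).trans ?_
  refine (hD.localTorsion_christoffel hS ((extChartAt 𝓘(ℝ, E) x).map_source hx) _ _).trans ?_
  rw [coord_smul, form_coord hx, coord_endo hx, coord_reeb hx]

end IsTanakaWebster

end PseudoHermitian

theorem coord_curvature_of_smooth [T2Space M]
    (hD : CovariantDerivative.ContMDiffCovariantDerivative D ∞)
    (hx : x ∈ (extChartAt 𝓘(ℝ, E) q).source) (u v w : E) :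
    coord q x (curvature D x u v w) = localCurvature (christoffel D q)
      (extChartAt 𝓘(ℝ, E) q x) (coord q x u) (coord q x v) (coord q x w) :=
  coord_curvature hx (differentiableAt_christoffel hD
    ((extChartAt 𝓘(ℝ, E) q).map_source hx)) u v w

theorem localCurvature_add_left (Γ : E → E →L[ℝ] E →L[ℝ] E) (z u u' v w : E) :
    localCurvature Γ z (u + u') v w = localCurvature Γ z u v w + localCurvature Γ z u' v w := by
  simp only [localCurvature, map_add, _root_.add_apply]
  abel

theorem localCurvature_smul_left (Γ : E → E →L[ℝ] E →L[ℝ] E) (z : E) (r : ℝ) (u v w : E) :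
    localCurvature Γ z (r • u) v w = r • localCurvature Γ z u v w := by
  simp only [localCurvature, map_smul, _root_.smul_apply, smul_sub, smul_add]

theorem localCurvature_add_right (Γ : E → E →L[ℝ] E →L[ℝ] E) (z u v w w' : E) :
    localCurvature Γ z u v (w + w') = localCurvature Γ z u v w + localCurvature Γ z u v w' := by
  simp only [localCurvature, map_add]
  abel

theorem localCurvature_smul_right (Γ : E → E →L[ℝ] E →L[ℝ] E) (z : E) (r : ℝ) (u v w : E) :
    localCurvature Γ z u v (r • w) = r • localCurvature Γ z u v w := by
  simp only [localCurvature, map_smul, smul_sub, smul_add]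

/-- The Jacobi operator `v ↦ R(v, u) u`. -/
def jacobiOperator [T2Space M] (hD : CovariantDerivative.ContMDiffCovariantDerivative D ∞)
    (x : M) (u : E) : E →ₗ[ℝ] E where
  toFun v := curvature D x v u u
  map_add' v w := by
    have hx := mem_source_self (E := E) x
    have h1 := fun v : E ↦ coord_curvature_of_smooth hD hx v u u
    refine coord_injective hx ((h1 _).trans (Eq.trans ?_ (coord_add _ _).symm))
    rw [h1, h1, ← localCurvature_add_left, ← coord_add]
  map_smul' r v := by
    have hx := mem_source_self (E := E) x
    have h1 := fun v : E ↦ coord_curvature_of_smooth hD hx v u u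
    refine coord_injective hx ((h1 _).trans (Eq.trans ?_ (coord_smul _ _).symm))
    rw [h1, RingHom.id_apply, ← localCurvature_smul_left, ← coord_smul]

theorem coord_jacobiOperator [T2Space M]
    (hD : CovariantDerivative.ContMDiffCovariantDerivative D ∞)
    (hx : x ∈ (extChartAt 𝓘(ℝ, E) q).source) (u v : E) :
    coord q x (jacobiOperator hD x u v) = localCurvature (christoffel D q)
      (extChartAt 𝓘(ℝ, E) q x) (coord q x v) (coord q x u) (coord q x u) :=
  coord_curvature_of_smooth hD hx v u u

theorem ricci_eq_trace [T2Space M]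
    (hD : CovariantDerivative.ContMDiffCovariantDerivative D ∞) (x : M) (u : E) :
    ricci D x u u = LinearMap.trace ℝ E (jacobiOperator hD x u) := by
  rw [LinearMap.trace_eq_matrix_trace ℝ (Module.finBasis ℝ E)]
  simp only [Matrix.trace, Matrix.diag, LinearMap.toMatrix_apply]
  rfl

theorem jacobiOperator_self [T2Space M]
    (hD : CovariantDerivative.ContMDiffCovariantDerivative D ∞) (x : M) (u : E) :
    jacobiOperator hD x u u = 0 := by
  have hx := mem_source_self (E := E) x
  refine coord_injective hx ((coord_jacobiOperator hD hx u u).trans (Eq.trans ?_ coord_zero.symm))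
  simp [localCurvature]

namespace PseudoHermitian.IsTanakaWebster

variable [T2Space M] {S : PseudoHermitian E M} (hD : S.IsTanakaWebster D) (hS : S.IsSasakian D)
include hD hS

/-- Pair symmetry, then skewness: ⟨R(v,u)u, w⟩ = ⟨R(u,w)v, u⟩ = -⟨v, R(u,w)u⟩ = ⟨v, R(w,u)u⟩. -/
theorem form_jacobiOperator (x : M) (u v w : E) :
    S.form x (jacobiOperator hD.smooth x u v) w = S.form x v (jacobiOperator hD.smooth x u w) := by
  have hx := mem_source_self (E := E) x
  have hz := (extChartAt 𝓘(ℝ, E) x).map_source hx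
  have hl := hD.isLocalSasakian hS x
  rw [form_coord hx, form_coord hx, coord_jacobiOperator hD.smooth hx,
    coord_jacobiOperator hD.smooth hx, hl.localCurvature_pair_symm hz,
    hl.metric_localCurvature_skew hz, localCurvature_antisymm, map_neg, neg_neg]

theorem localCurvature_reeb (x : M) {a b d : E}
    (h : a = coord x x (S.reeb x) ∨ b = coord x x (S.reeb x) ∨ d = coord x x (S.reeb x)) :
    localCurvature (christoffel D x) (extChartAt 𝓘(ℝ, E) x x) a b d = 0 := by
  have hx := mem_source_self (E := E) x
  have hz := (extChartAt 𝓘(ℝ, E) x).map_source hx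
  have hl := hD.isLocalSasakian hS x
  have h1 := fun v w ↦ hl.localCurvature_ξ_left hz (fun v hv ↦ metricRep_pos hz hv) v w
  rw [coord_reeb hx] at h
  rcases h with rfl | rfl | rfl
  · exact h1 _ _
  · rw [localCurvature_antisymm]
    exact neg_eq_zero.2 (h1 _ _)
  · exact hl.localCurvature_ξ hz _ _

theorem jacobiOperator_reeb (x : M) (u : E) : jacobiOperator hD.smooth x u (S.reeb x) = 0 := by
  have hx := mem_source_self (E := E) x
  refine coord_injective hx ((coord_jacobiOperator hD.smooth hx u _).trans
    (Eq.trans ?_ coord_zero.symm))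
  exact hD.localCurvature_reeb hS x (Or.inl rfl)

/-- The curvature vanishes when any argument is vertical, so the operator sees only the horizontal
part of u. This is how a Ricci bound on H alone controls a geodesic with nonzero vertical component.
-/
theorem jacobiOperator_add_reeb (x : M) (u : E) (r : ℝ) :
    jacobiOperator hD.smooth x (u + r • S.reeb x) = jacobiOperator hD.smooth x u := by
  ext v
  have hx := mem_source_self (E := E) x
  refine coord_injective hx ((coord_jacobiOperator hD.smooth hx _ v).trans
    (Eq.trans ?_ (coord_jacobiOperator hD.smooth hx u v).symm))
  have h1 := fun d ↦ hD.localCurvature_reeb hS x (a := coord x x v) (d := d) (Or.inr (Or.inl rfl))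
  have h2 := hD.localCurvature_reeb hS x (a := coord x x v) (b := coord x x u)
    (Or.inr (Or.inr rfl))
  rw [coord_add, coord_smul, localCurvature_antisymm, localCurvature_add_left,
    localCurvature_smul_left, neg_add, ← smul_neg, ← localCurvature_antisymm,
    ← localCurvature_antisymm, h1, smul_zero, add_zero, localCurvature_add_right,
    localCurvature_smul_right, h2, smul_zero, add_zero]

end PseudoHermitian.IsTanakaWebster

end Tensors

/-! ### Orthonormal frames for a positive definite bilinear form. -/

section Frames

variable {E : Type*} [NormedAddCommGroup E] [NormedSpace ℝ E]
  {B : E →L[ℝ] E →L[ℝ] ℝ} {ι : Type*}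

/-- The family `f` is orthonormal for the bilinear form `B`. -/
def IsOrthonormalFor (B : E →L[ℝ] E →L[ℝ] ℝ) (f : ι → E) : Prop :=
  (∀ i, B (f i) (f i) = 1) ∧ ∀ i j, i ≠ j → B (f i) (f j) = 0

namespace IsOrthonormalFor

variable [Fintype ι] {f : ι → E}

theorem apply_sum (h : IsOrthonormalFor B f) (r : ι → ℝ) (i : ι) :
    B (∑ j, r j • f j) (f i) = r i := by
  rw [map_sum, _root_.sum_apply, Finset.sum_eq_single i]
  · rw [map_smul, _root_.smul_apply, h.1, smul_eq_mul, mul_one]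
  · intro j _ hj
    rw [map_smul, _root_.smul_apply, h.2 j i hj, smul_zero]
  · simp

theorem linearIndependent (h : IsOrthonormalFor B f) : LinearIndependent ℝ f := by
  rw [Fintype.linearIndependent_iff]
  intro r hr i
  rw [← h.apply_sum r i, hr, map_zero, _root_.zero_apply]

variable [FiniteDimensional ℝ E]

theorem exists_basis (h : IsOrthonormalFor B f) (hcard : Fintype.card ι = Module.finrank ℝ E) :
    ∃ b : Module.Basis ι ℝ E, (∀ i, b i = f i) ∧ ∀ v i, b.repr v i = B v (f i) := by
  classical
  rcases isEmpty_or_nonempty ι with hι | hι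
  · have h0 : Module.finrank ℝ E = 0 := by rw [← hcard, Fintype.card_eq_zero]
    have hsub : Subsingleton E := Module.finrank_zero_iff.1 h0
    exact ⟨Module.Basis.empty E, fun i ↦ isEmptyElim i, fun v i ↦ isEmptyElim i⟩
  · refine ⟨basisOfLinearIndependentOfCardEqFinrank h.linearIndependent hcard, by simp, ?_⟩
    intro v i
    set b := basisOfLinearIndependentOfCardEqFinrank h.linearIndependent hcard with hb
    have h1 := b.sum_repr v
    simp only [hb, coe_basisOfLinearIndependentOfCardEqFinrank] at h1
    conv_rhs => rw [← h1]
    rw [h.apply_sum]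

theorem sum_apply_smul (h : IsOrthonormalFor B f) (hcard : Fintype.card ι = Module.finrank ℝ E)
    (v : E) : ∑ i, B v (f i) • f i = v := by
  obtain ⟨b, hb, hr⟩ := h.exists_basis hcard
  simpa only [hb, hr] using b.sum_repr v

theorem trace_eq (h : IsOrthonormalFor B f) (hcard : Fintype.card ι = Module.finrank ℝ E)
    (K : E →ₗ[ℝ] E) : LinearMap.trace ℝ E K = ∑ i, B (K (f i)) (f i) := by
  classical
  obtain ⟨b, hb, hr⟩ := h.exists_basis hcard
  rw [LinearMap.trace_eq_matrix_trace ℝ b]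
  simp only [Matrix.trace, Matrix.diag, LinearMap.toMatrix_apply, hb, hr]

end IsOrthonormalFor

/-- An orthonormal family can be completed to an orthonormal basis. -/
theorem exists_isOrthonormalFor [FiniteDimensional ℝ E] (hsymm : ∀ u v, B u v = B v u)
    (hpos : ∀ v, v ≠ 0 → 0 < B v v) {ι κ : Type*} [Fintype ι] [Fintype κ] {p : ι → E}
    (hp : IsOrthonormalFor B p)
    (hcard : Module.finrank ℝ E = Fintype.card ι + Fintype.card κ) :
    ∃ e : κ → E, IsOrthonormalFor B (Sum.elim p e) := by
  classical
  have hnn : ∀ v, 0 ≤ B v v := fun v ↦ by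
    by_cases hv : v = 0
    · simp [hv]
    · exact (hpos v hv).le
  -- The claim is proved for an abstract vector space, because E already carries a norm unrelated to
  -- B.
  have key : ∀ (V : Type _) [AddCommGroup V] [Module ℝ V] [FiniteDimensional ℝ V]
      (b : V →ₗ[ℝ] V →ₗ[ℝ] ℝ) (_ : ∀ u v, b u v = b v u) (_ : ∀ v, v ≠ 0 → 0 < b v v)
      (_ : ∀ v, 0 ≤ b v v) (p : ι → V) (_ : ∀ i, b (p i) (p i) = 1)
      (_ : ∀ i j, i ≠ j → b (p i) (p j) = 0)
      (_ : Module.finrank ℝ V = Fintype.card ι + Fintype.card κ),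
      ∃ f : ι ⊕ κ → V, (∀ i, f (Sum.inl i) = p i) ∧ (∀ i, b (f i) (f i) = 1) ∧
        ∀ i j, i ≠ j → b (f i) (f j) = 0 := by
    intro V _ _ _ b hs hpos hnn p hp1 hp2 hcard
    let core : InnerProductSpace.Core ℝ V :=
      { inner := fun u v ↦ b u v
        conj_inner_symm := fun u v ↦ hs v u
        re_inner_nonneg := fun v ↦ hnn v
        add_left := fun u v w ↦ by simp
        smul_left := fun u v r ↦ by simp
        definite := fun v hv ↦ by
          by_contra hne
          exact (hpos v hne).ne' hv }
    let _ : NormedAddCommGroup V := core.toNormedAddCommGroup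
    let _ : InnerProductSpace ℝ V := InnerProductSpace.ofCore core.toCore
    have hinner : ∀ u v : V, inner ℝ u v = b u v := fun _ _ ↦ rfl
    -- The family is padded by zeros on the second summand; only its restriction to the first has to
    -- be orthonormal.
    have hv : Orthonormal ℝ ((range (Sum.inl : ι → ι ⊕ κ)).domRestrict
        (Sum.elim p (fun _ : κ ↦ (0 : V)))) := by
      constructor
      · rintro ⟨_, i, rfl⟩
        have h1 : ‖p i‖ ^ 2 = 1 := by
          rw [← real_inner_self_eq_norm_sq, hinner, hp1]
        simpa using (pow_eq_one_iff_of_nonneg (norm_nonneg (p i)) two_ne_zero).1 h1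
      · rintro ⟨_, i, rfl⟩ ⟨_, j, rfl⟩ hij
        exact hp2 i j fun h ↦ hij (by simp [h])
    obtain ⟨f, hf⟩ := hv.exists_orthonormalBasis_extension_of_card_eq (by simpa using hcard)
    refine ⟨f, fun i ↦ (hf (Sum.inl i) ⟨i, rfl⟩), fun i ↦ ?_, fun i j hij ↦ ?_⟩
    · rw [← hinner, real_inner_self_eq_norm_sq, f.orthonormal.1 i, one_pow]
    · rw [← hinner, f.orthonormal.2 hij]
  obtain ⟨f, hfp, hf1, hf2⟩ := key E (ContinuousLinearMap.coeLM ℝ ∘ₗ B.toLinearMap) hsymm hpos hnn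
    p hp.1 hp.2 hcard
  have hfe : Sum.elim p (f ∘ Sum.inr) = f := by
    ext i
    rcases i with i | i
    · exact (hfp i).symm
    · rfl
  exact ⟨f ∘ Sum.inr, by rw [hfe]; exact ⟨hf1, hf2⟩⟩

end Frames

/-! ### Two facts of one-variable calculus. -/

theorem eq_left_of_hasDerivWithinAt_zero {f : ℝ → ℝ} {a b : ℝ}
    (h : ∀ t ∈ Icc a b, HasDerivWithinAt f 0 (Icc a b) t) : ∀ t ∈ Icc a b, f t = f a :=
  constant_of_has_deriv_right_zero (fun t ht ↦ (h t ht).continuousWithinAt) fun t ht ↦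
    (h t ⟨ht.1, ht.2.le⟩).mono_of_mem_nhdsWithin (Icc_mem_nhdsGE_of_mem ht)

/-- A function with prescribed derivative up to a constant and two prescribed zeros. -/
theorem exists_primitive_zero {φ : ℝ → ℝ} {a b t₁ : ℝ} (hφ : ContinuousOn φ (Icc a b))
    (ht₁ : t₁ ∈ Ioc a b) : ∃ (f : ℝ → ℝ) (k : ℝ), f a = 0 ∧ f t₁ = 0 ∧
      ∀ t ∈ Icc a b, HasDerivWithinAt f (φ t + k) (Icc a b) t := by
  have hab : a ≤ b := ht₁.1.le.trans ht₁.2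
  -- φ is extended continuously to the line to apply the fundamental theorem of calculus; the
  -- constant is minus the mean of φ over [a, t₁].
  set ψ := IccExtend hab ((Icc a b).domRestrict φ) with hψ
  have hψc : Continuous ψ := (continuousOn_iff_continuous_domRestrict.1 hφ).Icc_extend'
  have hψφ : ∀ t ∈ Icc a b, ψ t = φ t := fun t ht ↦ by rw [hψ, IccExtend_of_mem hab _ ht]; rfl
  set I := ∫ τ in a..t₁, ψ τ with hI
  refine ⟨fun t ↦ (∫ τ in a..t, ψ τ) + (t - a) * (-(I / (t₁ - a))), -(I / (t₁ - a)), by simp,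
    ?_, fun t ht ↦ ?_⟩
  · have : t₁ - a ≠ 0 := (sub_pos.2 ht₁.1).ne'
    field_simp
    rw [← hI]
    ring
  · rw [← hψφ t ht]
    have h1 := (hψc.integral_hasStrictDerivAt a t).hasDerivAt
    have h2 := (((hasDerivAt_id t).sub_const a).mul_const (-(I / (t₁ - a))))
    rw [one_mul] at h2
    exact (h1.add h2).hasDerivWithinAt

/-! ### Continuity of the matrix of the Jacobi operator. -/

section Continuity

set_option synthInstance.maxHeartbeats 400000

variable {E : Type*} [NormedAddCommGroup E] [NormedSpace ℝ E] [FiniteDimensional ℝ E]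
  {M : Type*} [TopologicalSpace M] [ChartedSpace E M] [IsManifold 𝓘(ℝ, E) ∞ M]
  {D : CovariantDerivative 𝓘(ℝ, E) E (TangentSpace 𝓘(ℝ, E) : M → Type _)}
  {c : ℝ → M × E} {V V' : ℝ → E} {v v' : E} {s : Set ℝ} {t : ℝ} {S : PseudoHermitian E M}

theorem continuousWithinAt_localCurvature {Γ : E → E →L[ℝ] E →L[ℝ] E} {x u v w : ℝ → E}
    (hΓ : ContDiffAt ℝ 1 Γ (x t)) (hx : ContinuousWithinAt x s t)
    (hu : ContinuousWithinAt u s t) (hv : ContinuousWithinAt v s t)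
    (hw : ContinuousWithinAt w s t) :
    ContinuousWithinAt (fun r ↦ localCurvature Γ (x r) (u r) (v r) (w r)) s t := by
  have h1 : ContinuousWithinAt (fun r ↦ Γ (x r)) s t :=
    ContinuousAt.comp_continuousWithinAt (g := Γ) (f := x) hΓ.continuousAt hx
  have h2 : ContinuousWithinAt (fun r ↦ fderiv ℝ Γ (x r)) s t :=
    ContinuousAt.comp_continuousWithinAt (g := fderiv ℝ Γ) (f := x)
      (hΓ.fderiv_right (m := 0) (by simp)).continuousAt hx
  exact (((((h2.clm_apply hu).clm_apply hv).clm_apply hw).sub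
    (((h2.clm_apply hv).clm_apply hu).clm_apply hw)).add
    ((h1.clm_apply hu).clm_apply ((h1.clm_apply hv).clm_apply hw))).sub
    ((h1.clm_apply hv).clm_apply ((h1.clm_apply hu).clm_apply hw))

theorem HasFieldDeriv.continuousWithinAt_coord {q : M} (hV : HasFieldDeriv D c V v s t)
    (hq : (c t).1 ∈ (extChartAt 𝓘(ℝ, E) q).source) :
    ContinuousWithinAt (fun r ↦ coord q (c r).1 (V r)) s t :=
  (hV.continuousWithinAt_lift hq).snd

theorem continuousWithinAt_form_jacobiOperator [T2Space M]
    (hD : CovariantDerivative.ContMDiffCovariantDerivative D ∞) (h : IsSprayCurve D c s)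
    (ht : t ∈ s) (hV : HasFieldDeriv D c V v s t) (hV' : HasFieldDeriv D c V' v' s t) :
    ContinuousWithinAt (fun r ↦ S.form (c r).1 (jacobiOperator hD (c r).1 (c r).2 (V r)) (V' r))
      s t := by
  have hq := mem_source_self (E := E) (c t).1
  set q := (c t).1
  have hz := mem_target_of_lift hq
  have h1 := (h t ht).continuousWithinAt_lift hq
  have hΓ : ContDiffAt ℝ 1 (christoffel D q) (lift q (c t)).1 :=
    ((contDiffOn_christoffel hD q).contDiffAt ((isOpen_extChartAt_target q).mem_nhds hz)).of_le
      (by simp)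
  have h2 : ContinuousWithinAt (fun r ↦ S.metricRep q (lift q (c r)).1) s t :=
    ContinuousAt.comp_continuousWithinAt (g := S.metricRep q) (f := fun r ↦ (lift q (c r)).1)
      (PseudoHermitian.contDiffOn_metricRep.contDiffAt
        ((isOpen_extChartAt_target q).mem_nhds hz)).continuousAt h1.fst
  have h3 := (h2.clm_apply (continuousWithinAt_localCurvature hΓ h1.fst
    (hV.continuousWithinAt_coord hq) h1.snd h1.snd)).clm_apply (hV'.continuousWithinAt_coord hq)
  have h4 : ∀ r, (c r).1 ∈ (extChartAt 𝓘(ℝ, E) q).source →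
      S.form (c r).1 (jacobiOperator hD (c r).1 (c r).2 (V r)) (V' r) =
        S.metricRep q (lift q (c r)).1 (localCurvature (christoffel D q) (lift q (c r)).1
          (coord q (c r).1 (V r)) (lift q (c r)).2 (lift q (c r)).2) (coord q (c r).1 (V' r)) := by
    intro r hr
    rw [PseudoHermitian.form_coord hr, coord_jacobiOperator hD hr]
    rfl
  refine h3.congr_of_eventuallyEq ?_ (h4 t hq)
  filter_upwards [(h t ht).continuousWithinAt.eventually_mem (source_mem_nhds hq)] with r hr
  exact h4 r hr

end Continuity

/-! ### Construction of the Jacobi field with two zeros. -/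

section Comparison

set_option synthInstance.maxHeartbeats 400000

variable {E : Type*} [NormedAddCommGroup E] [NormedSpace ℝ E] [FiniteDimensional ℝ E]
  {M : Type*} [TopologicalSpace M] [ChartedSpace E M] [IsManifold 𝓘(ℝ, E) ∞ M]
  {D : CovariantDerivative 𝓘(ℝ, E) E (TangentSpace 𝓘(ℝ, E) : M → Type _)}
  {c : ℝ → M × E} {a b : ℝ} {S : PseudoHermitian E M}

namespace PseudoHermitian

/-- ρ is the length of the horizontal part u - κξ of the unit vector u; it is positive precisely
because u is not vertical. -/
theorem isOrthonormalFor_pair {x : M} {u : E} {κ ρ : ℝ} (hρ : ρ ^ 2 = 1 - κ ^ 2) (hρ0 : 0 < ρ)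
    (hunit : S.form x u u = 1) (hκ : S.form x u (S.reeb x) = κ) :
    IsOrthonormalFor (S.form x) ![S.reeb x, ρ⁻¹ • (u + (-κ) • S.reeb x)] := by
  have h1 := S.form_reeb_reeb x
  have h2 := form_symm (S := S) x (S.reeb x) u
  have h3 : S.form x (S.reeb x) (ρ⁻¹ • (u + (-κ) • S.reeb x)) = 0 := by
    rw [map_smul, map_add, map_smul, h2, hκ, h1]
    simp
  refine ⟨Fin.forall_fin_two.2 ⟨h1, ?_⟩, ?_⟩
  · change S.form x (ρ⁻¹ • (u + (-κ) • S.reeb x))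
      (ρ⁻¹ • (u + (-κ) • S.reeb x)) = 1
    simp only [map_smul, map_add, _root_.smul_apply, _root_.add_apply, smul_eq_mul, hunit, hκ,
      h1, h2]
    field_simp
    linarith
  · intro i j hij
    fin_cases i <;> fin_cases j
    · exact absurd rfl hij
    · exact h3
    · exact (form_symm _ _ _).trans h3
    · exact absurd rfl hij

namespace IsTanakaWebster

variable (hD : S.IsTanakaWebster D)
include hD

theorem form_eq_of_parallel (h : IsSprayCurve D c (Icc a b)) {V V' : ℝ → E}
    (hV : ∀ t ∈ Icc a b, HasFieldDeriv D c V 0 (Icc a b) t)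
    (hV' : ∀ t ∈ Icc a b, HasFieldDeriv D c V' 0 (Icc a b) t) :
    ∀ t ∈ Icc a b, S.form (c t).1 (V t) (V' t) = S.form (c a).1 (V a) (V' a) :=
  eq_left_of_hasDerivWithinAt_zero (f := fun t ↦ S.form (c t).1 (V t) (V' t)) fun t ht ↦
    (hD.hasDerivWithinAt_form h ht (hV t ht) (hV' t ht)).congr_deriv (by simp)

/-- The horizontal part of the velocity of a geodesic is parallel. -/
theorem hasFieldDeriv_horizontal (h : IsSprayCurve D c (Icc a b)) (r κ : ℝ) :
    ∀ t ∈ Icc a b, HasFieldDeriv D c (fun t ↦ r • ((c t).2 + (-κ) • S.reeb (c t).1)) 0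
      (Icc a b) t := by
  intro t ht
  have h1 := HasFieldDeriv.smul h ht (hasDerivWithinAt_const t _ (-κ)) (hD.hasFieldDeriv_reeb h ht)
  have h2 : HasFieldDeriv D c (fun t ↦ (c t).2) 0 (Icc a b) t := h t ht
  have h3 := HasFieldDeriv.smul h ht (hasDerivWithinAt_const t _ r) (HasFieldDeriv.add h ht h2 h1)
  simpa using h3

variable [T2Space M] (hS : S.IsSasakian D)
include hS

/-- A parallel orthonormal frame containing the Reeb field and the normalised horizontal part of
the velocity. -/
theorem exists_parallel_frame {n : ℕ} (hdim : Module.finrank ℝ E = 2 + n) (hab : a ≤ b)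
    (h : IsSprayCurve D c (Icc a b)) {κ ρ : ℝ} (hρ : ρ ^ 2 = 1 - κ ^ 2) (hρ0 : 0 < ρ)
    (hunit : S.form (c a).1 (c a).2 (c a).2 = 1)
    (hκ : S.form (c a).1 (c a).2 (S.reeb (c a).1) = κ) :
    ∃ e : Fin n → ℝ → E, (∀ i, ∀ t ∈ Icc a b, HasFieldDeriv D c (e i) 0 (Icc a b) t) ∧
      ∀ t ∈ Icc a b, IsOrthonormalFor (S.form (c t).1) (Sum.elim
        ![S.reeb (c t).1, ρ⁻¹ • ((c t).2 + (-κ) • S.reeb (c t).1)] fun i ↦ e i t) := by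
  have hp := isOrthonormalFor_pair hρ hρ0 hunit hκ
  obtain ⟨e₀, he₀⟩ := exists_isOrthonormalFor (κ := Fin n) (form_symm (S := S) (c a).1)
    (fun v hv ↦ form_pos (c a).1 hv) hp (by simpa using hdim)
  choose e hea he using fun i ↦ h.exists_parallel hD.smooth hab (e₀ i)
  refine ⟨e, he, fun t ht ↦ ?_⟩
  -- Every member of the frame is parallel, including ξ and the horizontal velocity, so
  -- orthonormality at a persists.
  have hpar : ∀ i, ∃ V : ℝ → E, (∀ t ∈ Icc a b, HasFieldDeriv D c V 0 (Icc a b) t) ∧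
      ∀ t, Sum.elim ![S.reeb (c t).1, ρ⁻¹ • ((c t).2 + (-κ) • S.reeb (c t).1)]
        (fun i ↦ e i t) i = V t := by
    rintro (i | i)
    · fin_cases i
      · exact ⟨_, fun t ht ↦ hD.hasFieldDeriv_reeb h ht, fun _ ↦ rfl⟩
      · exact ⟨_, hD.hasFieldDeriv_horizontal h ρ⁻¹ κ, fun _ ↦ rfl⟩
    · exact ⟨_, he i, fun _ ↦ rfl⟩
  choose F hF hFe using hpar
  have he₀F : ∀ i, Sum.elim ![S.reeb (c a).1, ρ⁻¹ • ((c a).2 + (-κ) • S.reeb (c a).1)] e₀ i =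
      F i a := by
    intro i
    rw [← hFe]
    rcases i with i | i
    · rfl
    · exact (hea i).symm
  refine ⟨fun i ↦ ?_, fun i j hij ↦ ?_⟩
  · rw [hFe, hD.form_eq_of_parallel h (hF i) (hF i) t ht, ← he₀F]
    exact he₀.1 i
  · rw [hFe, hFe, hD.form_eq_of_parallel h (hF i) (hF j) t ht, ← he₀F, ← he₀F]
    exact he₀.2 i j hij

/-- The Jacobi operator in a frame as in `exists_parallel_frame`. -/
theorem jacobiOperator_frame {n : ℕ} (hdim : Module.finrank ℝ E = 2 + n) {x : M} {u : E}
    {κ ρ : ℝ} {e : Fin n → E} (he : IsOrthonormalFor (S.form x) (Sum.elim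
      ![S.reeb x, ρ⁻¹ • (u + (-κ) • S.reeb x)] e)) :
    (∀ v, jacobiOperator hD.smooth x u v =
      ∑ j, S.form x (jacobiOperator hD.smooth x u v) (e j) • e j) ∧
    LinearMap.trace ℝ E (jacobiOperator hD.smooth x u) =
      ∑ j, S.form x (jacobiOperator hD.smooth x u (e j)) (e j) := by
  have hcard : Fintype.card (Fin 2 ⊕ Fin n) = Module.finrank ℝ E := by simp [hdim]
  have h1 := hD.jacobiOperator_reeb hS x u
  have h2 : jacobiOperator hD.smooth x u (ρ⁻¹ • (u + (-κ) • S.reeb x)) = 0 := by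
    rw [map_smul, map_add, map_smul, h1, jacobiOperator_self]
    simp
  constructor
  · intro v
    have h3 := he.sum_apply_smul hcard (jacobiOperator hD.smooth x u v)
    -- By symmetry of the operator, the components of its values along ξ and along the horizontal
    -- velocity are governed by its values on these two vectors, which are zero.
    have h4 : S.form x (jacobiOperator hD.smooth x u v) (S.reeb x) = 0 := by
      rw [hD.form_jacobiOperator hS, h1, map_zero]
    have h5 : S.form x (jacobiOperator hD.smooth x u v) (ρ⁻¹ • (u + (-κ) • S.reeb x)) = 0 := by
      rw [hD.form_jacobiOperator hS, h2, map_zero]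
    rw [Fintype.sum_sum_type, Fin.sum_univ_two] at h3
    simp only [Sum.elim_inl, Sum.elim_inr, Matrix.cons_val_zero, Matrix.cons_val_one, h4, h5,
      zero_smul, zero_add] at h3
    exact h3.symm
  · rw [he.trace_eq hcard, Fintype.sum_sum_type, Fin.sum_univ_two]
    simp only [Sum.elim_inl, Sum.elim_inr, Matrix.cons_val_zero, Matrix.cons_val_one, h1, h2,
      map_zero, _root_.zero_apply, zero_add]

/-- The lower bound for the trace of the Jacobi operator. -/
theorem le_trace_jacobiOperator {K : ℝ}
    (hRic : ∀ (x : M) (u : E), S.θ x u = 0 → K * S.metric x u u ≤ ricci D x u u)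
    {x : M} {u : E} {κ : ℝ} (hunit : S.form x u u = 1) (hκ : S.form x u (S.reeb x) = κ) :
    K * (1 - κ ^ 2) ≤ LinearMap.trace ℝ E (jacobiOperator hD.smooth x u) := by
  have h1 := form_reeb_reeb (S := S) x
  have h2 : S.form x (S.reeb x) u = κ := (form_symm x _ _).trans hκ
  have h3 : S.form x (u + (-κ) • S.reeb x) (S.reeb x) = 0 := by
    rw [map_add, map_smul, _root_.add_apply, _root_.smul_apply, hκ, h1]
    simp
  have h4 : S.form x (u + (-κ) • S.reeb x) (u + (-κ) • S.reeb x) = 1 - κ ^ 2 := by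
    simp only [map_add, map_smul, _root_.add_apply, _root_.smul_apply, smul_eq_mul, hunit, hκ, h1,
      h2]
    ring
  -- The bound is applied to u - κξ, whose squared length is 1 - κ²; the Jacobi operator is the same
  -- as that of u.
  have h5 := hRic x (u + (-κ) • S.reeb x) ((form_reeb_right x _).symm.trans h3)
  rw [ricci_eq_trace hD.smooth, hD.jacobiOperator_add_reeb hS, ← form_eq_metric, h4] at h5
  exact h5

theorem isJacobiField_of {s : Set ℝ} {V W : ℝ → E}
    (hV : ∀ t ∈ s, HasFieldDeriv D c V (W t) s t)
    (hW : ∀ t ∈ s, HasFieldDeriv D c W (-jacobiOperator hD.smooth (c t).1 (c t).2 (V t) +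
      (-2 * S.form (c t).1 (c t).2 (S.endo (c t).1 (W t))) • S.reeb (c t).1) s t) :
    IsJacobiField D c V W s := by
  refine ⟨hV, fun t ht ↦ ?_⟩
  have h1 := hW t ht
  rw [← hD.torsion_eq hS] at h1
  exact h1

/-- Under a lower Ricci bound, a sufficiently long non-vertical geodesic carries a nontrivial Jacobi
field with two zeros. -/
theorem exists_jacobiField {n : ℕ} (hn : 0 < n) (hdim : Module.finrank ℝ E = 2 + n) {k₀ κ : ℝ}
    (hk₀ : 0 < k₀)
    (hRic : ∀ (x : M) (u : E), S.θ x u = 0 → n * k₀ * S.metric x u u ≤ ricci D x u u)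
    (hab : a ≤ b) (h : IsSprayCurve D c (Icc a b))
    (hunit : S.form (c a).1 (c a).2 (c a).2 = 1)
    (hκ : S.form (c a).1 (c a).2 (S.reeb (c a).1) = κ) (hκ1 : κ ^ 2 < 1)
    (hlen : Real.pi / √(k₀ * (1 - κ ^ 2)) ≤ b - a) :
    ∃ V W : ℝ → E, IsJacobiField D c V W (Icc a b) ∧ V a = 0 ∧ W a ≠ 0 ∧
      ∃ t ∈ Ioc a b, V t = 0 := by
  have hρ0 : 0 < √(1 - κ ^ 2) := Real.sqrt_pos.2 (sub_pos.2 hκ1)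
  obtain ⟨e, he, hframe⟩ := hD.exists_parallel_frame hS hdim hab h
    (Real.sq_sqrt (sub_pos.2 hκ1).le) hρ0 hunit hκ
  have hu : ∀ t ∈ Icc a b, HasFieldDeriv D c (fun t ↦ (c t).2) 0 (Icc a b) t := h
  have hunit' : ∀ t ∈ Icc a b, S.form (c t).1 (c t).2 (c t).2 = 1 := fun t ht ↦
    (hD.form_eq_of_parallel h hu hu t ht).trans hunit
  have hκ' : ∀ t ∈ Icc a b, S.form (c t).1 (c t).2 (S.reeb (c t).1) = κ := fun t ht ↦
    (hD.form_eq_of_parallel h hu (fun t ht ↦ hD.hasFieldDeriv_reeb h ht) t ht).trans hκ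
  obtain ⟨A, hA⟩ : ∃ A : ℝ → Matrix (Fin n) (Fin n) ℝ, ∀ t i j, A t i j =
      S.form (c t).1 (jacobiOperator hD.smooth (c t).1 (c t).2 (e i t)) (e j t) :=
    ⟨fun t ↦ Matrix.of fun i j ↦ S.form (c t).1 (jacobiOperator hD.smooth (c t).1 (c t).2 (e i t))
      (e j t), fun _ _ _ ↦ rfl⟩
  have hAsymm : ∀ t i j, A t i j = A t j i := fun t i j ↦ by
    rw [hA, hA, hD.form_jacobiOperator hS, form_symm]
  have hAc : ∀ i j, ContinuousOn (fun t ↦ A t i j) (Icc a b) := fun i j t ht ↦ by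
    simp only [hA]
    exact continuousWithinAt_form_jacobiOperator hD.smooth h ht (he i t ht) (he j t ht)
  have hAtr : ∀ t ∈ Icc a b, n * (k₀ * (1 - κ ^ 2)) ≤ (A t).trace := fun t ht ↦ by
    rw [← mul_assoc]
    refine (hD.le_trace_jacobiOperator hS hRic (hunit' t ht) (hκ' t ht)).trans_eq ?_
    rw [(hD.jacobiOperator_frame hS hdim (hframe t ht)).2]
    simp only [Matrix.trace, Matrix.diag, hA]
  obtain ⟨α, β, hαa, hβa, hα, hβ, t₁, ht₁, hαt₁⟩ := exists_jacobi_system_zero (S := A) hn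
    (mul_pos hk₀ (sub_pos.2 hκ1)) hlen hAc
    (fun t _ ↦ Matrix.IsSymm.ext fun i j ↦ hAsymm t j i) hAtr
  set U : ℝ → E := fun t ↦ ∑ i, α t i • e i t with hU
  set Z : ℝ → E := fun t ↦ ∑ i, β t i • e i t with hZ
  have hUd : ∀ t ∈ Icc a b, HasFieldDeriv D c U (Z t) (Icc a b) t := fun t ht ↦ by
    have h1 := HasFieldDeriv.sum h ht Finset.univ fun i _ ↦
      HasFieldDeriv.smul h ht (hα t ht i) (he i t ht)
    simpa only [smul_zero, add_zero] using h1
  have hZd : ∀ t ∈ Icc a b, HasFieldDeriv D c Z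
      (∑ i, (-∑ j, A t i j * α t j) • e i t) (Icc a b) t := fun t ht ↦ by
    have h1 := HasFieldDeriv.sum h ht Finset.univ fun i _ ↦
      HasFieldDeriv.smul h ht (hβ t ht i) (he i t ht)
    simpa only [smul_zero, add_zero] using h1
  -- Since γ' and J are parallel, φ' = -2⟨γ', JZ⟩, the vertical part of the Jacobi equation. A
  -- vertical component f with f' = φ + k therefore solves it for any constant k.
  set φ : ℝ → ℝ := fun t ↦ -2 * S.form (c t).1 (c t).2 (S.endo (c t).1 (U t)) with hφ
  have hφd : ∀ t ∈ Icc a b, HasDerivWithinAt φ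
      (-2 * S.form (c t).1 (c t).2 (S.endo (c t).1 (Z t))) (Icc a b) t := fun t ht ↦ by
    have h1 := hD.hasDerivWithinAt_form h ht (hu t ht) (hD.hasFieldDeriv_endo h ht (hUd t ht))
    refine (h1.const_mul (-2)).congr_deriv ?_
    rw [map_zero, _root_.zero_apply, zero_add]
  -- The free constant k makes f vanish at t₁ as well as at a, so the vertical direction does not
  -- delay the second zero.
  obtain ⟨f, k, hfa, hft₁, hf⟩ := exists_primitive_zero
    (fun t ht ↦ (hφd t ht).continuousWithinAt) ht₁
  refine ⟨fun t ↦ U t + f t • S.reeb (c t).1, fun t ↦ Z t + (φ t + k) • S.reeb (c t).1,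
    hD.isJacobiField_of hS (fun t ht ↦ ?_) (fun t ht ↦ ?_), ?_, ?_, t₁, ht₁, ?_⟩
  · have h1 := HasFieldDeriv.add h ht (hUd t ht)
      (HasFieldDeriv.smul h ht (hf t ht) (hD.hasFieldDeriv_reeb h ht))
    simpa only [smul_zero, add_zero] using h1
  · have h1 := HasFieldDeriv.add h ht (hZd t ht)
      (HasFieldDeriv.smul h ht ((hφd t ht).add_const k) (hD.hasFieldDeriv_reeb h ht))
    have h2 : jacobiOperator hD.smooth (c t).1 (c t).2 (U t + f t • S.reeb (c t).1) =
        ∑ i, (∑ j, A t i j * α t j) • e i t := by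
      rw [map_add, map_smul, hD.jacobiOperator_reeb hS, smul_zero, add_zero, hU, map_sum]
      have h3 : ∀ i, jacobiOperator hD.smooth (c t).1 (c t).2 (α t i • e i t) =
          α t i • ∑ j, A t i j • e j t := fun i ↦ by
        rw [map_smul]
        rw [(hD.jacobiOperator_frame hS hdim (hframe t ht)).1 (e i t)]
        simp only [hA]
      simp only [h3, Finset.smul_sum, Finset.sum_smul, smul_smul]
      rw [Finset.sum_comm]
      refine Finset.sum_congr rfl fun i _ ↦ Finset.sum_congr rfl fun j _ ↦ ?_
      rw [hAsymm t i j, mul_comm]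
    -- The vertical part of W disappears from the torsion term since Jξ = 0; likewise the vertical
    -- part of V is killed by the Jacobi operator. The two equations decouple.
    have h5 : S.endo (c t).1 (S.reeb (c t).1) = 0 := S.J_ξ _
    rw [h2, map_add, map_smul, h5, smul_zero, add_zero]
    simpa only [smul_zero, add_zero, neg_smul, Finset.sum_neg_distrib] using h1
  · simp [hU, hαa, hfa]
  · intro h0
    have ha : a ∈ Icc a b := ⟨le_rfl, hab⟩
    refine hβa (funext fun i ↦ ?_)
    -- Pairing W(a) with eᵢ recovers βᵢ(a), whatever the vertical component is, so W(a) = 0 would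
    -- contradict β a ≠ 0.
    have h1 := (hframe a ha).apply_sum (Sum.elim ![φ a + k, 0] (β a)) (Sum.inr i)
    rw [Fintype.sum_sum_type, Fin.sum_univ_two] at h1
    simp only [Sum.elim_inl, Sum.elim_inr, Matrix.cons_val_zero, Matrix.cons_val_one, zero_smul,
      add_zero] at h1
    rw [← h1, add_comm]
    replace h0 : Z a + (φ a + k) • S.reeb (c a).1 = 0 := h0
    change S.form (c a).1 (Z a + (φ a + k) • S.reeb (c a).1) (e i a) = 0
    rw [h0, map_zero, _root_.zero_apply]
  · simp [hU, hαt₁, hft₁]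

end IsTanakaWebster

end PseudoHermitian

end Comparison

end CRGeometry

end

theorem theorem5p4 {E : Type*} [NormedAddCommGroup E] [NormedSpace ℝ E] [FiniteDimensional ℝ E]
    {M : Type*} [TopologicalSpace M] [T2Space M] [ChartedSpace E M] [IsManifold 𝓘(ℝ, E) ∞ M]
    (m : ℕ) (hdim : Module.finrank ℝ E = 2 * m + 1)
    (S : CRGeometry.PseudoHermitian E M)
    (D : CovariantDerivative 𝓘(ℝ, E) E (TangentSpace 𝓘(ℝ, E) : M → Type _))
    (hD : S.IsTanakaWebster D) (hS : S.IsSasakian D)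
    (k₀ : ℝ) (hk₀ : 0 < k₀)
    (hRic : ∀ (x : M) (u : TangentSpace 𝓘(ℝ, E) x), S.θ x u = 0 →
      (2 * (m : ℝ) - 1) * k₀ * S.metric x u u ≤ CRGeometry.ricci D x u u)
    (a b : ℝ) (γ : ℝ → M) (hγ : CRGeometry.IsGeodesicOn D γ (Icc a b))
    (harc : ∀ t ∈ Icc a b,
      S.metric (γ t) (CRGeometry.velocity E γ (Icc a b) t)
        (CRGeometry.velocity E γ (Icc a b) t) = 1)
    (hvert : S.metric (γ a) (CRGeometry.velocity E γ (Icc a b) a) (S.ξ (γ a)) ^ 2 < 1)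
    (hlen : Real.pi / √(k₀ *
      (1 - S.metric (γ a) (CRGeometry.velocity E γ (Icc a b) a) (S.ξ (γ a)) ^ 2)) ≤ b - a) :
    ∃ t ∈ Ioc a b, CRGeometry.IsConjugateAlong D γ a b t := by
  have huc := CRGeometry.IsSprayCurve.of_isGeodesicOn hγ
  set κ := S.metric (γ a) (CRGeometry.velocity E γ (Icc a b) a) (S.ξ (γ a)) with hκ
  have hk : 0 < k₀ * (1 - κ ^ 2) := mul_pos hk₀ (sub_pos.2 hvert)
  have hab : a < b := sub_pos.1 ((div_pos Real.pi_pos (Real.sqrt_pos.2 hk)).trans_le hlen)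
  have hκ' := (S.form_eq_metric (γ a) (CRGeometry.velocity E γ (Icc a b) a) (S.reeb (γ a))).trans
    hκ.symm
  have hunit := (S.form_eq_metric (γ a) (CRGeometry.velocity E γ (Icc a b) a)
    (CRGeometry.velocity E γ (Icc a b) a)).trans (harc a ⟨le_rfl, hab.le⟩)
  -- The Reeb vector and the horizontal velocity are independent, so 2m + 1 ≥ 2 and m ≥ 1. The
  -- remaining 2m - 1 frame vectors, written 2n + 1 with m = n + 1, are thus positive in number, as
  -- the trace comparison requires.
  have h2 := (CRGeometry.PseudoHermitian.isOrthonormalFor_pair (Real.sq_sqrt (sub_pos.2 hvert).le)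
    (Real.sqrt_pos.2 (sub_pos.2 hvert)) hunit hκ').linearIndependent.fintype_card_le_finrank
  rw [Fintype.card_fin, hdim] at h2
  obtain ⟨n, rfl⟩ : ∃ n, m = n + 1 := ⟨m - 1, by omega⟩
  obtain ⟨V, W, hJ, hVa, hWa, t, ht, hVt⟩ := hD.exists_jacobiField hS (n := 2 * n + 1)
    (Nat.succ_pos _) (by rw [hdim]; ring) hk₀
    (fun x u hu ↦ by
      refine le_trans (le_of_eq ?_) (hRic x u hu)
      push_cast
      ring) hab.le huc hunit hκ' hvert hlen
  exact ⟨t, ht, CRGeometry.isConjugateAlong_of_jacobi hD.smooth (hD.hasParallelTorsion hS) hγ hJ ht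
    hVa hVt hWa⟩
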